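/- Let $M$ be a smooth ($C^\infty$, Hausdorff, finite-dimensional) manifold without boundary, $U\subset M$ open, $X$ a smooth vector field on $U$ and $\mathcal V$ a smooth distribution of rank $m$ on $U$. Let $\mathcal D=\mathcal V+[X,\mathcal V]$ be the family of subspaces $\mathcal D(x)\subset T_xM$ spanned by $V(x)$ and $[X,V](x)$ for all smooth local sections $V$ of $\mathcal V$ near $x$. Assume that the pair $(X,\mathcal V)$ is regular on $U$, i.e. $X(x)\ne0$ and $\dim\mathcal D(x)=2m$ for all $x\in U$, and $[X,\mathcal D]\subset\mathcal D$. If $\hat V=(V_1,\dots,V_m)$ is a smooth local frame of $\mathcal V$, then $[X,[X,\hat V]]=\hat V H_0+[X,\hat V]H_1$ for unique $m\times m$ matrices $H_0,H_1$ of smooth functions; the curvature operator $K_x:\mathcal V(x)\to\mathcal V(x)$ is the endomorphism whose matrix in the frame $\hat V$ is $-H_0+\frac12X(H_1)-\frac14H_1^2$ (it does not depend on the frame). Let $\mathcal H(x)$ be the span of the vectors $[X,V](x)$ for smooth local sections $V$ of $\mathcal V$ near $x$ with $[X,[X,V]](x)\in\mathcal V(x)$. Then $\mathcal D=\mathcal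 V\oplus\mathcal H$; with $\pi_{\mathcal V}:\mathcal D\to\mathcal V$ the corresponding projection, put $D_XV=\pi_{\mathcal V}[X,V]$ for sections $V$ of $\mathcal V$. Let $T\in(0,\infty]$ and let $c:[0,T)\to U$ be an integral curve of $X$ that is not closed, i.e. $c(t)\neq c(0)$ for $0<t<T$. Suppose that along $c$ there is a positive definite metric $g$ on $\mathcal V$ (a scalar product on each $\mathcal V(c(t))$, $t\in[0,T)$) which is parallel with respect to $D_X$, i.e. along $c$ $$X(g(Y,Z))=g(D_XY,Z)+g(Y,D_XZ)$$ for all smooth local sections $Y,Z$ of $\mathcal V$, such that $K$ is symmetric with respect to $g$ along $c$, that is, $g(Kv,w)=g(v,Kw)$ for all $v,w\in\mathcal V(c(t))$, $t\in[0,T)$. Suppose moreover that for some constant $\kappa$ $$\operatorname{tr}K_{c(t)}\ge\kappa>0\qquad\text{for all }t\in[0,T).$$ Put $T^*=\pi\sqrt{m/\kappa}$. If $T^*<T$, then there is a conjugate time in the interval $(0,T^*]$: there is $t^*\in(0,T^*]$ with $$\exp(t^*X)_*\mathcal V(c(0))\cap\mathcal V(c(t^*))\neq\{0\},$$ where $\exp(tX)$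 is the local flow of $X$. -/

import Mathlib

/-!
Dynamic pairs `(X, 𝒱)` on a smooth manifold without boundary modelled on a finite-dimensional
real vector space `E`: regularity, curvature operator, covariant derivative along `X`, parallel
metrics along a trajectory, and conjugate times.
-/

open scoped Manifold ContDiff
open VectorField

noncomputable section

namespace DynamicPair

variable {E : Type*} [NormedAddCommGroup E] [NormedSpace ℝ E]
  {M : Type*} [TopologicalSpace M] [ChartedSpace E M]

/-- A section `Y` of a field of tangent subspaces `Δ` is smooth on `N`. (A local section on an open
set `N` is represented by a function on all of `M`, whose values outside `N` play no role.) -/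
def IsSmoothSectionOn [IsManifold 𝓘(ℝ, E) ∞ M]
    (Δ : ∀ x : M, Submodule ℝ (TangentSpace 𝓘(ℝ, E) x)) (Y : ∀ x, Δ x) (N : Set M) : Prop :=
  ContMDiffOn 𝓘(ℝ, E) 𝓘(ℝ, E).tangent ∞
    (fun x => (⟨x, (Y x : TangentSpace 𝓘(ℝ, E) x)⟩ : TangentBundle 𝓘(ℝ, E) M)) N

/-- The Lie bracket `[X, Y]` with a section `Y` of `Δ`. -/
def adX (X : ∀ x : M, TangentSpace 𝓘(ℝ, E) x)
    {Δ : ∀ x : M, Submodule ℝ (TangentSpace 𝓘(ℝ, E) x)} (Y : ∀ x, Δ x) :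
    ∀ x : M, TangentSpace 𝓘(ℝ, E) x :=
  mlieBracket 𝓘(ℝ, E) X (fun x => (Y x : TangentSpace 𝓘(ℝ, E) x))

/-- The iterated Lie bracket `[X, [X, Y]]` with a section `Y` of `Δ`. -/
def adX2 (X : ∀ x : M, TangentSpace 𝓘(ℝ, E) x)
    {Δ : ∀ x : M, Submodule ℝ (TangentSpace 𝓘(ℝ, E) x)} (Y : ∀ x, Δ x) :
    ∀ x : M, TangentSpace 𝓘(ℝ, E) x :=
  mlieBracket 𝓘(ℝ, E) X (adX X Y)

/-- `W = (W₁, …, Wₘ)` is a smooth frame of `𝒱` on `N`. -/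
structure IsFrameOn [IsManifold 𝓘(ℝ, E) ∞ M]
    (𝒱 : ∀ x : M, Submodule ℝ (TangentSpace 𝓘(ℝ, E) x)) {m : ℕ}
    (W : Fin m → ∀ x, 𝒱 x) (N : Set M) : Prop where
  smooth : ∀ i, IsSmoothSectionOn 𝒱 (W i) N
  linearIndependent : ∀ x ∈ N, LinearIndependent ℝ (fun i => W i x)
  span_eq_top : ∀ x ∈ N, Submodule.span ℝ (Set.range fun i => W i x) = ⊤

/-- The distribution `𝒟 = 𝒱 + [X, 𝒱]`: its value at `x` is spanned by `Y(x)` and `[X, Y](x)`, for all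
smooth local sections `Y` of `𝒱` near `x`. -/
def distD [IsManifold 𝓘(ℝ, E) ∞ M] (X : ∀ x : M, TangentSpace 𝓘(ℝ, E) x)
    (𝒱 : ∀ x : M, Submodule ℝ (TangentSpace 𝓘(ℝ, E) x)) (x : M) :
    Submodule ℝ (TangentSpace 𝓘(ℝ, E) x) :=
  Submodule.span ℝ {w | ∃ (N : Set M) (Y : ∀ y, 𝒱 y), IsOpen N ∧ x ∈ N ∧
    IsSmoothSectionOn 𝒱 Y N ∧ (w = Y x ∨ w = adX X Y x)}

/-- `(X, 𝒱)` is a regular dynamic pair on the open set `U`, with `𝒱` of rank `m`. -/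
structure IsRegularOn [IsManifold 𝓘(ℝ, E) ∞ M] (X : ∀ x : M, TangentSpace 𝓘(ℝ, E) x)
    (𝒱 : ∀ x : M, Submodule ℝ (TangentSpace 𝓘(ℝ, E) x)) (m : ℕ) (U : Set M) : Prop where
  /-- `X` is a smooth vector field on `U` -/
  smooth_field : ContMDiffOn 𝓘(ℝ, E) 𝓘(ℝ, E).tangent ∞
    (fun x => (⟨x, X x⟩ : TangentBundle 𝓘(ℝ, E) M)) U
  /-- `𝒱` is a smooth distribution of rank `m` on `U` -/
  smooth_distribution : ∀ x ∈ U, ∃ (N : Set M) (W : Fin m → ∀ y, 𝒱 y),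
    IsOpen N ∧ x ∈ N ∧ IsFrameOn 𝒱 W N
  /-- (R1) -/
  field_ne_zero : ∀ x ∈ U, X x ≠ 0
  /-- (R2) -/
  rank_distD : ∀ x ∈ U, Module.finrank ℝ (distD X 𝒱 x) = 2 * m
  /-- (I): `[X, 𝒟] ⊆ 𝒟` -/
  invariance : ∀ (N : Set M) (Z : ∀ y, distD X 𝒱 y), IsOpen N → N ⊆ U →
    IsSmoothSectionOn (distD X 𝒱) Z N → ∀ x ∈ N, adX X Z x ∈ distD X 𝒱 x

/-- The structure equation `[X, [X, W]] = W H₀ + [X, W] H₁` of a frame `W`, at the point `x`. -/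
def StructureEq (X : ∀ x : M, TangentSpace 𝓘(ℝ, E) x)
    {𝒱 : ∀ x : M, Submodule ℝ (TangentSpace 𝓘(ℝ, E) x)} {m : ℕ} (W : Fin m → ∀ x, 𝒱 x)
    (H₀ H₁ : M → Matrix (Fin m) (Fin m) ℝ) (x : M) : Prop :=
  ∀ j, adX2 X (W j) x =
    ∑ i, H₀ x i j • (W i x : TangentSpace 𝓘(ℝ, E) x) + ∑ i, H₁ x i j • adX X (W i) x

/-- The curvature matrix `-H₀ + (1/2) X(H₁) - (1/4) H₁²` at the point `x`. -/
def curvatureMatrix (X : ∀ x : M, TangentSpace 𝓘(ℝ, E) x) {m : ℕ}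
    (H₀ H₁ : M → Matrix (Fin m) (Fin m) ℝ) (x : M) : Matrix (Fin m) (Fin m) ℝ :=
  -H₀ x + (1 / 2 : ℝ) • Matrix.of (fun i j => mvfderiv 𝓘(ℝ, E) (fun y => H₁ y i j) x (X x))
    - (1 / 4 : ℝ) • (H₁ x * H₁ x)

/-- `K` is the endomorphism of `𝒱(x)` which, in every smooth local frame of `𝒱` near `x`, is given by
the curvature matrix of that frame. -/
def IsCurvatureAt [IsManifold 𝓘(ℝ, E) ∞ M] (X : ∀ x : M, TangentSpace 𝓘(ℝ, E) x)
    (𝒱 : ∀ x : M, Submodule ℝ (TangentSpace 𝓘(ℝ, E) x)) (m : ℕ) (x : M)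
    (K : 𝒱 x →ₗ[ℝ] 𝒱 x) : Prop :=
  ∀ (N : Set M) (W : Fin m → ∀ y, 𝒱 y) (H₀ H₁ : M → Matrix (Fin m) (Fin m) ℝ),
    IsOpen N → x ∈ N → IsFrameOn 𝒱 W N → (∀ y ∈ N, StructureEq X W H₀ H₁ y) →
      ∀ j, K (W j x) = ∑ i, curvatureMatrix X H₀ H₁ x i j • W i x

/-- The curvature operator `K_x : 𝒱(x) → 𝒱(x)`. For a regular pair it is the unique endomorphism
satisfying `IsCurvatureAt`. -/
def curvature [IsManifold 𝓘(ℝ, E) ∞ M] (X : ∀ x : M, TangentSpace 𝓘(ℝ, E) x)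
    (𝒱 : ∀ x : M, Submodule ℝ (TangentSpace 𝓘(ℝ, E) x)) (m : ℕ) (x : M) : 𝒱 x →ₗ[ℝ] 𝒱 x :=
  Classical.epsilon (IsCurvatureAt X 𝒱 m x)

/-- The section `Y` of `𝒱` is normal at `x`: `[X, [X, Y]](x) ∈ 𝒱(x)`. A local section is normal if it
is normal at every point of its domain. -/
def IsNormalAt (X : ∀ x : M, TangentSpace 𝓘(ℝ, E) x)
    {𝒱 : ∀ x : M, Submodule ℝ (TangentSpace 𝓘(ℝ, E) x)} (Y : ∀ x, 𝒱 x) (x : M) : Prop :=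
  adX2 X Y x ∈ 𝒱 x

/-- The horizontal space `ℋ(x)`, spanned by the values `[X, Y](x)` for smooth local sections `Y` of
`𝒱` that are normal at `x`. If `W` is a frame with structure matrices `H₀, H₁` and `Y = W f`, then
normality of `Y` at `x` says `X(f) = -(1/2) H₁ f` at `x`, and then
`[X, Y] = ([X, W] - (1/2) W H₁) f` at `x`; so `ℋ(x)` is the span of `[X, W] - (1/2) W H₁` at `x`, and
the same space arises from sections that are normal on a whole neighbourhood of `x`. -/
def horizontal [IsManifold 𝓘(ℝ, E) ∞ M] (X : ∀ x : M, TangentSpace 𝓘(ℝ, E) x)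
    (𝒱 : ∀ x : M, Submodule ℝ (TangentSpace 𝓘(ℝ, E) x)) (x : M) :
    Submodule ℝ (TangentSpace 𝓘(ℝ, E) x) :=
  Submodule.span ℝ {w | ∃ (N : Set M) (Y : ∀ y, 𝒱 y), IsOpen N ∧ x ∈ N ∧
    IsSmoothSectionOn 𝒱 Y N ∧ IsNormalAt X Y x ∧ w = adX X Y x}

/-- The covariant derivative `D_X Y = π_𝒱 [X, Y]` at `x`, where `π_𝒱` is the projection of
`𝒟 = 𝒱 ⊕ ℋ` onto `𝒱`: the vector `v ∈ 𝒱(x)` with `[X, Y](x) - v ∈ ℋ(x)`. -/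
def covDeriv [IsManifold 𝓘(ℝ, E) ∞ M] (X : ∀ x : M, TangentSpace 𝓘(ℝ, E) x)
    {𝒱 : ∀ x : M, Submodule ℝ (TangentSpace 𝓘(ℝ, E) x)} (Y : ∀ x, 𝒱 x) (x : M) : 𝒱 x :=
  Classical.epsilon fun v : 𝒱 x => adX X Y x - (v : TangentSpace 𝓘(ℝ, E) x) ∈ horizontal X 𝒱 x

/-- A positive definite metric on `𝒱` along the curve `c : J → M`: a scalar product on each
`𝒱(c(t))`, `t ∈ J`. -/
def IsPosDefMetricAlong (𝒱 : ∀ x : M, Submodule ℝ (TangentSpace 𝓘(ℝ, E) x)) (c : ℝ → M)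
    (J : Set ℝ) (g : ∀ t : ℝ, LinearMap.BilinForm ℝ (𝒱 (c t))) : Prop :=
  ∀ t ∈ J, (∀ v w, g t v w = g t w v) ∧ ∀ v, v ≠ 0 → 0 < g t v v

/-- The metric `g` along the integral curve `c : J → M` of `X` is parallel with respect to `D_X`:
`X(g(Y, Z)) = g(D_X Y, Z) + g(Y, D_X Z)` along `c`. In a local frame this is a linear differential
equation for the matrix of `g` with smooth coefficients, so `g` is smooth along `c`. -/
def IsParallelAlong [IsManifold 𝓘(ℝ, E) ∞ M] (X : ∀ x : M, TangentSpace 𝓘(ℝ, E) x)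
    (𝒱 : ∀ x : M, Submodule ℝ (TangentSpace 𝓘(ℝ, E) x)) (c : ℝ → M)
    (J : Set ℝ) (g : ∀ t : ℝ, LinearMap.BilinForm ℝ (𝒱 (c t))) : Prop :=
  ∀ t ∈ J, ∀ (N : Set M) (Y Z : ∀ y, 𝒱 y), IsOpen N → c t ∈ N →
    IsSmoothSectionOn 𝒱 Y N → IsSmoothSectionOn 𝒱 Z N →
      HasDerivWithinAt (fun s => g s (Y (c s)) (Z (c s)))
        (g t (covDeriv X Y (c t)) (Z (c t)) + g t (Y (c t)) (covDeriv X Z (c t))) J t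

/-- `γ : [0, t] → U` is an integral curve of `X` starting from `y`. -/
def IsTrajectory (X : ∀ x : M, TangentSpace 𝓘(ℝ, E) x) (U : Set M) (t : ℝ) (y : M)
    (γ : ℝ → M) : Prop :=
  γ 0 = y ∧ IsMIntegralCurveOn γ X (Set.Icc 0 t) ∧ Set.MapsTo γ (Set.Icc 0 t) U

open Classical in
/-- The flow `exp(tX)` of the vector field `X` on `U`, for `t ≥ 0`: the point `y` is sent to `γ(t)`,
where `γ : [0, t] → U` is the integral curve of `X` with `γ(0) = y`. At points `y` where there is no
such curve, the value is irrelevant. -/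
def flow (X : ∀ x : M, TangentSpace 𝓘(ℝ, E) x) (U : Set M) (t : ℝ) (y : M) : M :=
  if h : ∃ γ : ℝ → M, IsTrajectory X U t y γ then h.choose t else y

/-- `t` is a conjugate time for the trajectory of `X` in `U` starting from `x₀`:
`exp(tX)_* 𝒱(x₀) ∩ 𝒱(exp(tX)(x₀)) ≠ {0}`. -/
def IsConjugateTime (X : ∀ x : M, TangentSpace 𝓘(ℝ, E) x)
    (𝒱 : ∀ x : M, Submodule ℝ (TangentSpace 𝓘(ℝ, E) x)) (U : Set M) (x₀ : M) (t : ℝ) : Prop :=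
  0 < t ∧
    (𝒱 x₀).map (mfderiv 𝓘(ℝ, E) 𝓘(ℝ, E) (flow X U t) x₀).toLinearMap ⊓ 𝒱 (flow X U t x₀) ≠ ⊥

/-- The interval `[0, T)`, with `T ≤ ∞`. -/
def timeInterval (T : EReal) : Set ℝ := {t | 0 ≤ t ∧ (t : EReal) < T}

end DynamicPair

end

/-! The flow of `X` pulls tangent vectors along `c` back to the fixed space at `c 0`, and under this
pull-back the bracket with `X` becomes the time derivative (`exists_pullback`). For a local frame
`W` of `𝒱`, the fields `h = [X, W] - (1/2) W H₁` (`hor`) form a frame of `ℋ`, and `[X, W] = h +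
(1/2) W H₁`, `[X, h] = -W K + (1/2) h H₁` (`mlieBracket_hor`). This is the Jacobi equation as a
first-order system. It also shows that the flow preserves `𝒱 ⊕ ℋ` (`IsPullback.forall_mem_eq_zero`),
so a vertical vector pulled back to `c 0` is vertical there as soon as its component along `ℋ(c 0)`
vanishes. Let `Q` and `N` be the matrices of these components for `W` and `h`. Then `Q' = N + (1/2)
Q H₁` and `N' = -Q K + (1/2) N H₁`; in a suitable frame at time `0`, `Q = 0` and `N = 1`; and any `t
> 0` with `Q t` singular is a conjugate time.

Suppose that no conjugate time occurs in `(0, T*]`. Then `S = N Q⁻¹` exists there and solves the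
Riccati equation `S' = -Q K Q⁻¹ - S²`. With `G` the inverse Gram matrix of `g`, parallelism of `g`
and symmetry of `K` make `N G Qᵀ - Q G Nᵀ` constant, hence zero. So `S` is symmetric for a scalar
product, and Cauchy-Schwarz gives `(tr S)² ≤ m tr (S²)` (`trace_sq_le_card_mul_trace`). With `κ = m
k²` the trace `φ = tr S` satisfies `φ' ≤ -m k² - φ²/m` and starts from a simple pole. The comparison
function `m k cot (k t)` tends to `-∞` at `π / k = T*`, while `φ` is finite there. The contradiction
is drawn in `JacobiData.false_of_forall_exists` from the nonincreasing function `sin² (k t) (φ - m k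
cot (k t))`, which vanishes at both ends of `[0, π / k]`.

Frames of `𝒱` are only local, so the objects followed over the whole interval are `S` and `N G Qᵀ`,
on which a change of frame has no effect (`IsAdaptedFrame.invariants_eq`). The differential
equations are checked in a local frame near each time. -/

noncomputable section

open scoped Manifold ContDiff Topology
open VectorField Set Metric

namespace DynamicPair

/-! ### Differentiability of the flow in the model space -/

section LocalFlow

variable {E : Type*} [NormedAddCommGroup E] [NormedSpace ℝ E]

/-- First-order Taylor estimate for a map whose derivative is Lipschitz on a convex set. -/
lemma norm_sub_sub_fderiv_le {f : E → E} {s : Set E} {C : ℝ} (hs : Convex ℝ s) (hC : 0 ≤ C)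
    (hd : ∀ x ∈ s, DifferentiableAt ℝ f x)
    (hl : ∀ x ∈ s, ∀ y ∈ s, ‖fderiv ℝ f x - fderiv ℝ f y‖ ≤ C * ‖x - y‖)
    {a b : E} (ha : a ∈ s) (hb : b ∈ s) :
    ‖f b - f a - fderiv ℝ f a (b - a)‖ ≤ C * ‖b - a‖ ^ 2 := by
  have hseg : segment ℝ a b ⊆ s := hs.segment_subset ha hb
  have h := (convex_segment a b).norm_image_sub_le_of_norm_hasFDerivWithin_le'
    (f := f) (f' := fderiv ℝ f) (φ := fderiv ℝ f a) (C := C * ‖b - a‖)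
    (fun x hx => (hd x (hseg hx)).hasFDerivAt.hasFDerivWithinAt)
    (fun x hx => (hl x (hseg hx) a ha).trans (by
      gcongr
      exact norm_sub_le_of_mem_segment hx))
    (left_mem_segment ℝ a b) (right_mem_segment ℝ a b)
  calc _ ≤ _ := h
    _ = _ := by ring

/-- Differentiable dependence on the initial value at a fixed solution, given a solution of the
variational equation along it. -/
lemma hasFDerivAt_of_variational {f : E → E} {s : Set E} {C K L ε r : ℝ} {z₀ : E}
    (hs : Convex ℝ s) (hC : 0 ≤ C)
    (hd : ∀ x ∈ s, DifferentiableAt ℝ f x)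
    (hl : ∀ x ∈ s, ∀ y ∈ s, ‖fderiv ℝ f x - fderiv ℝ f y‖ ≤ C * ‖x - y‖)
    (hK : ∀ x ∈ s, ‖fderiv ℝ f x‖ ≤ K) (hK0 : 0 < K)
    {Φ : E → ℝ → E} {D : ℝ → E →L[ℝ] E}
    (h0 : ∀ y ∈ ball z₀ r, Φ y 0 = y)
    (hΦ : ∀ y ∈ ball z₀ r, ∀ t ∈ Ioo (-ε) ε, HasDerivAt (Φ y) (f (Φ y t)) t)
    (hΦs : ∀ y ∈ ball z₀ r, ∀ t ∈ Ioo (-ε) ε, Φ y t ∈ s)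
    (hL : ∀ y ∈ ball z₀ r, ∀ y' ∈ ball z₀ r, ∀ t ∈ Ioo (-ε) ε,
      ‖Φ y' t - Φ y t‖ ≤ L * ‖y' - y‖)
    {y : E} (hy : y ∈ ball z₀ r) (hD0 : D 0 = 1)
    (hD : ∀ t ∈ Ioo (-ε) ε, HasDerivAt D (fderiv ℝ f (Φ y t) ∘L D t) t)
    {t : ℝ} (ht : t ∈ Ico 0 ε) : HasFDerivAt (fun y => Φ y t) (D t) y := by
  have hsub : Icc 0 t ⊆ Ioo (-ε) ε := fun τ hτ =>
    ⟨by have := hτ.1; have := ht.1; have := ht.2; linarith, hτ.2.trans_lt ht.2⟩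
  -- The remainder of the first-order expansion in `y' - y` solves the linearised equation up to an
  -- error quadratic in `‖y' - y‖`, and it starts at zero; Grönwall's inequality keeps it quadratic.
  have key : ∀ y' ∈ ball z₀ r, ‖Φ y' t - Φ y t - D t (y' - y)‖
      ≤ C * L ^ 2 / K * (Real.exp (K * t) - 1) * ‖y' - y‖ ^ 2 := by
    intro y' hy'
    have hder : ∀ τ ∈ Ioo (-ε) ε, HasDerivAt (fun τ => Φ y' τ - Φ y τ - D τ (y' - y))
        (f (Φ y' τ) - f (Φ y τ) - (fderiv ℝ f (Φ y τ)) (D τ (y' - y))) τ := by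
      intro τ hτ
      have h := (hD τ hτ).clm_apply (hasDerivAt_const τ (y' - y))
      simpa using! ((hΦ y' hy' τ hτ).sub (hΦ y hy τ hτ)).sub h
    have := norm_le_gronwallBound_of_norm_deriv_right_le (a := 0) (b := t) (δ := 0) (K := K)
      (ε := C * L ^ 2 * ‖y' - y‖ ^ 2)
      (f := fun τ => Φ y' τ - Φ y τ - D τ (y' - y))
      (fun τ hτ => (hder τ (hsub hτ)).continuousAt.continuousWithinAt)
      (fun τ hτ => (hder τ (hsub (Ico_subset_Icc_self hτ))).hasDerivWithinAt)
      (by simp [h0 _ hy, h0 _ hy', hD0]) (fun τ hτ => ?_) t (right_mem_Icc.2 ht.1)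
    · rw [gronwallBound_of_K_ne_0 hK0.ne'] at this
      refine this.trans (le_of_eq ?_)
      simp only [sub_zero]
      ring
    · have hτ' := hsub (Ico_subset_Icc_self hτ)
      have e : f (Φ y' τ) - f (Φ y τ) - (fderiv ℝ f (Φ y τ)) (D τ (y' - y))
          = fderiv ℝ f (Φ y τ) (Φ y' τ - Φ y τ - D τ (y' - y))
            + (f (Φ y' τ) - f (Φ y τ) - fderiv ℝ f (Φ y τ) (Φ y' τ - Φ y τ)) := by
        simp only [map_sub]; abel
      rw [e]
      refine (norm_add_le _ _).trans (add_le_add ?_ ?_)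
      · exact (ContinuousLinearMap.le_opNorm _ _).trans (by
          gcongr
          exact hK _ (hΦs y hy τ hτ'))
      · refine (norm_sub_sub_fderiv_le hs hC hd hl (hΦs y hy τ hτ') (hΦs y' hy' τ hτ')).trans ?_
        rw [mul_assoc, ← mul_pow]
        gcongr
        exact hL y hy y' hy' τ hτ'
  rw [hasFDerivAt_iff_isLittleO]
  refine Asymptotics.IsBigO.trans_isLittleO (g := fun y' => ‖y' - y‖ ^ 2) ?_ ?_
  · refine Asymptotics.IsBigO.of_bound (C * L ^ 2 / K * (Real.exp (K * t) - 1)) ?_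
    filter_upwards [isOpen_ball.mem_nhds hy] with y' hy'
    simpa using key y' hy'
  · have := (Asymptotics.isLittleO_norm_pow_id (E' := E) one_lt_two).comp_tendsto
      (k := fun y' => y' - y) (l' := 𝓝 y) (by
        have : ContinuousAt (fun y' => y' - y) y := by fun_prop
        simpa [ContinuousAt] using this)
    simpa [Function.comp_def] using this

/-- A `C²` vector field has a local flow, differentiable in the initial value, whose derivative is
invertible and solves the variational equation. -/
theorem exists_local_flow [CompleteSpace E] {f : E → E} {z₀ : E} (hf : ContDiffAt ℝ 2 f z₀)
    {Ω : Set E} (hΩ : Ω ∈ 𝓝 z₀) :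
    ∃ ε > 0, ∃ r > 0, ∃ (Φ : E → ℝ → E) (D : E → ℝ → E →L[ℝ] E), ∀ y ∈ ball z₀ r,
      Φ y 0 = y ∧ D y 0 = 1 ∧ ∀ t ∈ Ioo (-ε) ε, Φ y t ∈ Ω ∧ HasDerivAt (Φ y) (f (Φ y t)) t ∧
        HasDerivAt (D y) (fderiv ℝ f (Φ y t) ∘L D y t) t ∧ IsUnit (D y t) ∧
        (0 ≤ t → HasFDerivAt (fun y => Φ y t) (D y t) y) := by
  have hf1 : ContDiffAt ℝ 1 (fderiv ℝ f) z₀ := hf.fderiv_right (by norm_num)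
  obtain ⟨C, s₁, hs₁, hC⟩ := hf1.exists_lipschitzOnWith
  have hdiff : ∀ᶠ x in 𝓝 z₀, DifferentiableAt ℝ f x :=
    (hf.eventually (by simp)).mono fun x hx => hx.differentiableAt (by norm_num)
  have hbd : ∀ᶠ x in 𝓝 z₀, ‖fderiv ℝ f x‖ < ‖fderiv ℝ f z₀‖ + 1 :=
    hf1.continuousAt.norm.eventually (gt_mem_nhds (by linarith))
  obtain ⟨ρ, hρ, hball⟩ := Metric.eventually_nhds_iff_ball.1
    ((hdiff.and hbd).and ((Filter.eventually_mem_set.2 hs₁).and (Filter.eventually_mem_set.2 hΩ)))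
  -- The field is coupled with its variational equation, so that one application of Picard-Lindelöf
  -- yields both the flow and the candidate for its derivative. `G` is `C¹` because `f` is `C²`.
  let G : E × (E →L[ℝ] E) → E × (E →L[ℝ] E) := fun p => (f p.1, fderiv ℝ f p.1 ∘L p.2)
  have hG : ContDiffAt ℝ 1 G (z₀, 1) := by
    refine ContDiffAt.prodMk ?_ ?_
    · exact (hf.of_le (by norm_num)).comp (z₀, (1 : E →L[ℝ] E)) contDiffAt_fst
    · exact (hf1.comp (z₀, (1 : E →L[ℝ] E)) contDiffAt_fst).clm_comp contDiffAt_snd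
  obtain ⟨ε, hε, a, r, L, K, hr, hpl⟩ := IsPicardLindelof.of_contDiffAt_one hG
  obtain ⟨α, hα, L', hL'⟩ := (hpl 0).exists_forall_mem_closedBall_eq_hasDerivWithinAt_lipschitzOnWith
  have hcont : ContinuousOn (Function.uncurry α) (closedBall (z₀, 1) r ×ˢ Icc (0 - ε) (0 + ε)) :=
    continuousOn_prod_of_continuousOn_lipschitzOnWith _ L'
      (fun x hx => HasDerivWithinAt.continuousOn (hα x hx).2) hL'
  have hat : ContinuousAt (Function.uncurry α) ((z₀, 1), 0) :=
    hcont.continuousAt (prod_mem_nhds (closedBall_mem_nhds _ (by exact_mod_cast hr))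
      (Icc_mem_nhds (by linarith) (by linarith)))
  have hv0 : Function.uncurry α ((z₀, 1), 0) = (z₀, 1) :=
    (hα _ (mem_closedBall_self (by exact_mod_cast hr.le))).1
  -- Being invertible is an open condition that holds at time zero. By joint continuity of the
  -- solution it persists for short times and nearby initial values.
  have hO : {p : E × (E →L[ℝ] E) | p.1 ∈ ball z₀ ρ ∧ IsUnit p.2} ∈ 𝓝 (z₀, (1 : E →L[ℝ] E)) := by
    exact prod_mem_nhds (s := ball z₀ ρ) (t := {A : E →L[ℝ] E | IsUnit A}) (ball_mem_nhds _ hρ)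
      (Units.isOpen.mem_nhds isUnit_one)
  rw [← hv0] at hO
  have hpre := hat.preimage_mem_nhds hO
  obtain ⟨u, hu, v, hv, huv⟩ := mem_nhds_prod_iff.1 hpre
  obtain ⟨ε₁, hε₁, hε₁v⟩ := Metric.mem_nhds_iff.1 hv
  obtain ⟨r₁, hr₁, hr₁u⟩ := Metric.mem_nhds_iff.1 hu
  have hrR : (0 : ℝ) < r := by exact_mod_cast hr
  have hmem : ∀ y ∈ ball z₀ (min r r₁), (y, (1 : E →L[ℝ] E)) ∈ closedBall (z₀, (1 : E →L[ℝ] E)) r ∧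
      (y, (1 : E →L[ℝ] E)) ∈ u := by
    intro y hy
    rw [mem_ball, lt_min_iff] at hy
    refine ⟨?_, hr₁u ?_⟩
    · simpa [mem_closedBall, Prod.dist_eq] using hy.1.le
    · simpa [mem_ball, Prod.dist_eq, hr₁] using hy.2
  have hval : ∀ y ∈ ball z₀ (min r r₁), ∀ t ∈ Ioo (-min ε ε₁) (min ε ε₁),
      (α (y, 1) t).1 ∈ ball z₀ ρ ∧ IsUnit (α (y, 1) t).2 := by
    intro y hy t ht
    have : ((y, (1 : E →L[ℝ] E)), t) ∈ u ×ˢ v := by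
      refine ⟨(hmem y hy).2, hε₁v ?_⟩
      rw [mem_ball, Real.dist_eq, sub_zero, abs_lt]
      exact ⟨by have := min_le_right ε ε₁; linarith [ht.1], ht.2.trans_le (min_le_right _ _)⟩
    exact huv this
  have htI : ∀ t ∈ Ioo (-min ε ε₁) (min ε ε₁), -ε < t ∧ t < ε := fun t ht =>
    ⟨by have := min_le_left ε ε₁; linarith [ht.1], ht.2.trans_le (min_le_left _ _)⟩
  have hder : ∀ y ∈ ball z₀ (min r r₁), ∀ t ∈ Ioo (-min ε ε₁) (min ε ε₁),
      HasDerivAt (α (y, 1)) (G (α (y, 1) t)) t := by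
    intro y hy t ht
    obtain ⟨h1, h2⟩ := htI t ht
    exact ((hα _ (hmem y hy).1).2 t ⟨by linarith, by linarith⟩).hasDerivAt
      (Icc_mem_nhds (by linarith) (by linarith))
  have hder1 : ∀ y ∈ ball z₀ (min r r₁), ∀ t ∈ Ioo (-min ε ε₁) (min ε ε₁),
      HasDerivAt (fun t => (α (y, 1) t).1) (f (α (y, 1) t).1) t := fun y hy t ht =>
    ((hasFDerivAt_fst (𝕜 := ℝ) (E := E) (F := E →L[ℝ] E)).comp_hasDerivAt t (hder y hy t ht))
  have hder2 : ∀ y ∈ ball z₀ (min r r₁), ∀ t ∈ Ioo (-min ε ε₁) (min ε ε₁),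
      HasDerivAt (fun t => (α (y, 1) t).2) (fderiv ℝ f (α (y, 1) t).1 ∘L (α (y, 1) t).2) t :=
    fun y hy t ht =>
    ((hasFDerivAt_snd (𝕜 := ℝ) (E := E) (F := E →L[ℝ] E)).comp_hasDerivAt t (hder y hy t ht))
  refine ⟨min ε ε₁, lt_min hε hε₁, min r r₁, lt_min hrR hr₁, fun y t => (α (y, 1) t).1,
    fun y t => (α (y, 1) t).2, fun y hy => ⟨?_, ?_, fun t ht => ⟨?_, hder1 y hy t ht,
      hder2 y hy t ht, (hval y hy t ht).2, fun ht0 => ?_⟩⟩⟩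
  · exact congrArg Prod.fst (hα _ (hmem y hy).1).1
  · exact congrArg Prod.snd (hα _ (hmem y hy).1).1
  · exact (hball _ (hval y hy t ht).1).2.2
  · refine hasFDerivAt_of_variational (f := f) (s := ball z₀ ρ) (C := C)
      (K := ‖fderiv ℝ f z₀‖ + 1) (L := L') (ε := min ε ε₁) (r := min r r₁) (z₀ := z₀)
      (Φ := fun y t => (α (y, 1) t).1) (D := fun t => (α (y, 1) t).2)
      (convex_ball _ _) C.2 (fun x hx => (hball x hx).1.1) (fun x hx y hy => ?_)
      (fun x hx => (hball x hx).1.2.le) (by positivity)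
      (fun y hy => congrArg Prod.fst (hα _ (hmem y hy).1).1) hder1
      (fun y hy t ht => (hval y hy t ht).1) (fun y hy y' hy' t ht => ?_) hy
      (congrArg Prod.snd (hα _ (hmem y hy).1).1) (hder2 y hy) ⟨ht0, ht.2⟩
    · exact hC.norm_sub_le (hball x hx).2.1 (hball y hy).2.1
    · obtain ⟨h1, h2⟩ := htI t ht
      have := (hL' t ⟨by linarith, by linarith⟩).norm_sub_le (hmem y' hy').1 (hmem y hy).1
      refine (norm_fst_le _).trans (this.trans (le_of_eq ?_))
      simp

end LocalFlow

/-! ### Vector fields, brackets and curves read in a chart -/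

section Chart

variable {E : Type*} [NormedAddCommGroup E] [NormedSpace ℝ E]
  {M : Type*} [TopologicalSpace M] [ChartedSpace E M]

lemma comp_smulRight_one {E : Type*} [NormedAddCommGroup E] [NormedSpace ℝ E] (B : E →L[ℝ] E)
    (v : E) : B.comp ((1 : ℝ →L[ℝ] ℝ).smulRight v) = (1 : ℝ →L[ℝ] ℝ).smulRight (B v) := by
  ext; simp

lemma smulRight_one_eq_inverse_comp {E : Type*} [NormedAddCommGroup E] [NormedSpace ℝ E]
    {B : E →L[ℝ] E} (hB : IsUnit B) (v : E) : (1 : ℝ →L[ℝ] ℝ).smulRight v =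
      (Ring.inverse B).comp (ContinuousLinearMap.toSpanSingleton ℝ (B v)) := by
  obtain ⟨u, rfl⟩ := hB
  rw [Ring.inverse_unit]
  ext
  have h : ((u⁻¹ : (E →L[ℝ] E)ˣ) : E →L[ℝ] E) ((u : E →L[ℝ] E) v) = v := by
    rw [← mul_apply_eq_comp, ← Units.val_mul, inv_mul_cancel]
    rfl
  simp [h]

/-- The derivative at `y` of the preferred chart at `p`, as an endomorphism of the model space. -/
def chartDeriv (E : Type*) [NormedAddCommGroup E] [NormedSpace ℝ E] {M : Type*}
    [TopologicalSpace M] [ChartedSpace E M] (p y : M) : E →L[ℝ] E :=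
  mfderiv 𝓘(ℝ, E) 𝓘(ℝ, E) (extChartAt 𝓘(ℝ, E) p) y

/-- The vector field `Y` read in the preferred chart at `p`. -/
def chartField (p : M) (Y : ∀ x : M, TangentSpace 𝓘(ℝ, E) x) (z : E) : E :=
  chartDeriv E p ((extChartAt 𝓘(ℝ, E) p).symm z) (Y ((extChartAt 𝓘(ℝ, E) p).symm z))

variable [IsManifold 𝓘(ℝ, E) ∞ M]

lemma hasMFDerivAt_chart {p y : M} (hy : y ∈ (extChartAt 𝓘(ℝ, E) p).source) :
    HasMFDerivAt 𝓘(ℝ, E) 𝓘(ℝ, E) (extChartAt 𝓘(ℝ, E) p) y (chartDeriv E p y) := by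
  rw [extChartAt_source] at hy
  exact (mdifferentiableAt_extChartAt hy).hasMFDerivAt

lemma isUnit_chartDeriv {p y : M} (hy : y ∈ (extChartAt 𝓘(ℝ, E) p).source) :
    IsUnit (chartDeriv E p y) := by
  obtain ⟨e, he⟩ := isInvertible_mfderiv_extChartAt (I := 𝓘(ℝ, E)) hy
  let e' : E ≃L[ℝ] E := e
  have : (e' : E →L[ℝ] E) = chartDeriv E p y := he
  rw [← this]
  exact ⟨ContinuousLinearEquiv.toUnit e', rfl⟩

lemma hasMFDerivAt_chart_symm {p : M} {z : E} (hz : z ∈ (extChartAt 𝓘(ℝ, E) p).target) :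
    HasMFDerivAt 𝓘(ℝ, E) 𝓘(ℝ, E) (extChartAt 𝓘(ℝ, E) p).symm z
      (Ring.inverse (chartDeriv E p ((extChartAt 𝓘(ℝ, E) p).symm z)) : E →L[ℝ] E) := by
  have h1 := (mdifferentiableWithinAt_extChartAt_symm (I := 𝓘(ℝ, E)) hz)
  have h2 := h1.hasMFDerivWithinAt
  have h3 := h2.hasMFDerivAt (by simp)
  have h4 := mfderiv_extChartAt_comp_mfderivWithin_extChartAt_symm (I := 𝓘(ℝ, E)) hz
  have hu := isUnit_chartDeriv ((extChartAt 𝓘(ℝ, E) p).map_target hz)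
  set B : E →L[ℝ] E := mfderivWithin 𝓘(ℝ, E) 𝓘(ℝ, E) (extChartAt 𝓘(ℝ, E) p).symm (range 𝓘(ℝ, E)) z
  have h5 : chartDeriv E p ((extChartAt 𝓘(ℝ, E) p).symm z) * B = 1 := h4
  obtain ⟨u, hu⟩ := hu
  have h6 : Ring.inverse (chartDeriv E p ((extChartAt 𝓘(ℝ, E) p).symm z)) = B := by
    rw [← hu] at h5 ⊢
    rw [Ring.inverse_unit]
    exact Units.inv_eq_of_mul_eq_one_right h5
  rw [h6]
  exact h3

lemma chartDeriv_self (p : M) : chartDeriv E p p = 1 := by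
  exact mfderiv_extChartAt_self

/-- The derivative of the chart is a coordinate change of the tangent bundle, so `chartField p Y`
is, near the base point, the fibre component by which smoothness of the section `Y` is defined. -/
lemma contDiffAt_chartField {p : M} {Y : ∀ x : M, TangentSpace 𝓘(ℝ, E) x}
    (hY : ContMDiffAt 𝓘(ℝ, E) 𝓘(ℝ, E).tangent ∞
      (fun x => (⟨x, Y x⟩ : TangentBundle 𝓘(ℝ, E) M)) p) :
    ContDiffAt ℝ ∞ (chartField p Y) (extChartAt 𝓘(ℝ, E) p p) := by
  rw [contMDiffAt_iff] at hY
  have h := (hY.2.contDiffAt (by simp)).snd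
  refine h.congr_of_eventuallyEq ?_
  filter_upwards [extChartAt_target_mem_nhds (I := 𝓘(ℝ, E)) p] with z hz
  have hs := (extChartAt 𝓘(ℝ, E) p).map_target hz
  rw [extChartAt_source] at hs
  have e : chartDeriv E p ((extChartAt 𝓘(ℝ, E) p).symm z) =
      tangentCoordChange 𝓘(ℝ, E) ((extChartAt 𝓘(ℝ, E) p).symm z) p
        ((extChartAt 𝓘(ℝ, E) p).symm z) := by
    rw [← mfderiv_chartAt_eq_tangentCoordChange hs]
    rfl
  rw [chartField, e]
  rfl

/-- The bracket on `M` is the flat bracket of the fields in the chart, carried back by the inverse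
of the derivative of the chart. At `p` itself, in the preferred chart at `p`, that derivative is the
identity. -/
lemma mlieBracket_eq_chartField {p : M} {X Y : ∀ x : M, TangentSpace 𝓘(ℝ, E) x} :
    mlieBracket 𝓘(ℝ, E) X Y p =
      lieBracket ℝ (chartField p X) (chartField p Y) (extChartAt 𝓘(ℝ, E) p p) := by
  have key : ∀ Z : ∀ x : M, TangentSpace 𝓘(ℝ, E) x,
      mpullbackWithin 𝓘(ℝ, E) 𝓘(ℝ, E) (extChartAt 𝓘(ℝ, E) p).symm Z (range 𝓘(ℝ, E))
        =ᶠ[𝓝 (extChartAt 𝓘(ℝ, E) p p)] chartField p Z := by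
    intro Z
    filter_upwards [extChartAt_target_mem_nhds (I := 𝓘(ℝ, E)) p] with z hz
    have h := hasMFDerivAt_chart_symm hz
    obtain ⟨u, hu⟩ := isUnit_chartDeriv ((extChartAt 𝓘(ℝ, E) p).map_target hz)
    rw [mpullbackWithin_apply, modelWithCornersSelf_coe, range_id, mfderivWithin_univ,
      h.mfderiv, chartField, ← hu, Ring.inverse_unit]
    exact congrArg (fun B : E →L[ℝ] E => B (Z ((extChartAt 𝓘(ℝ, E) p).symm z)))
      (ContinuousLinearMap.inverse_equiv (ContinuousLinearEquiv.ofUnit u).symm)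
  rw [← mlieBracketWithin_univ, mlieBracketWithin_apply, mfderiv_extChartAt_self,
    (key X).lieBracketWithin_vectorField_eq_nhds (key Y)]
  simp only [preimage_univ, univ_inter, modelWithCornersSelf_coe, range_id, lieBracketWithin_univ]
  exact congrArg (fun B : E →L[ℝ] E => B (lieBracket ℝ (chartField p X) (chartField p Y)
    (extChartAt 𝓘(ℝ, E) p p))) ContinuousLinearMap.inverse_id

lemma hasDerivWithinAt_chart_comp {p : M} {γ : ℝ → M} {s : Set ℝ} {t : ℝ}
    {v : TangentSpace 𝓘(ℝ, E) (γ t)}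
    (h : HasMFDerivWithinAt 𝓘(ℝ, ℝ) 𝓘(ℝ, E) γ s t ((1 : ℝ →L[ℝ] ℝ).smulRight v))
    (hp : γ t ∈ (extChartAt 𝓘(ℝ, E) p).source) :
    HasDerivWithinAt (fun τ => extChartAt 𝓘(ℝ, E) p (γ τ)) (chartDeriv E p (γ t) v) s t := by
  have e : (chartDeriv E p (γ t)).comp ((1 : ℝ →L[ℝ] ℝ).smulRight (v : E)) =
      (1 : ℝ →L[ℝ] ℝ).smulRight (chartDeriv E p (γ t) v) := by
    exact comp_smulRight_one _ _
  have h1 : HasFDerivWithinAt (fun τ => extChartAt 𝓘(ℝ, E) p (γ τ))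
      ((chartDeriv E p (γ t)).comp ((1 : ℝ →L[ℝ] ℝ).smulRight (v : E))) s t :=
    hasMFDerivWithinAt_iff_hasFDerivWithinAt.1
      ((hasMFDerivAt_chart hp).comp_hasMFDerivWithinAt t h)
  rw [e] at h1
  simpa using h1.hasDerivWithinAt

lemma hasMFDerivWithinAt_chart_symm_comp {p : M} {z : ℝ → E} {s : Set ℝ} {t : ℝ}
    {v : TangentSpace 𝓘(ℝ, E) ((extChartAt 𝓘(ℝ, E) p).symm (z t))}
    (h : HasDerivWithinAt z (chartDeriv E p ((extChartAt 𝓘(ℝ, E) p).symm (z t)) v) s t)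
    (hz : z t ∈ (extChartAt 𝓘(ℝ, E) p).target) :
    HasMFDerivWithinAt 𝓘(ℝ, ℝ) 𝓘(ℝ, E) (fun τ => (extChartAt 𝓘(ℝ, E) p).symm (z τ)) s t
      ((1 : ℝ →L[ℝ] ℝ).smulRight v) := by
  have h1 := (hasMFDerivAt_chart_symm hz).comp_hasMFDerivWithinAt t
    (hasMFDerivWithinAt_iff_hasFDerivWithinAt.2 h.hasFDerivWithinAt)
  have hu := isUnit_chartDeriv ((extChartAt 𝓘(ℝ, E) p).map_target hz)
  have e : (1 : ℝ →L[ℝ] ℝ).smulRight (v : E) =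
      (Ring.inverse (chartDeriv E p ((extChartAt 𝓘(ℝ, E) p).symm (z t)))).comp
      (ContinuousLinearMap.toSpanSingleton ℝ
        (chartDeriv E p ((extChartAt 𝓘(ℝ, E) p).symm (z t)) v)) := by
    exact smulRight_one_eq_inverse_comp hu _
  exact h1.congr_mfderiv e.symm

end Chart

/-! ### Uniqueness and concatenation of trajectories -/

section Trajectory

variable {E : Type*} [NormedAddCommGroup E] [NormedSpace ℝ E]
  {M : Type*} [TopologicalSpace M] [ChartedSpace E M]
  {X : ∀ x : M, TangentSpace 𝓘(ℝ, E) x} {U : Set M}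

/-- Trajectories with the same starting point coincide. -/
theorem IsTrajectory.eqOn [IsManifold 𝓘(ℝ, E) ∞ M] [T2Space M] (hU : IsOpen U)
    (hX : ContMDiffOn 𝓘(ℝ, E) 𝓘(ℝ, E).tangent ∞
      (fun x => (⟨x, X x⟩ : TangentBundle 𝓘(ℝ, E) M)) U) {t : ℝ} {y : M} {γ γ' : ℝ → M}
    (h : IsTrajectory X U t y γ) (h' : IsTrajectory X U t y γ') : EqOn γ γ' (Icc 0 t) := by
  obtain ⟨h0, hint, hmaps⟩ := h
  obtain ⟨h0', hint', hmaps'⟩ := h'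
  have hcl : IsClosed ({τ | γ τ = γ' τ} ∩ Icc 0 t) := by
    rw [inter_comm]
    exact (hint.continuousOn.prodMk hint'.continuousOn).preimage_isClosed_of_isClosed isClosed_Icc
      isClosed_diagonal
  refine hcl.Icc_subset_of_forall_exists_gt (h0.trans h0'.symm) ?_
  -- The set of agreement is closed, so it suffices to extend it a little to the right of `x`. In
  -- the chart at `γ x` both curves solve the same equation, whose field is Lipschitz near the base
  -- point.
  rintro x ⟨hx : γ x = γ' x, hx0, hxt⟩ y hy
  have hxI : x ∈ Icc 0 t := ⟨hx0, hxt.le⟩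
  set p := γ x with hp
  have hf := (contDiffAt_chartField (hX.contMDiffAt (hU.mem_nhds (hmaps hxI)))).of_le
    (show (1 : WithTop ℕ∞) ≤ ∞ by exact_mod_cast le_top)
  obtain ⟨K, s, hs, hlip⟩ := hf.exists_lipschitzOnWith
  have hnhds : ∀ β : ℝ → M, IsMIntegralCurveOn β X (Icc 0 t) → β x = p → ∀ᶠ τ in 𝓝[Icc 0 t] x,
      β τ ∈ (extChartAt 𝓘(ℝ, E) p).source ∧ extChartAt 𝓘(ℝ, E) p (β τ) ∈ s := by
    intro β hβ hβx
    have hc := hβ.continuousOn x hxI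
    have h1 : ∀ᶠ q in 𝓝 (β x), q ∈ (extChartAt 𝓘(ℝ, E) p).source ∧ extChartAt 𝓘(ℝ, E) p q ∈ s := by
      rw [hβx]
      exact (Filter.eventually_mem_set.2 (extChartAt_source_mem_nhds p)).and
        ((continuousAt_extChartAt p).eventually hs)
    exact hc.eventually h1
  obtain ⟨δ, hδ, hball⟩ := Metric.mem_nhdsWithin_iff.1
    ((hnhds γ hint rfl).and (hnhds γ' hint' hx.symm))
  set e := min (x + δ / 2) (min y t) with he
  have hxe : x < e := lt_min (by linarith) (lt_min hy hxt)
  have het : e ≤ t := (min_le_right _ _).trans (min_le_right _ _)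
  have hsub : Icc x e ⊆ Icc 0 t := fun τ hτ => ⟨hx0.trans hτ.1, hτ.2.trans het⟩
  have hmem : ∀ τ ∈ Icc x e, τ ∈ ball x δ ∩ Icc 0 t := fun τ hτ => by
    refine ⟨?_, hsub hτ⟩
    have : τ ≤ x + δ / 2 := hτ.2.trans (min_le_left _ _)
    rw [mem_ball, Real.dist_eq, abs_lt]
    constructor <;> linarith [hτ.1]
  have hder : ∀ β : ℝ → M, IsMIntegralCurveOn β X (Icc 0 t) →
      (∀ τ ∈ Icc x e, β τ ∈ (extChartAt 𝓘(ℝ, E) p).source) → ∀ τ ∈ Icc x e,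
        HasDerivWithinAt (fun τ => extChartAt 𝓘(ℝ, E) p (β τ))
          (chartField p X (extChartAt 𝓘(ℝ, E) p (β τ))) (Icc x e) τ := by
    intro β hβ hsrc τ hτ
    have := hasDerivWithinAt_chart_comp (hβ τ (hsub hτ)) (hsrc τ hτ)
    rw [chartField, (extChartAt 𝓘(ℝ, E) p).left_inv (hsrc τ hτ)]
    exact this.mono hsub
  have hsrc : ∀ τ ∈ Icc x e, γ τ ∈ (extChartAt 𝓘(ℝ, E) p).source :=
    fun τ hτ => (hball (hmem τ hτ)).1.1
  have hsrc' : ∀ τ ∈ Icc x e, γ' τ ∈ (extChartAt 𝓘(ℝ, E) p).source :=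
    fun τ hτ => (hball (hmem τ hτ)).2.1
  have hright : ∀ τ ∈ Ico x e, Icc x e ∈ 𝓝[Ici τ] τ := fun τ hτ =>
    Filter.mem_of_superset (Icc_mem_nhdsGE hτ.2) (Icc_subset_Icc_left hτ.1)
  have heq := ODE_solution_unique_of_mem_Icc_right (v := fun _ => chartField p X) (s := fun _ => s)
    (fun _ _ => hlip)
    (HasDerivWithinAt.continuousOn (hder γ hint hsrc))
    (fun τ hτ => (hder γ hint hsrc τ (Ico_subset_Icc_self hτ)).mono_of_mem_nhdsWithin (hright τ hτ))
    (fun τ hτ => (hball (hmem τ (Ico_subset_Icc_self hτ))).1.2)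
    (HasDerivWithinAt.continuousOn (hder γ' hint' hsrc'))
    (fun τ hτ => (hder γ' hint' hsrc' τ (Ico_subset_Icc_self hτ)).mono_of_mem_nhdsWithin
      (hright τ hτ))
    (fun τ hτ => (hball (hmem τ (Ico_subset_Icc_self hτ))).2.2)
    (by simp only [← hx, ← hp])
  have hee : e ∈ Icc x e := right_mem_Icc.2 hxe.le
  exact ⟨e, (extChartAt 𝓘(ℝ, E) p).injOn (hsrc e hee) (hsrc' e hee) (heq hee), hxe,
    (min_le_right _ _).trans (min_le_left _ _)⟩

/-- `flow` picks an arbitrary trajectory; by uniqueness the choice does not affect its endpoint. -/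
theorem IsTrajectory.flow_eq [IsManifold 𝓘(ℝ, E) ∞ M] [T2Space M] (hU : IsOpen U)
    (hX : ContMDiffOn 𝓘(ℝ, E) 𝓘(ℝ, E).tangent ∞
      (fun x => (⟨x, X x⟩ : TangentBundle 𝓘(ℝ, E) M)) U) {t : ℝ} (ht : 0 ≤ t) {y : M} {γ : ℝ → M}
    (h : IsTrajectory X U t y γ) : flow X U t y = γ t := by
  have hex : ∃ γ : ℝ → M, IsTrajectory X U t y γ := ⟨γ, h⟩
  rw [flow, dif_pos hex]
  exact hex.choose_spec.eqOn hU hX h (right_mem_Icc.2 ht)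

/-- Concatenation of trajectories. -/
theorem IsTrajectory.trans {a b : ℝ} (ha : 0 ≤ a) (hb : 0 ≤ b) {y : M} {γ γ' : ℝ → M}
    (h : IsTrajectory X U a y γ) (h' : IsTrajectory X U b (γ a) γ') :
    IsTrajectory X U (a + b) y (fun τ => if τ ≤ a then γ τ else γ' (τ - a)) := by
  obtain ⟨h0, hint, hmaps⟩ := h
  obtain ⟨h0', hint', hmaps'⟩ := h'
  set β : ℝ → M := fun τ => if τ ≤ a then γ τ else γ' (τ - a) with hβ
  have e1 : ∀ τ ≤ a, β τ = γ τ := fun τ hτ => if_pos hτ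
  have e2 : ∀ τ, a ≤ τ → β τ = γ' (τ - a) := by
    intro τ hτ
    rcases hτ.eq_or_lt with rfl | hτ
    · rw [e1 _ le_rfl, sub_self, h0']
    · exact if_neg hτ.not_ge
  have hI : Icc 0 (a + b) = Icc 0 a ∪ Icc a (a + b) :=
    (Icc_union_Icc_eq_Icc ha (by linarith)).symm
  have d1 : IsMIntegralCurveOn β X (Icc 0 a) := by
    intro τ hτ
    rw [e1 τ hτ.2]
    exact HasMFDerivWithinAt.congr_mono (hint τ hτ) (fun σ hσ => e1 σ hσ.2) (e1 τ hτ.2) subset_rfl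
  have d2 : IsMIntegralCurveOn β X (Icc a (a + b)) := by
    have h3 := isMIntegralCurveOn_comp_sub (dt := a).2 hint'
    intro τ hτ
    rw [e2 τ hτ.1]
    refine HasMFDerivWithinAt.congr_mono (h3 τ ?_) (fun σ hσ => e2 σ hσ.1) (e2 τ hτ.1) ?_
    · exact ⟨by linarith [hτ.1], by linarith [hτ.2]⟩
    · exact fun σ hσ => ⟨by linarith [hσ.1], by linarith [hσ.2]⟩
  refine ⟨(e1 0 ha).trans h0, ?_, ?_⟩
  · intro τ hτ
    -- Off the junction only one of the two pieces matters. At the junction the two one-sided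
    -- derivatives are both given by `X` at the same point, and they glue.
    rcases lt_trichotomy τ a with h | h | h
    · refine (d1 τ ⟨hτ.1, h.le⟩).mono_of_mem_nhdsWithin ?_
      rw [mem_nhdsWithin]
      exact ⟨Iio a, isOpen_Iio, h, fun σ hσ => ⟨hσ.2.1, le_of_lt hσ.1⟩⟩
    · subst h
      rw [hI]
      exact (d1 τ ⟨hτ.1, le_rfl⟩).union (d2 τ ⟨le_rfl, hτ.2⟩)
    · refine (d2 τ ⟨h.le, hτ.2⟩).mono_of_mem_nhdsWithin ?_
      rw [mem_nhdsWithin]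
      exact ⟨Ioi a, isOpen_Ioi, h, fun σ hσ => ⟨le_of_lt hσ.1, hσ.2.2⟩⟩
  · intro τ hτ
    rcases le_total τ a with h | h
    · rw [e1 τ h]; exact hmaps ⟨hτ.1, h⟩
    · rw [e2 τ h]; exact hmaps' ⟨by linarith, by linarith [hτ.2]⟩

end Trajectory

/-! ### The derivative of the flow along an integral curve -/

section FlowDerivative

variable {E : Type*} [NormedAddCommGroup E] [NormedSpace ℝ E]
  {M : Type*} [TopologicalSpace M] [ChartedSpace E M]
  {X : ∀ x : M, TangentSpace 𝓘(ℝ, E) x} {U : Set M}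

/-- The flow for time `t` is defined near `y` and differentiable at `y`, with derivative `B`. -/
def HasFlowDeriv (X : ∀ x : M, TangentSpace 𝓘(ℝ, E) x) (U : Set M) (t : ℝ) (y : M)
    (B : E →L[ℝ] E) : Prop :=
  (∀ᶠ y' in 𝓝 y, ∃ γ, IsTrajectory X U t y' γ) ∧
    HasMFDerivAt 𝓘(ℝ, E) 𝓘(ℝ, E) (flow X U t) y B

lemma flow_zero (y : M) : flow X U 0 y = y := by
  unfold flow
  split_ifs with h
  · exact h.choose_spec.1
  · rfl

variable {T : EReal} {c : ℝ → M}

lemma zero_mem_timeInterval (hT : 0 < T) : (0 : ℝ) ∈ timeInterval T := ⟨le_rfl, by simpa using hT⟩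

lemma mem_timeInterval_of_le {s t : ℝ} (ht : t ∈ timeInterval T) (h0 : 0 ≤ s) (hst : s ≤ t) :
    s ∈ timeInterval T := ⟨h0, (EReal.coe_le_coe_iff.2 hst).trans_lt ht.2⟩

lemma isTrajectory_shift (hc : IsMIntegralCurveOn c X (timeInterval T))
    (hcU : MapsTo c (timeInterval T) U) {s t : ℝ} (hs : 0 ≤ s) (ht : t ∈ timeInterval T) :
    IsTrajectory X U (t - s) (c s) (fun τ => c (τ + s)) := by
  have hsub : ∀ τ ∈ Icc 0 (t - s), τ + s ∈ timeInterval T := fun τ hτ =>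
    mem_timeInterval_of_le ht (by linarith [hτ.1]) (by linarith [hτ.2])
  refine ⟨by simp, ?_, fun τ hτ => hcU (hsub τ hτ)⟩
  exact (isMIntegralCurveOn_comp_add (dt := s).2 hc).mono hsub

variable [IsManifold 𝓘(ℝ, E) ∞ M] [T2Space M]

/-- This is the chain rule. The existence of trajectories near `y`, which is part of `HasFlowDeriv`,
makes the group law of the flow hold on a neighbourhood of `y`, as differentiation requires. -/
theorem HasFlowDeriv.comp (hU : IsOpen U)
    (hX : ContMDiffOn 𝓘(ℝ, E) 𝓘(ℝ, E).tangent ∞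
      (fun x => (⟨x, X x⟩ : TangentBundle 𝓘(ℝ, E) M)) U) {a b : ℝ} (ha : 0 ≤ a) (hb : 0 ≤ b)
    {y : M} {A B : E →L[ℝ] E} (hA : HasFlowDeriv X U a y A)
    (hB : HasFlowDeriv X U b (flow X U a y) B) : HasFlowDeriv X U (a + b) y (B ∘L A) := by
  have hev : ∀ᶠ y' in 𝓝 y, ∃ γ, IsTrajectory X U (a + b) y' γ ∧
      γ (a + b) = flow X U b (flow X U a y') := by
    filter_upwards [hA.1, hA.2.continuousAt.eventually hB.1] with y' ⟨γ, hγ⟩ ⟨γ', hγ'⟩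
    rw [hγ'.flow_eq hU hX hb]
    rw [hγ.flow_eq hU hX ha] at hγ'
    refine ⟨_, hγ.trans ha hb hγ', ?_⟩
    rcases hb.eq_or_lt with rfl | hb'
    · simp [hγ'.1]
    · simp [hb']
  refine ⟨hev.mono fun y' ⟨γ, hγ, _⟩ => ⟨γ, hγ⟩, ?_⟩
  refine (HasMFDerivAt.comp y hB.2 hA.2).congr_of_eventuallyEq ?_
  filter_upwards [hev] with y' ⟨γ, hγ, he⟩
  rw [hγ.flow_eq hU hX (by positivity), he]
  rfl

/-- The flow of the model space is carried to `M` by the chart; its curves stay in the chart and in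
`U`, so they are the trajectories that define `flow`. The time `ε` is uniform for initial points in
`O`. The factor `D` is kept apart from the chart derivatives because it satisfies the variational
equation. -/
theorem exists_local_flow_manifold [CompleteSpace E] (hU : IsOpen U)
    (hX : ContMDiffOn 𝓘(ℝ, E) 𝓘(ℝ, E).tangent ∞
      (fun x => (⟨x, X x⟩ : TangentBundle 𝓘(ℝ, E) M)) U) {p : M} (hp : p ∈ U) :
    ∃ ε > 0, ∃ O ∈ 𝓝 p, ∃ D : M → ℝ → E →L[ℝ] E, ∀ y ∈ O,
      y ∈ (extChartAt 𝓘(ℝ, E) p).source ∧ ∀ t ∈ Ico 0 ε,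
        flow X U t y ∈ (extChartAt 𝓘(ℝ, E) p).source ∧ IsUnit (D y t) ∧
        HasFlowDeriv X U t y (Ring.inverse (chartDeriv E p (flow X U t y)) ∘L D y t ∘L
          chartDeriv E p y) ∧
        HasDerivAt (D y) (fderiv ℝ (chartField p X) (extChartAt 𝓘(ℝ, E) p (flow X U t y)) ∘L
          D y t) t := by
  set φ := extChartAt 𝓘(ℝ, E) p with hφ
  have hf : ContDiffAt ℝ 2 (chartField p X) (φ p) :=
    (contDiffAt_chartField (hX.contMDiffAt (hU.mem_nhds hp))).of_le (WithTop.coe_le_coe.2 le_top)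
  have hΩ : φ.target ∩ φ.symm ⁻¹' U ∈ 𝓝 (φ p) := by
    refine Filter.inter_mem (extChartAt_target_mem_nhds p) ?_
    refine (continuousAt_extChartAt_symm p).preimage_mem_nhds ?_
    rw [extChartAt_to_inv]
    exact hU.mem_nhds hp
  obtain ⟨ε, hε, r, hr, Φ, D, h⟩ := exists_local_flow hf hΩ
  have hO : IsOpen (φ.source ∩ φ ⁻¹' ball (φ p) r) :=
    (continuousOn_extChartAt p).isOpen_inter_preimage (isOpen_extChartAt_source p) isOpen_ball
  have htraj : ∀ y ∈ φ.source ∩ φ ⁻¹' ball (φ p) r, ∀ t ∈ Ico 0 ε,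
      IsTrajectory X U t y (fun τ => φ.symm (Φ (φ y) τ)) := by
    rintro y ⟨hy, hyr⟩ t ht
    obtain ⟨h0, -, h1⟩ := h (φ y) hyr
    have hsub : Icc 0 t ⊆ Ioo (-ε) ε := fun τ hτ =>
      ⟨by linarith [hτ.1], hτ.2.trans_lt ht.2⟩
    refine ⟨by simp only [h0]; exact φ.left_inv hy, fun τ hτ => ?_, fun τ hτ => ?_⟩
    · exact hasMFDerivWithinAt_chart_symm_comp (h1 τ (hsub hτ)).2.1.hasDerivWithinAt
        (h1 τ (hsub hτ)).1.1
    · exact (h1 τ (hsub hτ)).1.2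
  refine ⟨ε, hε, _, hO.mem_nhds ⟨mem_extChartAt_source p, mem_ball_self hr⟩, fun y => D (φ y),
    fun y hy => ⟨hy.1, fun t ht => ?_⟩⟩
  obtain ⟨h0, -, h1⟩ := h (φ y) hy.2
  obtain ⟨hm, -, hD, hu, hF⟩ := h1 t ⟨by linarith [ht.1], ht.2⟩
  have hfl : flow X U t y = φ.symm (Φ (φ y) t) := (htraj y hy t ht).flow_eq hU hX ht.1
  have hφfl : φ (flow X U t y) = Φ (φ y) t := by rw [hfl]; exact φ.right_inv hm.1
  refine ⟨hfl ▸ φ.map_target hm.1, hu, ⟨?_, ?_⟩, ?_⟩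
  · filter_upwards [hO.mem_nhds hy] with y' hy'
    exact ⟨_, htraj y' hy' t ht⟩
  · have hc := (hasMFDerivAt_chart_symm hm.1).comp y
      ((hF ht.1).hasMFDerivAt.comp y (hasMFDerivAt_chart hy.1))
    rw [hfl]
    refine hc.congr_of_eventuallyEq ?_
    filter_upwards [hO.mem_nhds hy] with y' hy'
    exact (htraj y' hy' t ht).flow_eq hU hX ht.1
  · rw [hφfl]
    exact hD

lemma flow_shift (hU : IsOpen U)
    (hX : ContMDiffOn 𝓘(ℝ, E) 𝓘(ℝ, E).tangent ∞
      (fun x => (⟨x, X x⟩ : TangentBundle 𝓘(ℝ, E) M)) U)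
    (hc : IsMIntegralCurveOn c X (timeInterval T))
    (hcU : MapsTo c (timeInterval T) U) {s t : ℝ} (hs : 0 ≤ s) (hst : s ≤ t)
    (ht : t ∈ timeInterval T) : flow X U (t - s) (c s) = c t := by
  rw [(isTrajectory_shift hc hcU hs ht).flow_eq hU hX (sub_nonneg.2 hst)]
  simp

/-- The flow along an integral curve, read in a chart at one of its points. -/
lemma exists_local_flow_along [CompleteSpace E] (hU : IsOpen U)
    (hX : ContMDiffOn 𝓘(ℝ, E) 𝓘(ℝ, E).tangent ∞
      (fun x => (⟨x, X x⟩ : TangentBundle 𝓘(ℝ, E) M)) U)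
    (hc : IsMIntegralCurveOn c X (timeInterval T))
    (hcU : MapsTo c (timeInterval T) U) {t₀ : ℝ} (ht₀ : t₀ ∈ timeInterval T) :
    ∃ δ > 0, ∃ D : M → ℝ → E →L[ℝ] E, ∀ s ∈ timeInterval T, ∀ t ∈ timeInterval T,
      |s - t₀| < δ → |t - t₀| < δ → s ≤ t →
        c t ∈ (extChartAt 𝓘(ℝ, E) (c t₀)).source ∧ c s ∈ (extChartAt 𝓘(ℝ, E) (c t₀)).source ∧
        IsUnit (D (c s) (t - s)) ∧
        HasFlowDeriv X U (t - s) (c s) (Ring.inverse (chartDeriv E (c t₀) (c t)) ∘L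
          D (c s) (t - s) ∘L chartDeriv E (c t₀) (c s)) ∧
        HasDerivAt (D (c s)) (fderiv ℝ (chartField (c t₀) X)
          (extChartAt 𝓘(ℝ, E) (c t₀) (c t)) ∘L D (c s) (t - s)) (t - s) := by
  obtain ⟨ε, hε, O, hO, D, h⟩ := exists_local_flow_manifold hU hX (hcU ht₀)
  obtain ⟨δ, hδ, hball⟩ := Metric.mem_nhdsWithin_iff.1
    ((hc.continuousOn t₀ ht₀).preimage_mem_nhdsWithin hO)
  refine ⟨min δ (ε / 2), lt_min hδ (by linarith), D, fun s hs t ht hsd htd hst => ?_⟩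
  obtain ⟨h1, h2⟩ := h (c s) (hball ⟨by
    rw [mem_ball, Real.dist_eq]; exact hsd.trans_le (min_le_left _ _), hs⟩)
  have h3 := abs_lt.1 (hsd.trans_le (min_le_right _ _))
  have h4 := abs_lt.1 (htd.trans_le (min_le_right _ _))
  obtain ⟨h5, h6, h7, h8⟩ := h2 (t - s) ⟨sub_nonneg.2 hst, by linarith⟩
  rw [flow_shift hU hX hc hcU hs.1 hst ht] at h5 h7 h8
  exact ⟨h5, h1, h6, h7, h8⟩

/-- By compactness `[0, b]` splits into finitely many steps, each short enough for one local flow;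
the derivative is the composition of the invertible derivatives of the steps. -/
lemma exists_hasFlowDeriv [CompleteSpace E] (hU : IsOpen U)
    (hX : ContMDiffOn 𝓘(ℝ, E) 𝓘(ℝ, E).tangent ∞
      (fun x => (⟨x, X x⟩ : TangentBundle 𝓘(ℝ, E) M)) U)
    (hc : IsMIntegralCurveOn c X (timeInterval T))
    (hcU : MapsTo c (timeInterval T) U) {b : ℝ} (hb : b ∈ timeInterval T) :
    ∃ B : E →L[ℝ] E, IsUnit B ∧ HasFlowDeriv X U b (c 0) B := by
  have hmem : ∀ t : Icc 0 b, (t : ℝ) ∈ timeInterval T := fun t =>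
    mem_timeInterval_of_le hb t.2.1 t.2.2
  choose δ hδ D hD using fun t : Icc 0 b => exists_local_flow_along hU hX hc hcU (hmem t)
  have hstep : ∀ (i s t : Icc 0 b), |(s : ℝ) - i| < δ i → |(t : ℝ) - i| < δ i → s ≤ t →
      ∃ B : E →L[ℝ] E, IsUnit B ∧ HasFlowDeriv X U (t - s) (c s) B := by
    intro i s t hs ht hst
    obtain ⟨h1, h2, h3, h4, -⟩ := hD i s (hmem s) t (hmem t) hs ht hst
    refine ⟨_, ?_, h4⟩
    have hu := (isUnit_chartDeriv h1).ringInverse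
    exact hu.mul (h3.mul (isUnit_chartDeriv h2))
  obtain ⟨t, ht0, hmono, ⟨n, hn⟩, hcov⟩ := exists_monotone_Icc_subset_open_cover_Icc hb.1
    (c := fun i : Icc 0 b => {t : Icc 0 b | |(t : ℝ) - i| < δ i})
    (fun i => isOpen_lt (by fun_prop) continuous_const)
    (fun i _ => mem_iUnion.2 ⟨i, by simpa using hδ i⟩)
  have hall : ∀ k, ∃ B : E →L[ℝ] E, IsUnit B ∧ HasFlowDeriv X U (t k) (c 0) B := by
    intro k
    induction k with
    | zero =>
      have := hstep (t 0) (t 0) (t 0) (by simpa using hδ _) (by simpa using hδ _) le_rfl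
      rw [sub_self, ht0] at this
      rwa [ht0]
    | succ k ih =>
      obtain ⟨A, hA, hA'⟩ := ih
      obtain ⟨i, hi⟩ := hcov k
      have hle := hmono (Nat.le_succ k)
      obtain ⟨B, hB, hB'⟩ := hstep i (t k) (t (k + 1)) (hi (left_mem_Icc.2 hle))
        (hi (right_mem_Icc.2 hle)) hle
      refine ⟨B ∘L A, hB.mul hA, ?_⟩
      have hfl := flow_shift hU hX hc hcU le_rfl (t k).2.1 (hmem (t k))
      rw [sub_zero] at hfl
      rw [← hfl] at hB'
      have := HasFlowDeriv.comp hU hX (t k).2.1 (sub_nonneg.2 hle) hA' hB'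
      rwa [add_sub_cancel] at this
  have := hall n
  rwa [hn n le_rfl] at this

/-- Transport along an integral curve by the derivative of the flow: the pulled back vector field
`t ↦ exp(tX)^* Y` at the starting point has derivative `exp(tX)^* [X, Y]`. -/
theorem exists_transport [CompleteSpace E] (hU : IsOpen U)
    (hX : ContMDiffOn 𝓘(ℝ, E) 𝓘(ℝ, E).tangent ∞
      (fun x => (⟨x, X x⟩ : TangentBundle 𝓘(ℝ, E) M)) U)
    (hc : IsMIntegralCurveOn c X (timeInterval T))
    (hcU : MapsTo c (timeInterval T) U) :
    ∃ A : ℝ → E →L[ℝ] E, A 0 = 1 ∧ ∀ t ∈ timeInterval T, IsUnit (A t) ∧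
      flow X U t (c 0) = c t ∧
      HasMFDerivAt 𝓘(ℝ, E) 𝓘(ℝ, E) (flow X U t) (c 0) (A t) ∧
      ∀ Y : ∀ x : M, TangentSpace 𝓘(ℝ, E) x, ContMDiffAt 𝓘(ℝ, E) 𝓘(ℝ, E).tangent ∞
        (fun x => (⟨x, Y x⟩ : TangentBundle 𝓘(ℝ, E) M)) (c t) →
        HasDerivWithinAt (fun τ => Ring.inverse (A τ) (Y (c τ) : E))
          (Ring.inverse (A t) (mlieBracket 𝓘(ℝ, E) X Y (c t) : E)) (timeInterval T) t := by
  set A : ℝ → E →L[ℝ] E := fun t => mfderiv 𝓘(ℝ, E) 𝓘(ℝ, E) (flow X U t) (c 0) with hAdef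
  have hA : ∀ t ∈ timeInterval T, IsUnit (A t) ∧ HasFlowDeriv X U t (c 0) (A t) := by
    intro t ht
    obtain ⟨B, hB, hB'⟩ := exists_hasFlowDeriv hU hX hc hcU ht
    have : A t = B := hB'.2.mfderiv
    rw [this]
    exact ⟨hB, hB'⟩
  have hfl : ∀ t ∈ timeInterval T, flow X U t (c 0) = c t := fun t ht => by
    have := flow_shift hU hX hc hcU le_rfl ht.1 ht
    rwa [sub_zero] at this
  have hcomp : ∀ s ∈ timeInterval T, ∀ t ∈ timeInterval T, s ≤ t → ∀ B,
      HasFlowDeriv X U (t - s) (c s) B → A t = B ∘L A s := by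
    intro s hs t ht hst B hB
    rw [← hfl s hs] at hB
    have := HasFlowDeriv.comp hU hX hs.1 (sub_nonneg.2 hst) (hA s hs).2 hB
    rw [add_sub_cancel] at this
    exact this.2.mfderiv
  refine ⟨A, ?_, fun t₀ ht₀ => ⟨(hA t₀ ht₀).1, hfl t₀ ht₀, (hA t₀ ht₀).2.2, fun Y hY => ?_⟩⟩
  · have : flow X U 0 = id := funext flow_zero
    simp only [hAdef]
    rw [this]
    exact mfderiv_id
  obtain ⟨δ, hδ, D, hD⟩ := exists_local_flow_along hU hX hc hcU ht₀
  -- The local flow is differentiated for forward times only. Both sides of `t₀` are therefore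
  -- reached from an earlier time `s`; at `t₀ = 0` the time interval is itself one-sided and `s = 0`
  -- serves.
  obtain ⟨s, hs, hs0, hsδ, hev⟩ : ∃ s ∈ timeInterval T, s ≤ t₀ ∧ |s - t₀| < δ ∧
      ∀ᶠ t in 𝓝[timeInterval T] t₀, s ≤ t := by
    rcases ht₀.1.eq_or_lt with h0 | h0
    · subst h0
      exact ⟨0, ht₀, le_rfl, by simpa using hδ,
        Filter.eventually_of_mem self_mem_nhdsWithin fun t ht => ht.1⟩
    · refine ⟨max 0 (t₀ - δ / 2), mem_timeInterval_of_le ht₀ (le_max_left _ _)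
        (max_le h0.le (by linarith)), max_le h0.le (by linarith), ?_, ?_⟩
      · rw [abs_lt]
        constructor
        · linarith [le_max_right 0 (t₀ - δ / 2)]
        · have : max 0 (t₀ - δ / 2) ≤ t₀ := max_le h0.le (by linarith)
          linarith
      · exact nhdsWithin_le_nhds (Ici_mem_nhds (max_lt h0 (by linarith)))
  set p := c t₀ with hp
  -- The pull-back factors through time `s`. Only `D (c s) (t - s)` and the chart expression of the
  -- vector depend on `t`, so the product rule applies in a fixed space.
  have hrep : ∀ t ∈ timeInterval T, |t - t₀| < δ → s ≤ t → ∀ v : E, Ring.inverse (A t) v =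
      Ring.inverse (chartDeriv E p (c s) ∘L A s)
        (Ring.inverse (D (c s) (t - s)) (chartDeriv E p (c t) v)) := by
    intro t ht htd hst y
    obtain ⟨h1, h2, h3, h4, -⟩ := hD s hs t ht hsδ htd hst
    rw [hcomp s hs t ht hst _ h4]
    obtain ⟨u, hu⟩ := isUnit_chartDeriv h1
    obtain ⟨v, hv⟩ := isUnit_chartDeriv h2
    obtain ⟨w, hw⟩ := h3
    obtain ⟨a, ha⟩ := (hA s hs).1
    rw [← hu, ← hv, ← hw, ← ha]
    have e1 : (Ring.inverse (u : E →L[ℝ] E) ∘L (w : E →L[ℝ] E) ∘L (v : E →L[ℝ] E)) ∘L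
        (a : E →L[ℝ] E) = ((u⁻¹ * (w * v) * a : (E →L[ℝ] E)ˣ) : E →L[ℝ] E) := by
      rw [Ring.inverse_unit]; rfl
    have e2 : (v : E →L[ℝ] E) ∘L (a : E →L[ℝ] E) = ((v * a : (E →L[ℝ] E)ˣ) : E →L[ℝ] E) := rfl
    rw [e1, e2, Ring.inverse_unit, Ring.inverse_unit, Ring.inverse_unit]
    have e3 : (u⁻¹ * (w * v) * a)⁻¹ = (v * a)⁻¹ * (w⁻¹ * u) := by group
    rw [e3]
    rfl
  have hbase := hD s hs t₀ ht₀ hsδ (by simpa using hδ) hs0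
  obtain ⟨hsrc, -, ⟨w, hw⟩, -, hDder⟩ := hbase
  have hx : HasDerivWithinAt (fun t => extChartAt 𝓘(ℝ, E) p (c t))
      (chartField p X (extChartAt 𝓘(ℝ, E) p p)) (timeInterval T) t₀ := by
    have := hasDerivWithinAt_chart_comp (p := p) (hc t₀ ht₀) hsrc
    rw [chartField, (extChartAt 𝓘(ℝ, E) p).left_inv hsrc]
    exact this
  have hy : HasDerivWithinAt (fun t => chartField p Y (extChartAt 𝓘(ℝ, E) p (c t)))
      (fderiv ℝ (chartField p Y) (extChartAt 𝓘(ℝ, E) p p)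
        (chartField p X (extChartAt 𝓘(ℝ, E) p p))) (timeInterval T) t₀ := by
    have hd : HasFDerivAt (chartField p Y) (fderiv ℝ (chartField p Y) (extChartAt 𝓘(ℝ, E) p p))
        (extChartAt 𝓘(ℝ, E) p (c t₀)) :=
      ((contDiffAt_chartField hY).differentiableAt (by simp)).hasFDerivAt
    exact hd.comp_hasDerivWithinAt t₀ hx
  have hsub : HasDerivAt (fun t => D (c s) (t - s)) (fderiv ℝ (chartField p X)
      (extChartAt 𝓘(ℝ, E) p p) ∘L D (c s) (t₀ - s)) t₀ := hDder.comp_sub_const t₀ s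
  have hinv := (hasFDerivAt_ringInverse (𝕜 := ℝ) w)
  rw [hw] at hinv
  have hDinv := hinv.comp_hasDerivAt t₀ hsub
  have hprod := (hDinv.hasDerivWithinAt (s := timeInterval T)).clm_apply hy
  have hfin := (ContinuousLinearMap.hasFDerivAt
    (Ring.inverse (chartDeriv E p (c s) ∘L A s))).comp_hasDerivWithinAt t₀ hprod
  have hevEq : (fun τ => Ring.inverse (A τ) (Y (c τ) : E)) =ᶠ[𝓝[timeInterval T] t₀]
      (fun t => Ring.inverse (chartDeriv E p (c s) ∘L A s) (Ring.inverse (D (c s) (t - s))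
        (chartField p Y (extChartAt 𝓘(ℝ, E) p (c t))))) := by
    have hnear : ∀ᶠ t in 𝓝[timeInterval T] t₀, |t - t₀| < δ := by
      refine nhdsWithin_le_nhds ?_
      filter_upwards [Metric.ball_mem_nhds t₀ hδ] with t ht
      rwa [mem_ball, Real.dist_eq] at ht
    filter_upwards [hev, hnear, self_mem_nhdsWithin] with t h1 h2 h3
    refine (hrep t h3 h2 h1 (Y (c t))).trans ?_
    rw [chartField, (extChartAt 𝓘(ℝ, E) p).left_inv (hD s hs t h3 hsδ h2 h1).1]
  refine (hfin.congr_of_eventuallyEq hevEq (hevEq.self_of_nhdsWithin ht₀)).congr_deriv ?_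
  refine Eq.trans ?_ (hrep t₀ ht₀ (by simpa using hδ) hs0 (mlieBracket 𝓘(ℝ, E) X Y p)).symm
  rw [← hp, chartDeriv_self, Function.comp_apply, ← hw, Ring.inverse_unit]
  refine congrArg _ ?_
  have hlie : (mlieBracket 𝓘(ℝ, E) X Y p : E) = _ := mlieBracket_eq_chartField
  rw [lieBracket_eq] at hlie
  have e1 : (1 : E →L[ℝ] E) (mlieBracket 𝓘(ℝ, E) X Y p) = mlieBracket 𝓘(ℝ, E) X Y p := rfl
  rw [e1, hlie, map_sub]
  -- By the variational equation `D⁻¹` has derivative `-D⁻¹ ∘ DX`. Together with the derivative `DY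
  -- · X` of the field along the curve this gives `D⁻¹ (DY · X - DX · Y) = D⁻¹ [X, Y]`.
  have e2 : (-(ContinuousLinearMap.mulLeftRight ℝ (E →L[ℝ] E)) ↑w⁻¹ ↑w⁻¹)
      (fderiv ℝ (chartField p X) (extChartAt 𝓘(ℝ, E) p p) ∘L (w : E →L[ℝ] E)) =
      -((↑w⁻¹ : E →L[ℝ] E) ∘L fderiv ℝ (chartField p X) (extChartAt 𝓘(ℝ, E) p p)) := by
    have : (↑w⁻¹ : E →L[ℝ] E) * (fderiv ℝ (chartField p X) (extChartAt 𝓘(ℝ, E) p p) *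
      (w : E →L[ℝ] E)) * (↑w⁻¹ : E →L[ℝ] E) =
        (↑w⁻¹ : E →L[ℝ] E) * fderiv ℝ (chartField p X) (extChartAt 𝓘(ℝ, E) p p) := by
      rw [mul_assoc, mul_assoc, Units.mul_inv, mul_one]
    exact congrArg Neg.neg this
  rw [e2, neg_apply, ContinuousLinearMap.comp_apply, neg_add_eq_sub]

/-- The pull-back of tangent vectors along an integral curve to its starting point. -/
theorem exists_pullback [CompleteSpace E] (hU : IsOpen U)
    (hX : ContMDiffOn 𝓘(ℝ, E) 𝓘(ℝ, E).tangent ∞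
      (fun x => (⟨x, X x⟩ : TangentBundle 𝓘(ℝ, E) M)) U)
    (hc : IsMIntegralCurveOn c X (timeInterval T)) (hT : 0 < T)
    (hcU : MapsTo c (timeInterval T) U) :
    ∃ (A : ℝ → E →L[ℝ] E) (B : ∀ t, TangentSpace 𝓘(ℝ, E) (c t) →ₗ[ℝ] E),
      (∀ v : TangentSpace 𝓘(ℝ, E) (c 0), B 0 v = v) ∧ ∀ t ∈ timeInterval T,
      flow X U t (c 0) = c t ∧
      HasMFDerivAt 𝓘(ℝ, E) 𝓘(ℝ, E) (flow X U t) (c 0) (A t) ∧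
      (∀ v : TangentSpace 𝓘(ℝ, E) (c t), A t (B t v) = v) ∧
      ∀ Y : ∀ x : M, TangentSpace 𝓘(ℝ, E) x, ContMDiffAt 𝓘(ℝ, E) 𝓘(ℝ, E).tangent ∞
        (fun x => (⟨x, Y x⟩ : TangentBundle 𝓘(ℝ, E) M)) (c t) →
        HasDerivWithinAt (fun τ => B τ (Y (c τ)))
          (B t (mlieBracket 𝓘(ℝ, E) X Y (c t))) (timeInterval T) t := by
  obtain ⟨A, hA0, hA⟩ := exists_transport hU hX hc hcU
  let B : ∀ t, TangentSpace 𝓘(ℝ, E) (c t) →ₗ[ℝ] E := fun t =>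
    show E →ₗ[ℝ] E from (Ring.inverse (A t) : E →L[ℝ] E).toLinearMap
  have hAB : ∀ t ∈ timeInterval T, ∀ v : E, A t (Ring.inverse (A t) v) = v := by
    intro t ht v
    have := Ring.mul_inverse_cancel _ (hA t ht).1
    exact congrArg (fun C : E →L[ℝ] E => C v) this
  refine ⟨A, B, fun v => ?_, fun t ht => ⟨(hA t ht).2.1, (hA t ht).2.2.1, hAB t ht,
    (hA t ht).2.2.2⟩⟩
  have := hAB 0 (zero_mem_timeInterval hT) v
  rw [hA0] at this
  change Ring.inverse (A 0) (v : E) = v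
  rw [hA0]
  exact this

end FlowDerivative

/-! ### Smoothness of coefficients -/

section Coefficients

/-- The coefficients of a linear combination of vectors depend smoothly on the vectors and on the
combination, near linearly independent vectors. -/
lemma exists_contDiffAt_coeff {ι E : Type*} [Fintype ι] [NormedAddCommGroup E] [NormedSpace ℝ E]
    [FiniteDimensional ℝ E] {u : ι → E} (hu : LinearIndependent ℝ u) (z : E) :
    ∃ C : (ι → E) × E → ι → ℝ, ContDiffAt ℝ ∞ C (u, z) ∧
      ∀ᶠ p in 𝓝 (u, z), ∀ a : ι → ℝ, p.2 = ∑ i, a i • p.1 i → a = C p := by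
  classical
  have hinj : LinearMap.ker (Fintype.linearCombination ℝ u) = ⊥ :=
    LinearMap.ker_eq_bot.2 hu.fintypeLinearCombination_injective
  obtain ⟨l, hl⟩ := LinearMap.exists_leftInverse_of_injective _ hinj
  let L : E →L[ℝ] ι → ℝ := LinearMap.toContinuousLinearMap l
  -- `Λ v` sends `a` to `L (∑ aᵢ vᵢ)`. It is the identity at `v = u`, hence invertible nearby, and
  -- `(Λ v)⁻¹ (L z)` recovers the coefficients smoothly.
  let Λ : (ι → E) →L[ℝ] ((ι → ℝ) →L[ℝ] ι → ℝ) :=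
    ∑ i, ((ContinuousLinearMap.smulRightL ℝ (ι → ℝ) (ι → ℝ)
      (ContinuousLinearMap.proj i)).comp L).comp (ContinuousLinearMap.proj i)
  have hΛ : ∀ v a, Λ v a = L (∑ i, a i • v i) := by
    intro v a
    simp [Λ, map_sum]
  have hΛu : Λ u = 1 := by
    ext1 a
    rw [hΛ]
    exact LinearMap.congr_fun hl a
  refine ⟨fun p => Ring.inverse (Λ p.1) (L p.2), ?_, ?_⟩
  · have h1 : ContDiffAt ℝ ∞ (fun p : (ι → E) × E => Λ p.1) (u, z) :=
      (Λ.contDiff.comp contDiff_fst).contDiffAt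
    have h2 : ContDiffAt ℝ ∞ Ring.inverse (Λ u) := by
      rw [hΛu]
      exact contDiffAt_ringInverse ℝ (1 : ((ι → ℝ) →L[ℝ] ι → ℝ)ˣ)
    have h3 : ContDiffAt ℝ ∞ (fun p : (ι → E) × E => Ring.inverse (Λ p.1)) (u, z) :=
      ContDiffAt.comp (g := Ring.inverse) (f := fun p : (ι → E) × E => Λ p.1) (u, z) h2 h1
    exact h3.clm_apply (L.contDiff.comp contDiff_snd).contDiffAt
  · have hc : ContinuousAt (fun p : (ι → E) × E => Λ p.1) (u, z) :=
      (Λ.continuous.comp continuous_fst).continuousAt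
    have hmem : {A : (ι → ℝ) →L[ℝ] ι → ℝ | IsUnit A} ∈ 𝓝 (Λ u) := by
      rw [hΛu]
      exact Units.isOpen.mem_nhds isUnit_one
    filter_upwards [hc.preimage_mem_nhds hmem] with p hp a ha
    rw [ha, ← hΛ]
    exact (congrArg (fun A : (ι → ℝ) →L[ℝ] ι → ℝ => A a)
      (Ring.inverse_mul_cancel _ hp)).symm

variable {E : Type*} [NormedAddCommGroup E] [NormedSpace ℝ E]
  {M : Type*} [TopologicalSpace M] [ChartedSpace E M] [IsManifold 𝓘(ℝ, E) ∞ M]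

/-- The vector field `Y` is smooth at `x`. -/
abbrev SmoothAt (Y : ∀ x : M, TangentSpace 𝓘(ℝ, E) x) (x : M) : Prop :=
  ContMDiffAt 𝓘(ℝ, E) 𝓘(ℝ, E).tangent ∞ (fun x => (⟨x, Y x⟩ : TangentBundle 𝓘(ℝ, E) M)) x

/-- No regularity of the `a i` is assumed: independence determines them, and smoothness is inherited
from the fields. Structure, curvature and covariant-derivative coefficients are all shown to be
smooth in this way. -/
theorem contMDiffAt_coeff {ι : Type*} [Fintype ι] [FiniteDimensional ℝ E]
    {u : ι → ∀ x : M, TangentSpace 𝓘(ℝ, E) x} {z : ∀ x : M, TangentSpace 𝓘(ℝ, E) x}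
    {a : ι → M → ℝ} {x : M} (hu : ∀ i, SmoothAt (u i) x) (hz : SmoothAt z x)
    (hli : LinearIndependent ℝ (fun i => u i x))
    (h : ∀ᶠ y in 𝓝 x, z y = ∑ i, a i y • u i y) (i : ι) :
    ContMDiffAt 𝓘(ℝ, E) 𝓘(ℝ, ℝ) ∞ (a i) x := by
  set e := trivializationAt E (TangentSpace 𝓘(ℝ, E) : M → Type _) x with he
  have hbase : ∀ᶠ y in 𝓝 x, y ∈ e.baseSet :=
    e.open_baseSet.mem_nhds (FiberBundle.mem_baseSet_trivializationAt' x)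
  have hxb : x ∈ e.baseSet := FiberBundle.mem_baseSet_trivializationAt' x
  let L : ∀ y : M, TangentSpace 𝓘(ℝ, E) y →ₗ[ℝ] E := fun y => (e.continuousLinearMapAt ℝ y)
  have hL : ∀ y ∈ e.baseSet, ∀ v : TangentSpace 𝓘(ℝ, E) y, (e ⟨y, v⟩).2 = L y v := by
    intro y hy v
    exact (e.coe_linearMapAt_of_mem (R := ℝ) hy ▸ rfl)
  have hsm : ∀ Y : ∀ x : M, TangentSpace 𝓘(ℝ, E) x, SmoothAt Y x →
      ContMDiffAt 𝓘(ℝ, E) 𝓘(ℝ, E) ∞ (fun y => L y (Y y)) x := by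
    intro Y hY
    have := (Bundle.contMDiffAt_section x).1 hY
    refine this.congr_of_eventuallyEq ?_
    filter_upwards [hbase] with y hy
    exact (hL y hy _).symm
  have hinj : Function.Injective (L x) := by
    have := (e.continuousLinearEquivAt ℝ x hxb).injective
    intro v w hvw
    refine this ?_
    have h1 := hL x hxb v
    have h2 := hL x hxb w
    exact h1.trans (hvw.trans h2.symm)
  have hli' : LinearIndependent ℝ (fun i => L x (u i x)) :=
    hli.map' (L x) (LinearMap.ker_eq_bot.2 hinj)
  obtain ⟨C, hC, hev⟩ := exists_contDiffAt_coeff hli' (L x (z x))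
  have hpair : ContMDiffAt 𝓘(ℝ, E) 𝓘(ℝ, (ι → E) × E) ∞
      (fun y => ((fun i => L y (u i y)), L y (z y))) x := by
    refine ContMDiffAt.prodMk_space ?_ (hsm z hz)
    exact contMDiffAt_pi_space.2 fun i => hsm (u i) (hu i)
  have hcomp : ContMDiffAt 𝓘(ℝ, E) 𝓘(ℝ, ι → ℝ) ∞
      (fun y => C ((fun i => L y (u i y)), L y (z y))) x :=
    hC.contMDiffAt.comp x hpair
  refine (contMDiffAt_pi_space.1 hcomp i).congr_of_eventuallyEq ?_
  filter_upwards [h, hpair.continuousAt.eventually hev] with y hy hy'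
  have := hy' (fun i => a i y) (by simp only [hy, map_sum, map_smul])
  exact congrFun this i

end Coefficients

/-! ### Leibniz rules for the Lie bracket -/

section Leibniz

variable {E : Type*} [NormedAddCommGroup E] [NormedSpace ℝ E]
  {M : Type*} [TopologicalSpace M] [ChartedSpace E M]

lemma mlieBracket_congr_right {x : M} {X Y Z : ∀ x : M, TangentSpace 𝓘(ℝ, E) x}
    (h : ∀ᶠ y in 𝓝 x, Y y = Z y) :
    mlieBracket 𝓘(ℝ, E) X Y x = mlieBracket 𝓘(ℝ, E) X Z x :=
  Filter.EventuallyEq.mlieBracket_vectorField_eq (Filter.EventuallyEq.refl _ X) h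

variable [IsManifold 𝓘(ℝ, E) ∞ M]

/-- The derivative of the function `f` in the direction of `X`. -/
def dirDeriv (X : ∀ x : M, TangentSpace 𝓘(ℝ, E) x) (f : M → ℝ) (x : M) : ℝ :=
  mvfderiv 𝓘(ℝ, E) f x (X x)

/-- The function `f` is smooth at `x`. -/
abbrev SmoothFunAt (E : Type*) [NormedAddCommGroup E] [NormedSpace ℝ E] {M : Type*}
    [TopologicalSpace M] [ChartedSpace E M] (f : M → ℝ) (x : M) : Prop :=
  ContMDiffAt 𝓘(ℝ, E) 𝓘(ℝ, ℝ) ∞ f x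

variable {X : ∀ x : M, TangentSpace 𝓘(ℝ, E) x} {x : M}

lemma SmoothAt.mdifferentiableAt {Y : ∀ x : M, TangentSpace 𝓘(ℝ, E) x} (hY : SmoothAt Y x) :
    MDifferentiableAt 𝓘(ℝ, E) 𝓘(ℝ, E).tangent
      (fun x => (⟨x, Y x⟩ : TangentBundle 𝓘(ℝ, E) M)) x :=
  ContMDiffAt.mdifferentiableAt hY (by simp)

lemma SmoothAt.mlieBracket [CompleteSpace E] {Y : ∀ x : M, TangentSpace 𝓘(ℝ, E) x}
    (hX : SmoothAt X x) (hY : SmoothAt Y x) :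
    SmoothAt (VectorField.mlieBracket 𝓘(ℝ, E) X Y) x := by
  have : IsManifold 𝓘(ℝ, E) 2 M := IsManifold.of_le (n := ∞) (by norm_cast)
  have : IsManifold 𝓘(ℝ, E) (minSmoothness ℝ 2) M := by simpa using this
  have : IsManifold 𝓘(ℝ, E) (((⊤ : ℕ∞) : WithTop ℕ∞) + 1) M := ‹IsManifold 𝓘(ℝ, E) ∞ M›
  exact ContMDiffAt.mlieBracket_vectorField (m := ⊤) (n := ⊤) hX hY (by simp)

lemma smoothAt_sum_smul {ι : Type*} [Fintype ι] {a : ι → M → ℝ}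
    {u : ι → ∀ x : M, TangentSpace 𝓘(ℝ, E) x} (ha : ∀ i, SmoothFunAt E (a i) x)
    (hu : ∀ i, SmoothAt (u i) x) : SmoothAt (fun y => ∑ i, a i y • u i y) x :=
  ContMDiffAt.sum_section fun i _ => (ha i).smul_section (hu i)

lemma SmoothAt.congr {Y Z : ∀ x : M, TangentSpace 𝓘(ℝ, E) x} (hY : SmoothAt Y x)
    (h : ∀ᶠ y in 𝓝 x, Z y = Y y) : SmoothAt Z x := by
  refine ContMDiffAt.congr_of_eventuallyEq hY ?_
  filter_upwards [h] with y hy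
  rw [hy]

lemma mlieBracket_sum_smul [CompleteSpace E] {ι : Type*} [Fintype ι] {a : ι → M → ℝ}
    {u : ι → ∀ x : M, TangentSpace 𝓘(ℝ, E) x} (ha : ∀ i, SmoothFunAt E (a i) x)
    (hu : ∀ i, SmoothAt (u i) x) :
    mlieBracket 𝓘(ℝ, E) X (fun y => ∑ i, a i y • u i y) x =
      ∑ i, dirDeriv X (a i) x • u i x + ∑ i, a i x • mlieBracket 𝓘(ℝ, E) X (u i) x := by
  classical
  have : IsManifold 𝓘(ℝ, E) 2 M := IsManifold.of_le (n := ∞) (by norm_cast)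
  have : IsManifold 𝓘(ℝ, E) (minSmoothness ℝ 2) M := by simpa using this
  rw [← Finset.sum_add_distrib]
  suffices H : ∀ s : Finset ι, mlieBracket 𝓘(ℝ, E) X (fun y => ∑ i ∈ s, a i y • u i y) x =
      ∑ i ∈ s, (dirDeriv X (a i) x • u i x + a i x • mlieBracket 𝓘(ℝ, E) X (u i) x) from H _
  intro s
  induction s using Finset.induction_on with
  | empty =>
    simp only [Finset.sum_empty]
    exact congrFun (mlieBracket_zero_right (W := X)) x
  | insert i s hi ih =>
    simp only [Finset.sum_insert hi]
    rw [← ih]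
    have h1 : SmoothAt (a i • u i) x := (ha i).smul_section (hu i)
    have h2 : SmoothAt (fun y => ∑ j ∈ s, a j y • u j y) x :=
      ContMDiffAt.sum_section fun i _ => (ha i).smul_section (hu i)
    have h3 := mlieBracket_smul_right (V := X) ((ha i).mdifferentiableAt (by simp))
      (hu i).mdifferentiableAt
    refine (mlieBracket_add_right (V := X) h1.mdifferentiableAt h2.mdifferentiableAt).trans ?_
    exact congrArg (· + _) h3

lemma mlieBracket_add [CompleteSpace E] {Y Z : ∀ x : M, TangentSpace 𝓘(ℝ, E) x}
    (hY : SmoothAt Y x) (hZ : SmoothAt Z x) :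
    mlieBracket 𝓘(ℝ, E) X (fun y => Y y + Z y) x =
      mlieBracket 𝓘(ℝ, E) X Y x + mlieBracket 𝓘(ℝ, E) X Z x := by
  have : IsManifold 𝓘(ℝ, E) 2 M := IsManifold.of_le (n := ∞) (by norm_cast)
  exact mlieBracket_add_right hY.mdifferentiableAt hZ.mdifferentiableAt

end Leibniz

/-! ### Frames and coefficients of sections -/

section Frames

variable {E : Type*} [NormedAddCommGroup E] [NormedSpace ℝ E]
  {M : Type*} [TopologicalSpace M] [ChartedSpace E M] [IsManifold 𝓘(ℝ, E) ∞ M]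
  {X : ∀ x : M, TangentSpace 𝓘(ℝ, E) x} {𝒱 : ∀ x : M, Submodule ℝ (TangentSpace 𝓘(ℝ, E) x)}
  {m : ℕ} {W : Fin m → ∀ x, 𝒱 x} {N : Set M} {x : M}

lemma IsSmoothSectionOn.smoothAt {Δ : ∀ x : M, Submodule ℝ (TangentSpace 𝓘(ℝ, E) x)}
    {Y : ∀ x, Δ x} (hY : IsSmoothSectionOn Δ Y N) (hN : IsOpen N) (hx : x ∈ N) :
    SmoothAt (fun y => (Y y : TangentSpace 𝓘(ℝ, E) y)) x :=
  ContMDiffOn.contMDiffAt hY (hN.mem_nhds hx)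

lemma IsFrameOn.mono (hW : IsFrameOn 𝒱 W N) {N' : Set M} (h : N' ⊆ N) : IsFrameOn 𝒱 W N' where
  smooth i := ContMDiffOn.mono (hW.smooth i) h
  linearIndependent x hx := hW.linearIndependent x (h hx)
  span_eq_top x hx := hW.span_eq_top x (h hx)

/-- The basis of `𝒱(x)` given by a frame. -/
def IsFrameOn.basis (hW : IsFrameOn 𝒱 W N) (hx : x ∈ N) : Module.Basis (Fin m) ℝ (𝒱 x) :=
  Module.Basis.mk (hW.linearIndependent x hx) (hW.span_eq_top x hx).ge

lemma IsFrameOn.basis_apply (hW : IsFrameOn 𝒱 W N) (hx : x ∈ N) (i : Fin m) :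
    hW.basis hx i = W i x := by
  simp [IsFrameOn.basis]

lemma IsFrameOn.linearIndependent_coe (hW : IsFrameOn 𝒱 W N) (hx : x ∈ N) :
    LinearIndependent ℝ (fun i => (W i x : TangentSpace 𝓘(ℝ, E) x)) :=
  (hW.linearIndependent x hx).map' (𝒱 x).subtype (Submodule.ker_subtype _)

lemma IsFrameOn.exists_coeff [FiniteDimensional ℝ E] (hW : IsFrameOn 𝒱 W N) (hN : IsOpen N)
    (Y : ∀ x, 𝒱 x) : ∃ f : Fin m → M → ℝ, (∀ y ∈ N, Y y = ∑ i, f i y • W i y) ∧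
      ∀ x ∈ N, SmoothAt (fun y => (Y y : TangentSpace 𝓘(ℝ, E) y)) x →
        ∀ i, SmoothFunAt E (f i) x := by
  classical
  refine ⟨fun i y => if h : y ∈ N then (hW.basis h).repr (Y y) i else 0, ?_, ?_⟩
  · intro y hy
    conv_lhs => rw [← (hW.basis hy).sum_repr (Y y)]
    simp [hy, hW.basis_apply]
  · intro x hx hY i
    refine contMDiffAt_coeff (fun i => (hW.smooth i).smoothAt hN hx) hY
      (hW.linearIndependent_coe hx)
      (a := fun i y => if h : y ∈ N then (hW.basis h).repr (Y y) i else 0) ?_ i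
    filter_upwards [hN.mem_nhds hx] with y hy
    have : Y y = ∑ i, (hW.basis hy).repr (Y y) i • W i y := by
      conv_lhs => rw [← (hW.basis hy).sum_repr (Y y)]
      simp [hW.basis_apply]
    have h2 := congrArg (𝒱 y).subtype this
    simp only [map_sum, map_smul] at h2
    simpa [hy] using h2

/-- By the Leibniz rule, replacing frame fields by `∑ fᵢ Wᵢ` adds to the brackets only the vertical
terms `X(fᵢ) Wᵢ`. The rank condition thereby becomes linear independence of `W` and `[X, W]`. -/
lemma distD_eq_span [FiniteDimensional ℝ E] (hN : IsOpen N) (hW : IsFrameOn 𝒱 W N) (hx : x ∈ N) :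
    distD X 𝒱 x = Submodule.span ℝ (range (Sum.elim
      (fun i => (W i x : TangentSpace 𝓘(ℝ, E) x)) (fun i => adX X (W i) x))) := by
  have : CompleteSpace E := FiniteDimensional.complete ℝ E
  have hWs : ∀ (i : Fin m) {b : ℝ}, b • (W i x : TangentSpace 𝓘(ℝ, E) x) ∈
      Submodule.span ℝ (range (Sum.elim (fun i => (W i x : TangentSpace 𝓘(ℝ, E) x))
        (fun i => adX X (W i) x))) := fun i b =>
    Submodule.smul_mem _ _ (Submodule.subset_span ⟨Sum.inl i, rfl⟩)
  refine le_antisymm (Submodule.span_le.2 ?_) (Submodule.span_le.2 ?_)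
  · rintro w ⟨N', Y, hN', hxN', hY, hw⟩
    obtain ⟨f, hf, hfs⟩ := hW.exists_coeff hN Y
    rcases hw with rfl | rfl
    · rw [hf x hx, AddSubmonoidClass.coe_finsetSum]
      exact Submodule.sum_mem _ fun i _ => hWs i
    · have h1 : adX X Y x = _ := (mlieBracket_congr_right (X := X)
        (Z := fun y => ∑ i, f i y • (W i y : TangentSpace 𝓘(ℝ, E) y)) (by
          filter_upwards [hN.mem_nhds hx] with y hy
          rw [hf y hy, AddSubmonoidClass.coe_finsetSum]
          rfl)).trans (mlieBracket_sum_smul (hfs x hx (hY.smoothAt hN' hxN'))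
            fun i => (hW.smooth i).smoothAt hN hx)
      rw [h1]
      refine Submodule.add_mem _ (Submodule.sum_mem _ fun i _ => hWs i)
        (Submodule.sum_mem _ fun i _ => Submodule.smul_mem _ _
          (Submodule.subset_span ⟨Sum.inr i, rfl⟩))
  · rintro w ⟨i | i, rfl⟩
    · exact Submodule.subset_span ⟨N, W i, hN, hx, hW.smooth i, Or.inl rfl⟩
    · exact Submodule.subset_span ⟨N, W i, hN, hx, hW.smooth i, Or.inr rfl⟩

end Frames

/-! ### Linear combinations and shears -/

section Algebra

variable {ι V : Type*} [Fintype ι] [AddCommGroup V] [Module ℝ V]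

lemma sum_smul_sum_smul (P : Matrix ι ι ℝ) (f : ι → ℝ) (w : ι → V) :
    ∑ j, f j • ∑ k, P k j • w k = ∑ k, (P.mulVec f) k • w k := by
  simp only [Finset.smul_sum, smul_smul, Matrix.mulVec, dotProduct, Finset.sum_smul]
  rw [Finset.sum_comm]
  simp only [mul_comm]

/-- The new family arises by a block-triangular change with identity diagonal blocks. -/
lemma linearIndependent_sumElim_add {w h : ι → V} (hi : LinearIndependent ℝ (Sum.elim w h))
    (P : Matrix ι ι ℝ) :
    LinearIndependent ℝ (Sum.elim w fun j => h j + ∑ k, P k j • w k) := by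
  rw [Fintype.linearIndependent_iff] at hi ⊢
  intro a ha
  simp only [Fintype.sum_sum_type, Sum.elim_inl, Sum.elim_inr, smul_add,
    Finset.sum_add_distrib, sum_smul_sum_smul] at ha
  have := hi (Sum.elim (fun k => a (.inl k) + (P.mulVec fun j => a (.inr j)) k)
    fun j => a (.inr j)) (by
      simp only [Fintype.sum_sum_type, Sum.elim_inl, Sum.elim_inr, add_smul,
        Finset.sum_add_distrib]
      rw [← ha]
      abel)
  have hr : ∀ j, a (.inr j) = 0 := fun j => this (.inr j)
  rintro (k | j)
  · have hk := this (.inl k)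
    have h0 : (fun j => a (.inr j)) = 0 := funext hr
    simpa [h0] using hk
  · exact hr j

end Algebra

lemma dirDeriv_const_mul {E : Type*} [NormedAddCommGroup E] [NormedSpace ℝ E] {M : Type*}
    [TopologicalSpace M] [ChartedSpace E M] {X : ∀ x : M, TangentSpace 𝓘(ℝ, E) x} {x : M}
    {f : M → ℝ} (hf : SmoothFunAt E f x) (a : ℝ) :
    dirDeriv X (fun y => a * f y) x = a * dirDeriv X f x := by
  have h := mvfderiv_mul (I := 𝓘(ℝ, E)) (f := fun _ : M => a) (g := f) (x := x)
    mdifferentiableAt_const (hf.mdifferentiableAt (by simp))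
  have h2 := congrArg (fun φ : TangentSpace 𝓘(ℝ, E) x →L[ℝ] ℝ => φ (X x)) h
  refine h2.trans ?_
  simp [dirDeriv, mvfderiv_const]

/-! ### Frames satisfying the structure equation -/

section AdaptedFrames

variable {E : Type*} [NormedAddCommGroup E] [NormedSpace ℝ E]
  {M : Type*} [TopologicalSpace M] [ChartedSpace E M] [IsManifold 𝓘(ℝ, E) ∞ M]

/-- `W` is a frame of `𝒱` on the open set `N` which, together with `[X, W]`, is linearly independent
and satisfies the structure equation with matrices `H₀`, `H₁`. -/
structure IsAdaptedFrame (X : ∀ x : M, TangentSpace 𝓘(ℝ, E) x)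
    (𝒱 : ∀ x : M, Submodule ℝ (TangentSpace 𝓘(ℝ, E) x)) {m : ℕ} (W : Fin m → ∀ x, 𝒱 x)
    (H₀ H₁ : M → Matrix (Fin m) (Fin m) ℝ) (N : Set M) : Prop where
  isOpen : IsOpen N
  frame : IsFrameOn 𝒱 W N
  smooth_field : ∀ x ∈ N, SmoothAt X x
  field_ne_zero : ∀ x ∈ N, X x ≠ 0
  structureEq : ∀ x ∈ N, StructureEq X W H₀ H₁ x
  linearIndependent : ∀ x ∈ N, LinearIndependent ℝ
    (Sum.elim (fun i => (W i x : TangentSpace 𝓘(ℝ, E) x)) fun i => adX X (W i) x)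

/-- The horizontal fields `[X, W] - (1/2) W H₁` of a frame. -/
def hor (X : ∀ x : M, TangentSpace 𝓘(ℝ, E) x)
    {𝒱 : ∀ x : M, Submodule ℝ (TangentSpace 𝓘(ℝ, E) x)} {m : ℕ} (W : Fin m → ∀ x, 𝒱 x)
    (H₁ : M → Matrix (Fin m) (Fin m) ℝ) (j : Fin m) (x : M) : TangentSpace 𝓘(ℝ, E) x :=
  adX X (W j) x + ∑ k, ((-(1 / 2 : ℝ)) • H₁ x) k j • (W k x : TangentSpace 𝓘(ℝ, E) x)

variable {X : ∀ x : M, TangentSpace 𝓘(ℝ, E) x} {𝒱 : ∀ x : M, Submodule ℝ (TangentSpace 𝓘(ℝ, E) x)}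
  {m : ℕ} {W : Fin m → ∀ x, 𝒱 x} {H₀ H₁ : M → Matrix (Fin m) (Fin m) ℝ} {U N : Set M} {x : M}

lemma IsRegularOn.linearIndependent [FiniteDimensional ℝ E] (h : IsRegularOn X 𝒱 m U)
    (hN : IsOpen N) (hW : IsFrameOn 𝒱 W N) (hxU : x ∈ U) (hx : x ∈ N) : LinearIndependent ℝ
      (Sum.elim (fun i => (W i x : TangentSpace 𝓘(ℝ, E) x)) fun i => adX X (W i) x) := by
  rw [linearIndependent_iff_card_eq_finrank_span, Set.finrank, ← distD_eq_span hN hW hx,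
    h.rank_distD x hxU]
  simp [two_mul]

lemma IsRegularOn.isAdaptedFrame [FiniteDimensional ℝ E] (h : IsRegularOn X 𝒱 m U)
    (hU : IsOpen U) (hN : IsOpen N) (hNU : N ⊆ U) (hW : IsFrameOn 𝒱 W N)
    (hs : ∀ x ∈ N, StructureEq X W H₀ H₁ x) : IsAdaptedFrame X 𝒱 W H₀ H₁ N where
  isOpen := hN
  frame := hW
  smooth_field _ hx := ContMDiffOn.contMDiffAt h.smooth_field (hU.mem_nhds (hNU hx))
  field_ne_zero x hx := h.field_ne_zero x (hNU hx)
  structureEq := hs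
  linearIndependent _ hx := h.linearIndependent hN hW (hNU hx) hx

lemma IsFrameOn.smoothAt_adX [CompleteSpace E] (hN : IsOpen N) (hW : IsFrameOn 𝒱 W N)
    (hX : SmoothAt X x) (hx : x ∈ N) (j : Fin m) : SmoothAt (adX X (W j)) x :=
  hX.mlieBracket ((hW.smooth j).smoothAt hN hx)

/-- The fields `[X, Wⱼ]` are sections of `𝒟`, so invariance of `𝒟` puts `[X, [X, Wⱼ]]` in the span
of `W` and `[X, W]`; its coefficients are the columns of `H₀` and `H₁`. -/
lemma IsRegularOn.exists_isAdaptedFrame [FiniteDimensional ℝ E] (h : IsRegularOn X 𝒱 m U)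
    (hU : IsOpen U) (hx : x ∈ U) :
    ∃ (N : Set M) (W : Fin m → ∀ x, 𝒱 x) (H₀ H₁ : M → Matrix (Fin m) (Fin m) ℝ),
      x ∈ N ∧ IsAdaptedFrame X 𝒱 W H₀ H₁ N := by
  classical
  have : CompleteSpace E := FiniteDimensional.complete ℝ E
  obtain ⟨N₁, W, hN₁, hxN₁, hW₁⟩ := h.smooth_distribution x hx
  have hN : IsOpen (N₁ ∩ U) := hN₁.inter hU
  have hW : IsFrameOn 𝒱 W (N₁ ∩ U) := hW₁.mono inter_subset_left
  have hX : ∀ y ∈ N₁ ∩ U, SmoothAt X y := fun y hy =>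
    ContMDiffOn.contMDiffAt h.smooth_field (hU.mem_nhds hy.2)
  have hmem : ∀ y ∈ N₁ ∩ U, ∀ j, adX X (W j) y ∈ distD X 𝒱 y := fun y hy j =>
    Submodule.subset_span ⟨_, W j, hN, hy, hW.smooth j, Or.inr rfl⟩
  -- A section must take values in `𝒟` on all of `M`, so the bracket is replaced by `0` off the
  -- neighbourhood. Brackets depend only on germs and are unaffected inside it.
  let Z : Fin m → ∀ y, distD X 𝒱 y := fun j y =>
    if hy : y ∈ N₁ ∩ U then ⟨adX X (W j) y, hmem y hy j⟩ else 0
  have hZ : ∀ j, ∀ y ∈ N₁ ∩ U, (Z j y : TangentSpace 𝓘(ℝ, E) y) = adX X (W j) y := by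
    intro j y hy
    simp only [Z, dif_pos hy]
  have hZ' : ∀ j, ∀ y ∈ N₁ ∩ U, ∀ᶠ z in 𝓝 y,
      (Z j z : TangentSpace 𝓘(ℝ, E) z) = adX X (W j) z := fun j y hy =>
    Filter.eventually_of_mem (hN.mem_nhds hy) (hZ j)
  have hZs : ∀ j, IsSmoothSectionOn (distD X 𝒱) (Z j) (N₁ ∩ U) := fun j y hy =>
    ContMDiffAt.contMDiffWithinAt
      ((hW.smoothAt_adX hN (hX y hy) hy j).congr (hZ' j y hy))
  have key : ∀ y ∈ N₁ ∩ U, ∀ j, ∃ a : Fin m ⊕ Fin m → ℝ,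
      ∑ i, a i • (Sum.elim (fun i => (W i y : TangentSpace 𝓘(ℝ, E) y))
        (fun i => adX X (W i) y)) i = adX2 X (W j) y := by
    intro y hy j
    have h1 := h.invariance _ (Z j) hN inter_subset_right (hZs j) y hy
    rw [distD_eq_span hN hW hy] at h1
    have h2 : adX X (Z j) y = adX2 X (W j) y := mlieBracket_congr_right (hZ' j y hy)
    rw [h2] at h1
    exact (Submodule.mem_span_range_iff_exists_fun ℝ).1 h1
  choose! a ha using key
  refine ⟨N₁ ∩ U, W, fun y => Matrix.of fun i j => a y j (.inl i),
    fun y => Matrix.of fun i j => a y j (.inr i), ⟨hxN₁, hx⟩,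
    h.isAdaptedFrame hU hN inter_subset_right hW ?_⟩
  intro y hy j
  rw [← ha y hy j, Fintype.sum_sum_type]
  rfl

end AdaptedFrames

/-! ### Brackets of `X` with horizontal fields and sections -/

section HorizontalFields

variable {E : Type*} [NormedAddCommGroup E] [NormedSpace ℝ E]
  {M : Type*} [TopologicalSpace M] [ChartedSpace E M]
  {X : ∀ x : M, TangentSpace 𝓘(ℝ, E) x} {𝒱 : ∀ x : M, Submodule ℝ (TangentSpace 𝓘(ℝ, E) x)}
  {m : ℕ} {W : Fin m → ∀ x, 𝒱 x} {H₀ H₁ : M → Matrix (Fin m) (Fin m) ℝ} {N : Set M} {x : M}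

lemma adX_eq_sum_add_hor (X : ∀ x : M, TangentSpace 𝓘(ℝ, E) x) (W : Fin m → ∀ x, 𝒱 x)
    (H₁ : M → Matrix (Fin m) (Fin m) ℝ) (j : Fin m) (x : M) :
    adX X (W j) x = ∑ k, ((1 / 2 : ℝ) • H₁ x) k j • (W k x : TangentSpace 𝓘(ℝ, E) x)
      + hor X W H₁ j x := by
  simp only [hor, Matrix.smul_apply, smul_eq_mul, neg_mul, neg_smul, Finset.sum_neg_distrib]
  abel

namespace IsAdaptedFrame

variable [IsManifold 𝓘(ℝ, E) ∞ M]

lemma smoothAt_frame (hF : IsAdaptedFrame X 𝒱 W H₀ H₁ N) (hx : x ∈ N) (i : Fin m) :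
    SmoothAt (fun y => (W i y : TangentSpace 𝓘(ℝ, E) y)) x :=
  (hF.frame.smooth i).smoothAt hF.isOpen hx

lemma linearIndependent_hor (hF : IsAdaptedFrame X 𝒱 W H₀ H₁ N) (hx : x ∈ N) :
    LinearIndependent ℝ (Sum.elim (fun i => (W i x : TangentSpace 𝓘(ℝ, E) x))
      fun i => hor X W H₁ i x) :=
  linearIndependent_sumElim_add (hF.linearIndependent x hx) _

lemma coeff_eq_zero (hF : IsAdaptedFrame X 𝒱 W H₀ H₁ N) (hx : x ∈ N) {b : Fin m → ℝ}
    (h : ∑ i, b i • hor X W H₁ i x ∈ 𝒱 x) : b = 0 := by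
  obtain ⟨a, ha⟩ : ∃ a : Fin m → ℝ, ∑ i, b i • hor X W H₁ i x =
      ∑ i, a i • (W i x : TangentSpace 𝓘(ℝ, E) x) := by
    refine ⟨(hF.frame.basis hx).repr ⟨_, h⟩, ?_⟩
    have := congrArg (𝒱 x).subtype ((hF.frame.basis hx).sum_repr ⟨_, h⟩)
    simp only [map_sum, map_smul, hF.frame.basis_apply] at this
    exact this.symm
  have := Fintype.linearIndependent_iff.1 (hF.linearIndependent_hor hx)
    (Sum.elim (fun i => -a i) b) (by
      simp [Fintype.sum_sum_type, ha])
  exact funext fun i => this (.inr i)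

variable [FiniteDimensional ℝ E]

lemma smoothAt_adX (hF : IsAdaptedFrame X 𝒱 W H₀ H₁ N) (hx : x ∈ N) (i : Fin m) :
    SmoothAt (adX X (W i)) x :=
  have : CompleteSpace E := FiniteDimensional.complete ℝ E
  hF.frame.smoothAt_adX hF.isOpen (hF.smooth_field x hx) hx i

lemma smoothFunAt_H₀_H₁ (hF : IsAdaptedFrame X 𝒱 W H₀ H₁ N) (hx : x ∈ N) (i j : Fin m) :
    SmoothFunAt E (fun y => H₀ y i j) x ∧ SmoothFunAt E (fun y => H₁ y i j) x := by
  have : CompleteSpace E := FiniteDimensional.complete ℝ E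
  have hu : ∀ k : Fin m ⊕ Fin m, SmoothAt (Sum.elim
      (fun i y => (W i y : TangentSpace 𝓘(ℝ, E) y)) (fun i => adX X (W i)) k) x := by
    rintro (k | k)
    exacts [hF.smoothAt_frame hx k, hF.smoothAt_adX hx k]
  have hz : SmoothAt (adX2 X (W j)) x := (hF.smooth_field x hx).mlieBracket (hF.smoothAt_adX hx j)
  have hli : LinearIndependent ℝ (fun k => Sum.elim
      (fun i y => (W i y : TangentSpace 𝓘(ℝ, E) y)) (fun i => adX X (W i)) k x) := by
    convert hF.linearIndependent x hx with k
    rcases k with k | k <;> rfl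
  have h : ∀ᶠ y in 𝓝 x, adX2 X (W j) y = ∑ k, Sum.elim (fun i y => H₀ y i j)
      (fun i y => H₁ y i j) k y • Sum.elim
        (fun i y => (W i y : TangentSpace 𝓘(ℝ, E) y)) (fun i => adX X (W i)) k y := by
    filter_upwards [hF.isOpen.mem_nhds hx] with y hy
    rw [hF.structureEq y hy j, Fintype.sum_sum_type]
    rfl
  exact ⟨contMDiffAt_coeff hu hz hli h (.inl i), contMDiffAt_coeff hu hz hli h (.inr i)⟩

lemma smoothFunAt_half (hF : IsAdaptedFrame X 𝒱 W H₀ H₁ N) (hx : x ∈ N) (a : ℝ) (k j : Fin m) :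
    SmoothFunAt E (fun y => (a • H₁ y) k j) x :=
  contMDiffAt_const.mul (hF.smoothFunAt_H₀_H₁ hx k j).2

lemma smoothAt_hor (hF : IsAdaptedFrame X 𝒱 W H₀ H₁ N) (hx : x ∈ N) (j : Fin m) :
    SmoothAt (hor X W H₁ j) x :=
  ContMDiffAt.add_section (hF.smoothAt_adX hx j)
    (smoothAt_sum_smul (fun k => hF.smoothFunAt_half hx _ k j) (hF.smoothAt_frame hx))

/-- The bracket is `W (H₀ - (1/2) X(H₁)) + (1/2) [X, W] H₁`. Substituting `[X, W] = h + (1/2) W H₁`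
leaves the same connection term `(1/2) H₁` as for `W`, and the vertical remainder is minus the
curvature matrix. -/
lemma mlieBracket_hor (hF : IsAdaptedFrame X 𝒱 W H₀ H₁ N) (hx : x ∈ N) (j : Fin m) :
    mlieBracket 𝓘(ℝ, E) X (hor X W H₁ j) x =
      ∑ k, (-curvatureMatrix X H₀ H₁ x) k j • (W k x : TangentSpace 𝓘(ℝ, E) x)
        + ∑ k, ((1 / 2 : ℝ) • H₁ x) k j • hor X W H₁ k x := by
  have : CompleteSpace E := FiniteDimensional.complete ℝ E
  have h1 : mlieBracket 𝓘(ℝ, E) X (hor X W H₁ j) x = _ :=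
    (mlieBracket_add (X := X) (hF.smoothAt_adX hx j) (smoothAt_sum_smul
      (fun k => hF.smoothFunAt_half hx (-(1 / 2)) k j) (hF.smoothAt_frame hx))).trans
    (congrArg₂ (· + ·) (hF.structureEq x hx j)
      (mlieBracket_sum_smul (fun k => hF.smoothFunAt_half hx (-(1 / 2)) k j)
        (hF.smoothAt_frame hx)))
  have hd : ∀ k, dirDeriv X (fun y => (-(1 / 2 : ℝ) • H₁ y) k j) x =
      -(1 / 2) * dirDeriv X (fun y => H₁ y k j) x := fun k =>
    dirDeriv_const_mul (hF.smoothFunAt_H₀_H₁ hx k j).2 _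
  rw [h1]
  have h2 : ∀ k, hor X W H₁ k x = adX X (W k) x +
    ∑ l, ((-(1 / 2 : ℝ)) • H₁ x) l k • (W l x : TangentSpace 𝓘(ℝ, E) x) := fun k => rfl
  simp only [h2, smul_add, Finset.sum_add_distrib]
  rw [sum_smul_sum_smul (-(1 / 2 : ℝ) • H₁ x)]
  have h3 : ∀ k, mlieBracket 𝓘(ℝ, E) X (fun y => (W k y : TangentSpace 𝓘(ℝ, E) y)) x =
    adX X (W k) x := fun k => rfl
  simp only [h3, hd]
  have e1 : ∑ k, H₁ x k j • adX X (W k) x + ∑ k, (-(1 / 2 : ℝ) • H₁ x) k j • adX X (W k) x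
      = ∑ k, ((1 / 2 : ℝ) • H₁ x) k j • adX X (W k) x := by
    rw [← Finset.sum_add_distrib]
    refine Finset.sum_congr rfl fun k _ => ?_
    rw [← add_smul]
    congr 1
    simp only [Matrix.smul_apply, smul_eq_mul]
    ring
  have e2 : ∑ k, H₀ x k j • (W k x : TangentSpace 𝓘(ℝ, E) x)
      + ∑ k, (-(1 / 2) * dirDeriv X (fun y => H₁ y k j) x) • (W k x : TangentSpace 𝓘(ℝ, E) x)
      = ∑ k, (-curvatureMatrix X H₀ H₁ x) k j • (W k x : TangentSpace 𝓘(ℝ, E) x)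
        + ∑ k, ((-(1 / 2 : ℝ) • H₁ x).mulVec fun k => ((1 / 2 : ℝ) • H₁ x) k j) k •
          (W k x : TangentSpace 𝓘(ℝ, E) x) := by
    rw [← Finset.sum_add_distrib, ← Finset.sum_add_distrib]
    refine Finset.sum_congr rfl fun k _ => ?_
    rw [← add_smul, ← add_smul]
    congr 1
    have : ((-(1 / 2 : ℝ) • H₁ x).mulVec fun k => ((1 / 2 : ℝ) • H₁ x) k j) k =
        -(1 / 4) * (H₁ x * H₁ x) k j := by
      simp only [Matrix.mulVec, dotProduct, Matrix.mul_apply, Finset.mul_sum, Matrix.smul_apply,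
        smul_eq_mul]
      exact Finset.sum_congr rfl fun l _ => by ring
    rw [this]
    simp only [curvatureMatrix, Matrix.neg_apply, Matrix.sub_apply, Matrix.add_apply,
      Matrix.smul_apply, Matrix.of_apply, smul_eq_mul, dirDeriv]
    ring
  rw [← e1, add_add_add_comm, e2]
  abel

/-- The entries are, up to sign, the vertical coefficients of the smooth fields `[X, hor]`. -/
lemma smoothFunAt_curvatureMatrix (hF : IsAdaptedFrame X 𝒱 W H₀ H₁ N) (hx : x ∈ N)
    (k j : Fin m) : SmoothFunAt E (fun y => curvatureMatrix X H₀ H₁ y k j) x := by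
  have : CompleteSpace E := FiniteDimensional.complete ℝ E
  have hu : ∀ k : Fin m ⊕ Fin m, SmoothAt (Sum.elim
      (fun i y => (W i y : TangentSpace 𝓘(ℝ, E) y)) (fun i => hor X W H₁ i) k) x := by
    rintro (k | k)
    exacts [hF.smoothAt_frame hx k, hF.smoothAt_hor hx k]
  have hli : LinearIndependent ℝ (fun k => Sum.elim
      (fun i y => (W i y : TangentSpace 𝓘(ℝ, E) y)) (fun i => hor X W H₁ i) k x) := by
    convert hF.linearIndependent_hor hx with k
    rcases k with k | k <;> rfl
  have h := contMDiffAt_coeff (a := Sum.elim (fun i y => (-curvatureMatrix X H₀ H₁ y) i j)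
    (fun i y => ((1 / 2 : ℝ) • H₁ y) i j)) hu
    ((hF.smooth_field x hx).mlieBracket (hF.smoothAt_hor hx j)) hli (by
      filter_upwards [hF.isOpen.mem_nhds hx] with y hy
      refine (hF.mlieBracket_hor hy j).trans ?_
      rw [Fintype.sum_sum_type]
      rfl) (.inl k)
  refine (ContMDiffAt.neg h).congr_of_eventuallyEq (Filter.Eventually.of_forall fun y => ?_)
  simp

/-- The derivative of the coefficients of a section along `X`, corrected by the structure matrix. -/
def covCoeff (X : ∀ x : M, TangentSpace 𝓘(ℝ, E) x) (H₁ : M → Matrix (Fin m) (Fin m) ℝ)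
    (f : Fin m → M → ℝ) (k : Fin m) (x : M) : ℝ :=
  dirDeriv X (f k) x + (((1 / 2 : ℝ) • H₁ x).mulVec fun j => f j x) k

lemma adX_section (hF : IsAdaptedFrame X 𝒱 W H₀ H₁ N) (hx : x ∈ N) {Y : ∀ x, 𝒱 x}
    {f : Fin m → M → ℝ} (hf : ∀ i, SmoothFunAt E (f i) x)
    (hY : ∀ᶠ y in 𝓝 x, (Y y : TangentSpace 𝓘(ℝ, E) y) = ∑ i, f i y • (W i y : TangentSpace 𝓘(ℝ, E) y)) :
    adX X Y x = ∑ k, covCoeff X H₁ f k x • (W k x : TangentSpace 𝓘(ℝ, E) x)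
      + ∑ i, f i x • hor X W H₁ i x := by
  have : CompleteSpace E := FiniteDimensional.complete ℝ E
  have h1 : adX X Y x = _ := (mlieBracket_congr_right (X := X) hY).trans
    (mlieBracket_sum_smul hf (hF.smoothAt_frame hx))
  have h3 : ∀ k, mlieBracket 𝓘(ℝ, E) X (fun y => (W k y : TangentSpace 𝓘(ℝ, E) y)) x =
      ∑ l, ((1 / 2 : ℝ) • H₁ x) l k • (W l x : TangentSpace 𝓘(ℝ, E) x) + hor X W H₁ k x :=
    fun k => adX_eq_sum_add_hor X W H₁ k x
  rw [h1]
  simp only [h3, smul_add, Finset.sum_add_distrib, covCoeff, add_smul]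
  rw [sum_smul_sum_smul ((1 / 2 : ℝ) • H₁ x)]
  abel

/-- The horizontal part of the second bracket receives `covCoeff` twice: once from the vertical part
of `[X, Y]`, and once from differentiating its horizontal part `∑ fᵢ hᵢ`. Normality depends only on
this part, so the vertical coefficients are left unspecified. -/
lemma adX2_section (hF : IsAdaptedFrame X 𝒱 W H₀ H₁ N) (hx : x ∈ N) {Y : ∀ x, 𝒱 x}
    {f : Fin m → M → ℝ} (hf : ∀ᶠ y in 𝓝 x, (∀ i, SmoothFunAt E (f i) y) ∧
      (Y y : TangentSpace 𝓘(ℝ, E) y) = ∑ i, f i y • (W i y : TangentSpace 𝓘(ℝ, E) y)) :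
    ∃ a : Fin m → ℝ, adX2 X Y x = ∑ k, a k • (W k x : TangentSpace 𝓘(ℝ, E) x)
      + ∑ k, (2 * covCoeff X H₁ f k x) • hor X W H₁ k x := by
  have : CompleteSpace E := FiniteDimensional.complete ℝ E
  have hev : ∀ᶠ y in 𝓝 x, adX X Y y =
      ∑ k, covCoeff X H₁ f k y • (W k y : TangentSpace 𝓘(ℝ, E) y)
        + ∑ i, f i y • hor X W H₁ i y := by
    filter_upwards [hf.eventually_nhds, hF.isOpen.mem_nhds hx] with y hy hyN
    exact hF.adX_section hyN hy.self_of_nhds.1 (hy.mono fun z hz => hz.2)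
  have hfx := hf.self_of_nhds.1
  have hYs : SmoothAt (fun y => (Y y : TangentSpace 𝓘(ℝ, E) y)) x :=
    (smoothAt_sum_smul hfx (hF.smoothAt_frame hx)).congr (hf.mono fun y hy => hy.2)
  have hes : ∀ k, SmoothFunAt E (covCoeff X H₁ f k) x := by
    intro k
    have hu : ∀ k : Fin m ⊕ Fin m, SmoothAt (Sum.elim
        (fun i y => (W i y : TangentSpace 𝓘(ℝ, E) y)) (fun i => hor X W H₁ i) k) x := by
      rintro (k | k)
      exacts [hF.smoothAt_frame hx k, hF.smoothAt_hor hx k]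
    have hli : LinearIndependent ℝ (fun k => Sum.elim
        (fun i y => (W i y : TangentSpace 𝓘(ℝ, E) y)) (fun i => hor X W H₁ i) k x) := by
      convert hF.linearIndependent_hor hx with k
      rcases k with k | k <;> rfl
    refine contMDiffAt_coeff (a := Sum.elim (covCoeff X H₁ f) f) hu
      ((hF.smooth_field x hx).mlieBracket hYs) hli ?_ (.inl k)
    filter_upwards [hev] with y hy
    refine Eq.trans hy ?_
    rw [Fintype.sum_sum_type]
    rfl
  have h1 : adX2 X Y x = _ := (mlieBracket_congr_right (X := X) hev).trans
    ((mlieBracket_add (X := X) (smoothAt_sum_smul hes (hF.smoothAt_frame hx))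
      (smoothAt_sum_smul hfx (hF.smoothAt_hor hx))).trans
      (congrArg₂ (· + ·) (mlieBracket_sum_smul hes (hF.smoothAt_frame hx))
        (mlieBracket_sum_smul hfx (hF.smoothAt_hor hx))))
  have h3 : ∀ k, mlieBracket 𝓘(ℝ, E) X (fun y => (W k y : TangentSpace 𝓘(ℝ, E) y)) x =
      ∑ l, ((1 / 2 : ℝ) • H₁ x) l k • (W l x : TangentSpace 𝓘(ℝ, E) x) + hor X W H₁ k x :=
    fun k => adX_eq_sum_add_hor X W H₁ k x
  have h4 : ∀ k, mlieBracket 𝓘(ℝ, E) X (fun y => hor X W H₁ k y) x = _ :=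
    fun k => hF.mlieBracket_hor hx k
  rw [h1]
  simp only [h3, h4, smul_add, Finset.sum_add_distrib]
  rw [sum_smul_sum_smul ((1 / 2 : ℝ) • H₁ x), sum_smul_sum_smul ((1 / 2 : ℝ) • H₁ x),
    sum_smul_sum_smul (-curvatureMatrix X H₀ H₁ x)]
  refine ⟨fun k => dirDeriv X (covCoeff X H₁ f k) x
    + (((1 / 2 : ℝ) • H₁ x).mulVec fun j => covCoeff X H₁ f j x) k
    + ((-curvatureMatrix X H₀ H₁ x).mulVec fun j => f j x) k, ?_⟩
  have e : ∀ k, (2 * covCoeff X H₁ f k x) = covCoeff X H₁ f k x + dirDeriv X (f k) x +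
      (((1 / 2 : ℝ) • H₁ x).mulVec fun j => f j x) k := by
    intro k
    rw [two_mul, add_assoc]
    rfl
  simp only [e, add_smul, Finset.sum_add_distrib]
  abel

end IsAdaptedFrame

end HorizontalFields

/-! ### The splitting `𝒟 = 𝒱 ⊕ ℋ` and the curvature operator -/

section HorizontalSpace

variable {E : Type*} [NormedAddCommGroup E] [NormedSpace ℝ E]
  {M : Type*} [TopologicalSpace M] [ChartedSpace E M] [IsManifold 𝓘(ℝ, E) ∞ M]
  {X : ∀ x : M, TangentSpace 𝓘(ℝ, E) x} {𝒱 : ∀ x : M, Submodule ℝ (TangentSpace 𝓘(ℝ, E) x)}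
  {m : ℕ} {W W' : Fin m → ∀ x, 𝒱 x} {H₀ H₁ H₀' H₁' : M → Matrix (Fin m) (Fin m) ℝ}
  {N N' : Set M} {x : M}

/-- At a point where `X` does not vanish there is a function with prescribed value and prescribed
derivative along `X`. -/
lemma exists_fun_dirDeriv (hX : X x ≠ 0) (a b : ℝ) :
    ∃ f : M → ℝ, (∀ᶠ y in 𝓝 x, SmoothFunAt E f y) ∧ f x = a ∧ dirDeriv X f x = b := by
  have hex : ∀ v : E, v ≠ 0 → ∃ l : E →L[ℝ] ℝ, l v = 1 := fun v hv =>
    SeparatingDual.exists_eq_one hv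
  obtain ⟨l, hl⟩ := hex (X x) hX
  let L : E → ℝ := fun z => a + b * l (z - extChartAt 𝓘(ℝ, E) x x)
  have hL : ContDiff ℝ ∞ L := by fun_prop
  have hLd : ∀ z, HasFDerivAt L (b • l) z := by
    intro z
    exact ((l.hasFDerivAt.comp z ((hasFDerivAt_id z).sub_const _)).const_mul b).const_add a
  refine ⟨fun y => L (extChartAt 𝓘(ℝ, E) x y), ?_, ?_, ?_⟩
  · filter_upwards [extChartAt_source_mem_nhds (I := 𝓘(ℝ, E)) x] with y hy
    exact hL.contMDiff.contMDiffAt.comp y (contMDiffAt_extChartAt' (by simpa using hy))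
  · simp [L]
  · have h1 : HasMFDerivAt 𝓘(ℝ, E) 𝓘(ℝ, ℝ) (fun y => L (extChartAt 𝓘(ℝ, E) x y)) x
        ((b • l).comp (chartDeriv E x x)) :=
      HasMFDerivAt.comp (g := L) x (hLd _).hasMFDerivAt
        (hasMFDerivAt_chart (mem_extChartAt_source x))
    have h2 : dirDeriv X (fun y => L (extChartAt 𝓘(ℝ, E) x y)) x =
        ((b • l).comp (chartDeriv E x x)) (X x) :=
      congrArg (fun φ : E →L[ℝ] ℝ => φ (X x)) h1.mfderiv
    rw [h2, chartDeriv_self]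
    refine Eq.trans (b := b * l (X x)) rfl ?_
    rw [hl, mul_one]

variable [FiniteDimensional ℝ E]

namespace IsAdaptedFrame

lemma isNormalAt_iff (hF : IsAdaptedFrame X 𝒱 W H₀ H₁ N) (hx : x ∈ N) {Y : ∀ x, 𝒱 x}
    {f : Fin m → M → ℝ} (hf : ∀ᶠ y in 𝓝 x, (∀ i, SmoothFunAt E (f i) y) ∧
      (Y y : TangentSpace 𝓘(ℝ, E) y) = ∑ i, f i y • (W i y : TangentSpace 𝓘(ℝ, E) y)) :
    IsNormalAt X Y x ↔ ∀ k, covCoeff X H₁ f k x = 0 := by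
  obtain ⟨a, ha⟩ := hF.adX2_section hx hf
  have hW : ∑ k, a k • (W k x : TangentSpace 𝓘(ℝ, E) x) ∈ 𝒱 x :=
    Submodule.sum_mem _ fun k _ => Submodule.smul_mem _ _ (W k x).2
  rw [IsNormalAt, ha, Submodule.add_mem_iff_right _ hW]
  constructor
  · intro h k
    simpa using congrFun (hF.coeff_eq_zero hx h) k
  · intro h
    simp [h]

lemma exists_section_coeff (hF : IsAdaptedFrame X 𝒱 W H₀ H₁ N) (hx : x ∈ N) {Y : ∀ x, 𝒱 x}
    (hN' : IsOpen N') (hx' : x ∈ N') (hY : IsSmoothSectionOn 𝒱 Y N') :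
    ∃ f : Fin m → M → ℝ, ∀ᶠ y in 𝓝 x, (∀ i, SmoothFunAt E (f i) y) ∧
      (Y y : TangentSpace 𝓘(ℝ, E) y) = ∑ i, f i y • (W i y : TangentSpace 𝓘(ℝ, E) y) := by
  obtain ⟨f, hf, hfs⟩ := hF.frame.exists_coeff hF.isOpen Y
  refine ⟨f, ?_⟩
  filter_upwards [hF.isOpen.mem_nhds hx, hN'.mem_nhds hx'] with y hy hy'
  refine ⟨hfs y hy (hY.smoothAt hN' hy'), ?_⟩
  rw [hf y hy, AddSubmonoidClass.coe_finsetSum]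
  rfl

/-- A section is normal at `x` exactly when its `covCoeff` vanishes there, and then its bracket with
`X` is `∑ fᵢ hᵢ`. Conversely each `hⱼ` occurs, because `X x ≠ 0` allows the values and the
`X`-derivatives of the `fᵢ` at `x` to be prescribed independently. -/
lemma horizontal_eq (hF : IsAdaptedFrame X 𝒱 W H₀ H₁ N) (hx : x ∈ N) :
    horizontal X 𝒱 x = Submodule.span ℝ (range fun i => hor X W H₁ i x) := by
  classical
  refine le_antisymm (Submodule.span_le.2 ?_) (Submodule.span_le.2 ?_)
  · rintro w ⟨N', Y, hN', hx', hY, hn, rfl⟩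
    obtain ⟨f, hf⟩ := hF.exists_section_coeff hx hN' hx' hY
    have h0 := (hF.isNormalAt_iff hx hf).1 hn
    rw [hF.adX_section hx hf.self_of_nhds.1 (hf.mono fun y hy => hy.2)]
    simp only [h0, zero_smul, Finset.sum_const_zero, zero_add]
    exact Submodule.sum_mem _ fun i _ => Submodule.smul_mem _ _
      (Submodule.subset_span ⟨i, rfl⟩)
  · rintro _ ⟨j, rfl⟩
    have hex : ∀ i, ∃ f : M → ℝ, (∀ᶠ y in 𝓝 x, SmoothFunAt E f y) ∧
        f x = (if i = j then 1 else 0) ∧ dirDeriv X f x = -((1 / 2 : ℝ) • H₁ x) i j :=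
      fun i => exists_fun_dirDeriv (hF.field_ne_zero x hx) _ _
    choose f hfs hfx hfd using hex
    let Y : ∀ y, 𝒱 y := fun y => ∑ i, f i y • W i y
    have hYc : ∀ y, (Y y : TangentSpace 𝓘(ℝ, E) y) =
        ∑ i, f i y • (W i y : TangentSpace 𝓘(ℝ, E) y) := by
      intro y
      simp only [Y, AddSubmonoidClass.coe_finsetSum]
      rfl
    obtain ⟨N₁, hN₁, hN₁o, hxN₁⟩ := eventually_nhds_iff.1 (Filter.eventually_all.2 hfs)
    have hf : ∀ᶠ y in 𝓝 x, (∀ i, SmoothFunAt E (f i) y) ∧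
        (Y y : TangentSpace 𝓘(ℝ, E) y) = ∑ i, f i y • (W i y : TangentSpace 𝓘(ℝ, E) y) := by
      filter_upwards [Filter.eventually_all.2 hfs] with y hy
      exact ⟨hy, hYc y⟩
    have hYs : IsSmoothSectionOn 𝒱 Y (N₁ ∩ N) := fun y hy =>
      ContMDiffAt.contMDiffWithinAt ((smoothAt_sum_smul (hN₁ y hy.1)
        (hF.smoothAt_frame hy.2)).congr (Filter.Eventually.of_forall hYc))
    have hmul : (((1 / 2 : ℝ) • H₁ x).mulVec fun i => f i x) =
        fun k => ((1 / 2 : ℝ) • H₁ x) k j := by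
      ext k
      simp [Matrix.mulVec, dotProduct, hfx]
    have he : ∀ k, covCoeff X H₁ f k x = 0 := by
      intro k
      rw [covCoeff, hfd, hmul]
      ring
    refine Submodule.subset_span ⟨N₁ ∩ N, Y, hN₁o.inter hF.isOpen, ⟨hxN₁, hx⟩, hYs,
      (hF.isNormalAt_iff hx hf).2 he, ?_⟩
    rw [hF.adX_section hx hf.self_of_nhds.1 (hf.mono fun y hy => hy.2)]
    simp [he, hfx]

lemma eq_zero_of_mem_horizontal (hF : IsAdaptedFrame X 𝒱 W H₀ H₁ N) (hx : x ∈ N)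
    {v : TangentSpace 𝓘(ℝ, E) x} (hv : v ∈ 𝒱 x) (hh : v ∈ horizontal X 𝒱 x) : v = 0 := by
  rw [hF.horizontal_eq hx] at hh
  obtain ⟨b, rfl⟩ := (Submodule.mem_span_range_iff_exists_fun ℝ).1 hh
  simp [hF.coeff_eq_zero hx hv]

lemma hor_mem_horizontal (hF : IsAdaptedFrame X 𝒱 W H₀ H₁ N) (hx : x ∈ N) (i : Fin m) :
    hor X W H₁ i x ∈ horizontal X 𝒱 x := by
  rw [hF.horizontal_eq hx]
  exact Submodule.subset_span ⟨i, rfl⟩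

lemma sum_hor_mem_horizontal (hF : IsAdaptedFrame X 𝒱 W H₀ H₁ N) (hx : x ∈ N) (b : Fin m → ℝ) :
    ∑ i, b i • hor X W H₁ i x ∈ horizontal X 𝒱 x :=
  Submodule.sum_mem _ fun i _ => Submodule.smul_mem _ _ (hF.hor_mem_horizontal hx i)

/-- The vector chosen by `Classical.epsilon` is unique because `𝒱 ∩ ℋ = 0`. -/
lemma covDeriv_eq (hF : IsAdaptedFrame X 𝒱 W H₀ H₁ N) (hx : x ∈ N) (j : Fin m) :
    covDeriv X (W j) x = ∑ k, ((1 / 2 : ℝ) • H₁ x) k j • W k x := by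
  have hc : ((∑ k, ((1 / 2 : ℝ) • H₁ x) k j • W k x : 𝒱 x) : TangentSpace 𝓘(ℝ, E) x) =
      ∑ k, ((1 / 2 : ℝ) • H₁ x) k j • (W k x : TangentSpace 𝓘(ℝ, E) x) := by
    rw [AddSubmonoidClass.coe_finsetSum]
    rfl
  have h1 : adX X (W j) x - ((∑ k, ((1 / 2 : ℝ) • H₁ x) k j • W k x : 𝒱 x) :
      TangentSpace 𝓘(ℝ, E) x) = hor X W H₁ j x := by
    rw [hc, adX_eq_sum_add_hor X W H₁, add_sub_cancel_left]
  have h2 : adX X (W j) x - (covDeriv X (W j) x : TangentSpace 𝓘(ℝ, E) x) ∈ horizontal X 𝒱 x :=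
    Classical.epsilon_spec (p := fun v : 𝒱 x =>
      adX X (W j) x - (v : TangentSpace 𝓘(ℝ, E) x) ∈ horizontal X 𝒱 x)
      ⟨_, h1 ▸ hF.hor_mem_horizontal hx j⟩
  have h3 := Submodule.sub_mem _ h2 (h1 ▸ hF.hor_mem_horizontal hx j)
  rw [sub_sub_sub_cancel_left] at h3
  have h4 := hF.eq_zero_of_mem_horizontal hx
    ((∑ k, ((1 / 2 : ℝ) • H₁ x) k j • W k x : 𝒱 x) - covDeriv X (W j) x).2 h3
  exact (sub_eq_zero.1 (Subtype.ext h4)).symm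

/-- The difference of the two sides is horizontal, and also vertical, because both frames represent
the same bracket `[X, W' j]`. Hence `h` changes frame without derivatives of the transition matrix.
-/
lemma hor_eq_sum (hF : IsAdaptedFrame X 𝒱 W H₀ H₁ N) (hF' : IsAdaptedFrame X 𝒱 W' H₀' H₁' N')
    (hx : x ∈ N) (hx' : x ∈ N') {f : Fin m → ℝ} {j : Fin m} (h : W' j x = ∑ i, f i • W i x) :
    hor X W' H₁' j x = ∑ i, f i • hor X W H₁ i x := by
  obtain ⟨a, ha⟩ := hF.exists_section_coeff hx hF'.isOpen hx' (hF'.frame.smooth j)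
  have haf : ∀ i, a i x = f i := by
    have h1 := ha.self_of_nhds.2
    have h2 : ∑ i, a i x • W i x = ∑ i, f i • W i x := by
      rw [← h]
      refine Subtype.ext ?_
      rw [h1, AddSubmonoidClass.coe_finsetSum]
      rfl
    intro i
    have h3 := congrArg (fun v => (hF.frame.basis hx).repr v i) h2
    simpa [← hF.frame.basis_apply hx, Finsupp.single_apply] using h3
  have h1 := hF.adX_section hx ha.self_of_nhds.1 (ha.mono fun y hy => hy.2)
  rw [adX_eq_sum_add_hor X W' H₁'] at h1
  simp only [haf] at h1
  have h2 : hor X W' H₁' j x - ∑ i, f i • hor X W H₁ i x =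
      ∑ k, covCoeff X H₁ a k x • (W k x : TangentSpace 𝓘(ℝ, E) x) -
        ∑ k, ((1 / 2 : ℝ) • H₁' x) k j • (W' k x : TangentSpace 𝓘(ℝ, E) x) := by
    rw [sub_eq_sub_iff_add_eq_add, add_comm, h1]
  refine sub_eq_zero.1 (hF.eq_zero_of_mem_horizontal hx ?_
    (Submodule.sub_mem _ (hF'.hor_mem_horizontal hx' j) (hF.sum_hor_mem_horizontal hx f)))
  rw [h2]
  exact Submodule.sub_mem _
    (Submodule.sum_mem _ fun k _ => Submodule.smul_mem _ _ (W k x).2)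
    (Submodule.sum_mem _ fun k _ => Submodule.smul_mem _ _ (W' k x).2)

/-- Taking the bracket of `X` with the transition rule for `h` and comparing vertical parts
suffices: the derivatives of the transition coefficients multiply horizontal fields only. -/
lemma curvature_change (hF : IsAdaptedFrame X 𝒱 W H₀ H₁ N)
    (hF' : IsAdaptedFrame X 𝒱 W' H₀' H₁' N') (hx : x ∈ N) (hx' : x ∈ N') {f : Fin m → ℝ}
    {j : Fin m} (h : W' j x = ∑ i, f i • W i x) :
    ∑ k, curvatureMatrix X H₀' H₁' x k j • (W' k x : TangentSpace 𝓘(ℝ, E) x) =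
      ∑ i, f i • ∑ k, curvatureMatrix X H₀ H₁ x k i • (W k x : TangentSpace 𝓘(ℝ, E) x) := by
  have : CompleteSpace E := FiniteDimensional.complete ℝ E
  obtain ⟨a, ha, has⟩ := hF.frame.exists_coeff hF.isOpen (W' j)
  have haf : ∀ i, a i x = f i := by
    have h2 : ∑ i, a i x • W i x = ∑ i, f i • W i x := by rw [← h, ← ha x hx]
    intro i
    have h3 := congrArg (fun v => (hF.frame.basis hx).repr v i) h2
    simpa [← hF.frame.basis_apply hx, Finsupp.single_apply] using h3
  have hev : ∀ᶠ y in 𝓝 x, hor X W' H₁' j y = ∑ i, a i y • hor X W H₁ i y := by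
    filter_upwards [hF.isOpen.mem_nhds hx, hF'.isOpen.mem_nhds hx'] with y hy hy'
    exact hF.hor_eq_sum hF' hy hy' (ha y hy)
  have h1 := (mlieBracket_congr_right (X := X) hev).trans
    (mlieBracket_sum_smul (has x hx (hF'.smoothAt_frame hx' j)) (hF.smoothAt_hor hx))
  have h2 : ∀ i, mlieBracket 𝓘(ℝ, E) X (fun y => hor X W H₁ i y) x = _ :=
    fun i => hF.mlieBracket_hor hx i
  have h3 : mlieBracket 𝓘(ℝ, E) X (fun y => hor X W' H₁' j y) x = _ := hF'.mlieBracket_hor hx' j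
  rw [h3] at h1
  simp only [h2, haf, smul_add, Finset.sum_add_distrib, Matrix.neg_apply, neg_smul,
    Finset.sum_neg_distrib, smul_neg] at h1
  set K' := ∑ k, curvatureMatrix X H₀' H₁' x k j • (W' k x : TangentSpace 𝓘(ℝ, E) x)
  set K := ∑ i, f i • ∑ k, curvatureMatrix X H₀ H₁ x k i • (W k x : TangentSpace 𝓘(ℝ, E) x)
  set A := ∑ k, ((1 / 2 : ℝ) • H₁' x) k j • hor X W' H₁' k x
  set B := ∑ i, dirDeriv X (a i) x • hor X W H₁ i x
  set C := ∑ i, f i • ∑ k, ((1 / 2 : ℝ) • H₁ x) k i • hor X W H₁ k x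
  have h4 : K' - K = A - B - C := by
    have : A - B - C - (K' - K) = (-K' + A) - (B + (-K + C)) := by abel
    rw [h1, sub_self] at this
    exact (sub_eq_zero.1 this).symm
  refine sub_eq_zero.1 (hF.eq_zero_of_mem_horizontal hx (v := K' - K) ?_ ?_)
  · exact Submodule.sub_mem _
      (Submodule.sum_mem _ fun k _ => Submodule.smul_mem _ _ (W' k x).2)
      (Submodule.sum_mem _ fun i _ => Submodule.smul_mem _ _
        (Submodule.sum_mem _ fun k _ => Submodule.smul_mem _ _ (W k x).2))
  · rw [h4]
    exact Submodule.sub_mem _ (Submodule.sub_mem _ (hF'.sum_hor_mem_horizontal hx' _)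
      (hF.sum_hor_mem_horizontal hx _))
      (Submodule.sum_mem _ fun i _ => Submodule.smul_mem _ _ (hF.sum_hor_mem_horizontal hx _))

end IsAdaptedFrame

/-- The curvature operator is given, in every frame, by the curvature matrix of the frame. -/
theorem IsRegularOn.isCurvatureAt_curvature {U : Set M} (h : IsRegularOn X 𝒱 m U) (hU : IsOpen U)
    (hx : x ∈ U) : IsCurvatureAt X 𝒱 m x (curvature X 𝒱 m x) := by
  refine Classical.epsilon_spec (p := IsCurvatureAt X 𝒱 m x) ?_
  obtain ⟨N, W, H₀, H₁, hxN, hF⟩ := h.exists_isAdaptedFrame hU hx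
  -- The endomorphism is defined by one adapted frame; `curvature_change` gives the required formula
  -- in every other frame.
  refine ⟨(hF.frame.basis hxN).constr ℝ fun j => ∑ i, curvatureMatrix X H₀ H₁ x i j • W i x, ?_⟩
  intro N' W' H₀' H₁' hN' hxN' hW' hs j
  have hF' : IsAdaptedFrame X 𝒱 W' H₀' H₁' (N' ∩ U) :=
    h.isAdaptedFrame hU (hN'.inter hU) inter_subset_right (hW'.mono inter_subset_left)
      fun y hy => hs y hy.1
  have hf : W' j x = ∑ i, (hF.frame.basis hxN).repr (W' j x) i • W i x := by
    conv_lhs => rw [← (hF.frame.basis hxN).sum_repr (W' j x)]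
    simp [hF.frame.basis_apply]
  have h1 := hF.curvature_change hF' hxN ⟨hxN', hx⟩ hf
  refine Subtype.ext ?_
  rw [Module.Basis.constr_apply_fintype]
  simp only [Module.Basis.equivFun_apply]
  refine Eq.trans ?_ (h1.symm.trans ?_)
  · simp [AddSubmonoidClass.coe_finsetSum]
  · simp [AddSubmonoidClass.coe_finsetSum]

end HorizontalSpace

/-! ### The matrix Riccati equation and its trace -/

section Riccati

attribute [local instance] Matrix.linftyOpNormedRing Matrix.linftyOpNormedAlgebra

variable {m : ℕ}

lemma hasDerivWithinAt_transpose {f : ℝ → Matrix (Fin m) (Fin m) ℝ}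
    {a : Matrix (Fin m) (Fin m) ℝ} {s : Set ℝ} {t : ℝ} (hf : HasDerivWithinAt f a s t) :
    HasDerivWithinAt (fun t => (f t).transpose) a.transpose s t :=
  (LinearMap.toContinuousLinearMap
    (Matrix.transposeLinearEquiv (Fin m) (Fin m) ℝ ℝ).toLinearMap).hasFDerivAt.comp_hasDerivWithinAt
      t hf

lemma hasDerivWithinAt_trace {f : ℝ → Matrix (Fin m) (Fin m) ℝ}
    {a : Matrix (Fin m) (Fin m) ℝ} {s : Set ℝ} {t : ℝ} (hf : HasDerivWithinAt f a s t) :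
    HasDerivWithinAt (fun t => (f t).trace) a.trace s t :=
  (LinearMap.toContinuousLinearMap
    (Matrix.traceLinearMap (Fin m) ℝ ℝ)).hasFDerivAt.comp_hasDerivWithinAt t hf

lemma hasDerivWithinAt_matrix {f : ℝ → Matrix (Fin m) (Fin m) ℝ}
    {a : Matrix (Fin m) (Fin m) ℝ} {s : Set ℝ} {t : ℝ} :
    HasDerivWithinAt f a s t ↔ ∀ i j, HasDerivWithinAt (fun t => f t i j) (a i j) s t :=
  Iff.trans (hasDerivWithinAt_pi (φ := f) (φ' := a)) (forall_congr' fun _ => hasDerivWithinAt_pi)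

lemma hasDerivWithinAt_ringInverse {f : ℝ → Matrix (Fin m) (Fin m) ℝ}
    {a : Matrix (Fin m) (Fin m) ℝ} {s : Set ℝ} {t : ℝ} (hf : HasDerivWithinAt f a s t)
    (hu : IsUnit (f t)) : HasDerivWithinAt (fun t => Ring.inverse (f t))
      (-(Ring.inverse (f t) * a * Ring.inverse (f t))) s t := by
  obtain ⟨u, hu⟩ := hu
  have h := hasFDerivAt_ringInverse (𝕜 := ℝ) u
  have e : Ring.inverse (f t) = ↑u⁻¹ := by rw [← hu, Ring.inverse_unit]
  rw [hu] at h
  rw [e]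
  exact h.comp_hasDerivWithinAt t hf

/-- Cauchy-Schwarz for an endomorphism that is symmetric with respect to a scalar product. -/
lemma trace_sq_le_card_mul_trace {S P : Matrix (Fin m) (Fin m) ℝ} (hP : P.PosDef)
    (h : S * P = P * S.transpose) : S.trace ^ 2 ≤ m * (S * S).trace := by
  obtain ⟨R, hR⟩ : ∃ R, P = R.conjTranspose * R := by
    open scoped MatrixOrder in
    exact CStarAlgebra.nonneg_iff_eq_star_mul_self.1 (Matrix.nonneg_iff_posSemidef.2 hP.posSemidef)
  rw [Matrix.conjTranspose_eq_transpose_of_trivial] at hR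
  have hu : IsUnit R := by
    have := hP.isUnit
    rw [Matrix.isUnit_iff_isUnit_det, hR, Matrix.det_mul] at this
    rw [Matrix.isUnit_iff_isUnit_det]
    exact isUnit_of_mul_isUnit_right this
  have h1 : R * Ring.inverse R = 1 := Ring.mul_inverse_cancel _ hu
  have h2 : Ring.inverse R * R = 1 := Ring.inverse_mul_cancel _ hu
  set R' := Ring.inverse R
  have h1' : R'.transpose * R.transpose = 1 := by rw [← Matrix.transpose_mul, h1]; simp
  have h2' : R.transpose * R'.transpose = 1 := by rw [← Matrix.transpose_mul, h2]; simp
  -- With `P = Rᵀ R`, the hypothesis says that the conjugate `Z` of `S` is symmetric. Trace and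
  -- trace of the square are unchanged, so the diagonal Cauchy-Schwarz inequality applies to `Z`.
  set Z := R'.transpose * S * R.transpose with hZ
  have hsym : Z.transpose = Z := by
    have : Z = R * S.transpose * R' := by
      calc Z = R'.transpose * (S * (R.transpose * R)) * R' := by
            rw [hZ]; simp only [Matrix.mul_assoc, h1, Matrix.mul_one]
        _ = (R'.transpose * R.transpose) * R * S.transpose * R' := by
            rw [← hR, h, hR]; simp only [Matrix.mul_assoc]
        _ = _ := by rw [h1', Matrix.one_mul]
    rw [this]
    simp only [Matrix.transpose_mul, Matrix.transpose_transpose]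
    rw [← this, hZ, Matrix.mul_assoc]
  have t1 : Z.trace = S.trace := by
    rw [hZ, Matrix.trace_mul_comm, ← Matrix.mul_assoc, h2', Matrix.one_mul]
  have t2 : (Z * Z).trace = (S * S).trace := by
    have : Z * Z = R'.transpose * (S * S) * R.transpose := by
      calc Z * Z = R'.transpose * S * (R.transpose * R'.transpose) * S * R.transpose := by
            rw [hZ]; simp only [Matrix.mul_assoc]
        _ = _ := by rw [h2']; simp only [Matrix.mul_assoc, Matrix.mul_one]
    rw [this, Matrix.trace_mul_comm, ← Matrix.mul_assoc, h2', Matrix.one_mul]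
  rw [← t1, ← t2]
  calc Z.trace ^ 2 ≤ m * ∑ i, Z i i ^ 2 := by
        simpa [Matrix.trace] using sq_sum_le_card_mul_sum_sq (s := Finset.univ) (f := fun i => Z i i)
    _ ≤ m * (Z * Z).trace := by
        gcongr
        rw [Matrix.trace]
        refine Finset.sum_le_sum fun i _ => ?_
        rw [Matrix.diag_apply, Matrix.mul_apply]
        have : ∀ j, Z i j * Z j i = Z i j ^ 2 := fun j => by
          have : Z j i = Z i j := congrFun (congrFun hsym i) j
          rw [this, sq]
        simp only [this]
        exact Finset.single_le_sum (f := fun j => Z i j ^ 2) (fun j _ => sq_nonneg _)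
          (Finset.mem_univ i)

/-- The Jacobi equation along `J` at time `t`, read in a frame: `Q` and `N` are the matrices of the
vertical and of the horizontal frame in a fixed quotient, `G` is the inverse of the Gram matrix,
`H` the connection matrix and `K` the curvature matrix. The endomorphisms `B = N G Qᵀ` and
`S = N Q⁻¹` do not depend on the frame. -/
structure JacobiData (J : Set ℝ) (κ : ℝ) (S B Q N G H K : ℝ → Matrix (Fin m) (Fin m) ℝ)
    (t : ℝ) : Prop where
  deriv_Q : HasDerivWithinAt Q (N t + (1 / 2 : ℝ) • (Q t * H t)) J t
  deriv_N : HasDerivWithinAt N (-(Q t * K t) + (1 / 2 : ℝ) • (N t * H t)) J t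
  deriv_G : HasDerivWithinAt G (-(1 / 2 : ℝ) • (H t * G t + G t * (H t).transpose)) J t
  posDef : (G t).PosDef
  symm : K t * G t = G t * (K t).transpose
  trace_le : κ ≤ (K t).trace
  eq_B : B t = N t * G t * (Q t).transpose
  isUnit_Q : 0 < t → IsUnit (Q t)
  eq_S : 0 < t → S t = N t * Ring.inverse (Q t)

variable {J : Set ℝ} {κ : ℝ} {S B Q N G H K : ℝ → Matrix (Fin m) (Fin m) ℝ}

/-- This is conservation of the Wronskian. The equation for `G` cancels all connection terms,
leaving `B' = N G Nᵀ - Q K G Qᵀ`, which is symmetric because `K G` is. -/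
lemma JacobiData.hasDerivWithinAt_B_sub_transpose {t : ℝ} (ht : t ∈ J)
    (h : ∀ᶠ τ in 𝓝[J] t, JacobiData J κ S B Q N G H K τ) :
    HasDerivWithinAt (fun τ => B τ - (B τ).transpose) 0 J t := by
  have h0 := h.self_of_nhdsWithin ht
  have hG : (G t).transpose = G t := by
    have := h0.posDef.isHermitian.eq
    rwa [Matrix.conjTranspose_eq_transpose_of_trivial] at this
  have hB : HasDerivWithinAt B (N t * G t * (N t).transpose -
      Q t * (G t * (K t).transpose) * (Q t).transpose) J t := by
    have := (h0.deriv_N.mul h0.deriv_G).mul (hasDerivWithinAt_transpose h0.deriv_Q)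
    refine (this.congr_of_eventuallyEq (h.mono fun τ hτ => hτ.eq_B) h0.eq_B).congr_deriv ?_
    rw [← h0.symm]
    simp only [Matrix.transpose_add, Matrix.transpose_smul, Matrix.transpose_mul, add_mul, mul_add,
      smul_mul_assoc, mul_smul_comm, neg_mul, smul_add, mul_assoc,
      Pi.mul_apply]
    module
  refine (hB.sub (hasDerivWithinAt_transpose hB)).congr_deriv ?_
  have e : ((K t) * (G t)).transpose = K t * G t := by
    rw [h0.symm, Matrix.transpose_mul, Matrix.transpose_transpose, hG, h0.symm]
  rw [← h0.symm]
  simp only [Matrix.transpose_sub]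
  rw [Matrix.transpose_mul, Matrix.transpose_mul, Matrix.transpose_mul, Matrix.transpose_mul,
    Matrix.transpose_transpose, Matrix.transpose_transpose, hG, e]
  simp only [mul_assoc]
  abel

/-- In the derivative of `N Q⁻¹` the two connection terms cancel. -/
lemma JacobiData.hasDerivWithinAt_S {t : ℝ} (ht : t ∈ J) (ht0 : 0 < t)
    (h : ∀ᶠ τ in 𝓝[J] t, JacobiData J κ S B Q N G H K τ) :
    HasDerivWithinAt S (-(Q t * K t * Ring.inverse (Q t)) - S t * S t) J t := by
  have h0 := h.self_of_nhdsWithin ht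
  have hS := h0.deriv_N.mul (hasDerivWithinAt_ringInverse h0.deriv_Q (h0.isUnit_Q ht0))
  have hev : S =ᶠ[𝓝[J] t] fun τ => N τ * Ring.inverse (Q τ) := by
    filter_upwards [h, nhdsWithin_le_nhds (Ioi_mem_nhds ht0)] with τ hτ hτ0
    exact hτ.eq_S hτ0
  refine (hS.congr_of_eventuallyEq hev (h0.eq_S ht0)).congr_deriv ?_
  rw [h0.eq_S ht0]
  have hc : Ring.inverse (Q t) * Q t = 1 := Ring.inverse_mul_cancel _ (h0.isUnit_Q ht0)
  have hc' : ∀ Z, Ring.inverse (Q t) * (Q t * Z) = Z := fun Z => by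
    rw [← mul_assoc, hc, one_mul]
  simp only [add_mul, mul_add, smul_mul_assoc, mul_smul_comm, neg_mul, mul_neg, mul_assoc, hc',
    neg_add]
  module

/-- Near the initial time, `S` has a pole of order one. -/
lemma JacobiData.continuousWithinAt_sin_sq_mul_trace {b k : ℝ} (hb : 0 < b) (hQ : Q 0 = 0)
    (hN : IsUnit (N 0)) (h : ∀ᶠ τ in 𝓝[Icc 0 b] 0, JacobiData (Icc 0 b) κ S B Q N G H K τ) :
    ContinuousWithinAt (fun t => Real.sin (k * t) ^ 2 * (S t).trace) (Icc 0 b) 0 := by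
  have h0 := h.self_of_nhdsWithin (left_mem_Icc.2 hb.le)
  have hQ' := h0.deriv_Q
  rw [hQ, zero_mul, smul_zero, add_zero] at hQ'
  replace hQ' := hasDerivWithinAt_iff_tendsto_slope.1 hQ'
  obtain ⟨u, hu⟩ := hN
  -- Since `Q 0 = 0`, the quotient `Q t / t` tends to the invertible matrix `N 0`, so `t tr S` has a
  -- finite limit. The product in question is `sin (k t)` times `sin (k t) / t` times `t tr S`, and
  -- it tends to `0`. The value `S 0` is irrelevant, being multiplied by `sin² 0`.
  have hinv : Filter.Tendsto (fun t => Ring.inverse (slope Q 0 t)) (𝓝[Icc 0 b \ {0}] 0)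
      (𝓝 (Ring.inverse (N 0))) := by
    have := NormedRing.inverse_continuousAt u
    rw [hu] at this
    exact this.tendsto.comp hQ'
  have hNt : Filter.Tendsto N (𝓝[Icc 0 b \ {0}] 0) (𝓝 (N 0)) :=
    h0.deriv_N.continuousWithinAt.mono sdiff_subset
  have htr : Filter.Tendsto (fun t => (N t * Ring.inverse (slope Q 0 t)).trace)
      (𝓝[Icc 0 b \ {0}] 0) (𝓝 (N 0 * Ring.inverse (N 0)).trace) :=
    ((LinearMap.toContinuousLinearMap
      (Matrix.traceLinearMap (Fin m) ℝ ℝ)).continuous.tendsto _).comp (hNt.mul hinv)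
  have hsin : HasDerivAt (fun t => Real.sin (k * t)) k 0 := by
    have := ((hasDerivAt_id (0 : ℝ)).const_mul k).sin
    simpa using this
  have hsl : Filter.Tendsto (slope (fun t => Real.sin (k * t)) 0) (𝓝[Icc 0 b \ {0}] 0) (𝓝 k) :=
    hasDerivWithinAt_iff_tendsto_slope.1 hsin.hasDerivWithinAt
  have hs0 : Filter.Tendsto (fun t => Real.sin (k * t)) (𝓝[Icc 0 b \ {0}] 0) (𝓝 0) := by
    have := hsin.continuousAt.tendsto
    rw [mul_zero, Real.sin_zero] at this
    exact this.mono_left nhdsWithin_le_nhds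
  have hlim := (hs0.mul hsl).mul htr
  rw [← continuousWithinAt_sdiff_self]
  have e : Real.sin (k * 0) ^ 2 * (S 0).trace = 0 * k * (N 0 * Ring.inverse (N 0)).trace := by simp
  rw [ContinuousWithinAt, e]
  refine hlim.congr' ?_
  filter_upwards [nhdsWithin_mono _ sdiff_subset h, self_mem_nhdsWithin] with t ht htm
  have ht0 : t ≠ 0 := htm.2
  have htpos : 0 < t := lt_of_le_of_ne htm.1.1 (Ne.symm ht0)
  have hsmul : Ring.inverse (slope Q 0 t) = t • Ring.inverse (Q t) := by
    have hc : Q t * Ring.inverse (Q t) = 1 := Ring.mul_inverse_cancel _ (ht.isUnit_Q htpos)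
    have hc' : Ring.inverse (Q t) * Q t = 1 := Ring.inverse_mul_cancel _ (ht.isUnit_Q htpos)
    have e1 : slope Q 0 t = t⁻¹ • Q t := by simp [slope, hQ]
    rw [e1]
    refine Ring.inverse_unit ⟨t⁻¹ • Q t, t • Ring.inverse (Q t), ?_, ?_⟩
    · rw [smul_mul_smul_comm, hc, inv_mul_cancel₀ ht0, one_smul]
    · rw [smul_mul_smul_comm, hc', mul_inv_cancel₀ ht0, one_smul]
  rw [hsmul, mul_smul_comm, Matrix.trace_smul, ← ht.eq_S htpos]
  simp [slope]
  field_simp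

/-- The trace of the Riccati equation has no solution on an interval of length `π / k` that starts
with a pole. -/
theorem JacobiData.false_of_forall_exists {k b : ℝ} (hm : 0 < m) (hk : 0 < k) (hb : b = Real.pi / k)
    (h : ∀ t ∈ Icc 0 b, ∃ Q N G H K : ℝ → Matrix (Fin m) (Fin m) ℝ,
      (∀ᶠ τ in 𝓝[Icc 0 b] t, JacobiData (Icc 0 b) (m * k ^ 2) S B Q N G H K τ) ∧
      (t = 0 → Q 0 = 0 ∧ IsUnit (N 0))) : False := by
  have hbpos : 0 < b := by rw [hb]; positivity
  have hkb : k * b = Real.pi := by rw [hb]; field_simp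
  have hmR : (0 : ℝ) < m := by exact_mod_cast hm
  have h0I : (0 : ℝ) ∈ Icc 0 b := left_mem_Icc.2 hbpos.le
  have hbI : b ∈ Icc 0 b := right_mem_Icc.2 hbpos.le
  -- `B - Bᵀ` is constant and vanishes at time `0`, where `Q 0 = 0`.
  have hB : ∀ t ∈ Icc 0 b, (B t).transpose = B t := by
    have hd : ∀ t ∈ Icc 0 b, HasDerivWithinAt (fun τ => B τ - (B τ).transpose) 0 (Icc 0 b) t := by
      intro t ht
      obtain ⟨Q, N, G, H, K, hev, -⟩ := h t ht
      exact JacobiData.hasDerivWithinAt_B_sub_transpose ht hev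
    have hB0 : B 0 = 0 := by
      obtain ⟨Q, N, G, H, K, hev, h0⟩ := h 0 h0I
      rw [(hev.self_of_nhdsWithin h0I).eq_B, (h0 rfl).1]
      simp
    intro t ht
    have := Convex.norm_image_sub_le_of_norm_hasDerivWithin_le (C := 0) hd (by simp)
      (convex_Icc 0 b) h0I ht
    rw [hB0, zero_mul, norm_le_zero_iff] at this
    simp only [Matrix.transpose_zero, sub_zero] at this
    exact (sub_eq_zero.1 this).symm
  have hφ : ∀ t ∈ Ioc 0 b, ∃ φ' : ℝ, HasDerivWithinAt (fun t => (S t).trace) φ' (Icc 0 b) t ∧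
      φ' ≤ - (m * k ^ 2) - (S t).trace ^ 2 / m := by
    intro t ht
    have htI : t ∈ Icc 0 b := Ioc_subset_Icc_self ht
    obtain ⟨Q, N, G, H, K, hev, -⟩ := h t htI
    have hJ := hev.self_of_nhdsWithin htI
    refine ⟨_, hasDerivWithinAt_trace (JacobiData.hasDerivWithinAt_S htI ht.1 hev), ?_⟩
    have hu := hJ.isUnit_Q ht.1
    have hc : Ring.inverse (Q t) * Q t = 1 := Ring.inverse_mul_cancel _ hu
    have e1 : (Q t * K t * Ring.inverse (Q t)).trace = (K t).trace := by
      rw [Matrix.trace_mul_comm, ← mul_assoc, hc, one_mul]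
    have hP : (Q t * G t * (Q t).transpose).PosDef := by
      have := hJ.posDef.mul_mul_conjTranspose_same (B := Q t)
        (Matrix.vecMul_injective_iff_isUnit.2 hu)
      rwa [Matrix.conjTranspose_eq_transpose_of_trivial] at this
    -- Symmetry of `B = S P`, with `P = Q G Qᵀ` positive definite, says that `S` is symmetric for
    -- the scalar product defined by `P`.
    have e2 : S t * (Q t * G t * (Q t).transpose) = B t := by
      rw [hJ.eq_S ht.1, hJ.eq_B]
      simp only [mul_assoc]
      rw [← mul_assoc _ (Q t), hc, one_mul]
    have hPs : (Q t * G t * (Q t).transpose).transpose = Q t * G t * (Q t).transpose := by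
      have := hP.isHermitian.eq
      rwa [Matrix.conjTranspose_eq_transpose_of_trivial] at this
    have hle := trace_sq_le_card_mul_trace (S := S t) hP (by
      rw [e2, ← hB t htI, ← e2, Matrix.transpose_mul, hPs])
    rw [Matrix.trace_sub, Matrix.trace_neg, e1]
    have hdiv : (S t).trace ^ 2 / m ≤ (S t * S t).trace := by
      rw [div_le_iff₀ hmR]; linarith
    linarith [hJ.trace_le]
  -- This is `sin² (k t)` times the difference of `tr S` and the comparison function `m k cot (k
  -- t)`; the square of the sine removes the pole at `0` and makes `F` vanish at `b`.
  set F : ℝ → ℝ := fun t => Real.sin (k * t) ^ 2 * (S t).trace -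
    m * k * (Real.sin (k * t) * Real.cos (k * t)) with hF
  have hsin : ∀ t, HasDerivAt (fun t => Real.sin (k * t)) (k * Real.cos (k * t)) t := fun t => by
    have := ((hasDerivAt_id t).const_mul k).sin
    simpa [mul_comm] using this
  have hcos : ∀ t, HasDerivAt (fun t => Real.cos (k * t)) (-(k * Real.sin (k * t))) t := fun t => by
    have := ((hasDerivAt_id t).const_mul k).cos
    simpa [mul_comm] using this
  have hF' : ∀ t ∈ Ioc 0 b, ∃ d ≤ 0, HasDerivWithinAt F d (Icc 0 b) t := by
    intro t ht
    obtain ⟨φ', h1, h2⟩ := hφ t ht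
    have hd := (((hsin t).hasDerivWithinAt (s := Icc 0 b)).pow 2).mul h1 |>.sub
      ((((hsin t).mul (hcos t)).const_mul (m * k)).hasDerivWithinAt (s := Icc 0 b))
    refine ⟨_, ?_, hd⟩
    set s := Real.sin (k * t)
    set c := Real.cos (k * t)
    set φ := (S t).trace
    have h3 : s ^ 2 * φ' ≤ s ^ 2 * (- (m * k ^ 2) - φ ^ 2 / m) := by gcongr
    -- Completing the square shows that the upper bound for `F'` is nonpositive.
    have h4 : s ^ 2 * (- (m * k ^ 2) - φ ^ 2 / m) + 2 * s * (k * c) * φ -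
        m * k * (k * c * c + s * (-(k * s))) = -((s * φ - m * k * c) ^ 2 / m) := by
      field_simp
      ring
    have h5 : 0 ≤ (s * φ - m * k * c) ^ 2 / m := by positivity
    simp only [Pi.pow_apply]
    push_cast
    norm_num
    linarith
  have hcont : ContinuousOn F (Icc 0 b) := by
    intro t ht
    rcases ht.1.eq_or_lt with h0 | h0
    · subst h0
      obtain ⟨Q, N, G, H, K, hev, h0⟩ := h 0 h0I
      obtain ⟨hQ, hN⟩ := h0 rfl
      exact (JacobiData.continuousWithinAt_sin_sq_mul_trace hbpos hQ hN hev).sub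
        (by fun_prop)
    · obtain ⟨d, -, hd⟩ := hF' t ⟨h0, ht.2⟩
      exact hd.continuousWithinAt
  have hanti : AntitoneOn F (Icc 0 b) := by
    refine antitoneOn_of_deriv_nonpos (convex_Icc 0 b) hcont ?_ ?_
    all_goals
      intro t ht
      rw [interior_Icc] at ht
      obtain ⟨d, hd, hd'⟩ := hF' t (Ioo_subset_Ioc_self ht)
      have hd'' := hd'.hasDerivAt (Icc_mem_nhds ht.1 ht.2)
    · exact hd''.differentiableAt.differentiableWithinAt
    · rw [hd''.deriv]; exact hd
  have hF0 : F 0 = 0 := by simp [hF]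
  have hFb : F b = 0 := by simp [hF, hkb]
  -- `F` is nonincreasing and vanishes at both ends, hence everywhere; a factor `sin (k t) > 0` can
  -- be cancelled inside.
  have hzero : ∀ t ∈ Ioo 0 b, Real.sin (k * t) * (S t).trace - m * k * Real.cos (k * t) = 0 := by
    intro t ht
    have htI := Ioo_subset_Icc_self ht
    have h1 := hanti h0I htI ht.1.le
    have h2 := hanti htI hbI ht.2.le
    have h3 : F t = 0 := le_antisymm (hF0 ▸ h1) (hFb ▸ h2)
    have hs : 0 < Real.sin (k * t) := by
      refine Real.sin_pos_of_pos_of_lt_pi (mul_pos hk ht.1) ?_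
      rw [← hkb]
      exact mul_lt_mul_of_pos_left ht.2 hk
    have h4 : Real.sin (k * t) * (Real.sin (k * t) * (S t).trace - m * k * Real.cos (k * t)) = 0 := by
      rw [← h3, hF]; ring
    exact (mul_eq_zero.1 h4).resolve_left hs.ne'
  -- At `b` the trace is still finite because `Q b` is invertible. In the limit the identity reads
  -- `0 + m k = 0`.
  obtain ⟨φ', hφ', -⟩ := hφ b ⟨hbpos, le_rfl⟩
  have hcb : ContinuousWithinAt (fun t => Real.sin (k * t) * (S t).trace -
      m * k * Real.cos (k * t)) (Ioo 0 b) b := by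
    refine ContinuousWithinAt.sub (ContinuousWithinAt.mul (by fun_prop) ?_) (by fun_prop)
    exact hφ'.continuousWithinAt.mono Ioo_subset_Icc_self
  have hne : (𝓝[Ioo 0 b] b).NeBot := by
    rw [← mem_closure_iff_nhdsWithin_neBot, closure_Ioo hbpos.ne]
    exact hbI
  have hlim := tendsto_nhds_unique (hcb.tendsto) (tendsto_const_nhds.congr' (by
    filter_upwards [self_mem_nhdsWithin] with t ht
    exact (hzero t ht).symm) : Filter.Tendsto _ (𝓝[Ioo 0 b] b) (𝓝 (0 : ℝ)))
  rw [hkb, Real.sin_pi, Real.cos_pi] at hlim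
  have : (m : ℝ) * k = 0 := by linarith
  exact (mul_pos hmR hk).ne' this

end Riccati

/-! ### Invariance of `𝒱 ⊕ ℋ` under the flow -/

section Propagation

/-- A function whose derivative is bounded by a multiple of its norm vanishes as soon as it vanishes
at one point. -/
lemma eq_zero_of_norm_deriv_le {F : Type*} [NormedAddCommGroup F] [NormedSpace ℝ F]
    {y y' : ℝ → F} {a b C r : ℝ}
    (hd : ∀ τ ∈ Icc a b, HasDerivWithinAt y (y' τ) (Icc a b) τ)
    (hC : ∀ τ ∈ Icc a b, ‖y' τ‖ ≤ C * ‖y τ‖) (hr : r ∈ Icc a b) (h0 : y r = 0) :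
    ∀ τ ∈ Icc a b, y τ = 0 := by
  have hcont : ContinuousOn y (Icc a b) := fun τ hτ => (hd τ hτ).continuousWithinAt
  intro τ hτ
  rcases le_total r τ with h | h
  · refine eq_zero_of_abs_deriv_le_mul_abs_self_of_eq_zero_right (f' := y') (K := C)
      (hcont.mono (Icc_subset_Icc_left hr.1)) (fun x hx => ?_) h0
      (fun x hx => hC x ⟨hr.1.trans hx.1, hx.2.le⟩) τ ⟨h, hτ.2⟩
    exact (hd x ⟨hr.1.trans hx.1, hx.2.le⟩).mono_of_mem_nhdsWithin
      (Icc_mem_nhdsGE_of_mem ⟨hr.1.trans hx.1, hx.2⟩)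
  -- Times before `r` are treated by reversing time.
  · have hm : MapsTo (fun s : ℝ => -s) (Icc (-r) (-a)) (Icc a b) := fun s hs =>
      ⟨by linarith [hs.2], by linarith [hs.1, hr.2]⟩
    have := eq_zero_of_abs_deriv_le_mul_abs_self_of_eq_zero_right (f := fun s => y (-s))
      (f' := fun s => -y' (-s)) (K := C) (a := -r) (b := -a)
      (hcont.comp continuous_neg.continuousOn hm) (fun x hx => ?_) (by simpa using h0)
      (fun x hx => by simpa using hC (-x) (hm ⟨hx.1, hx.2.le⟩)) (-τ)
      ⟨by linarith, by linarith [hτ.1]⟩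
    · simpa using this
    · have h1 := (hd (-x) (hm ⟨hx.1, hx.2.le⟩)).scomp_of_eq x (h := fun s : ℝ => -s)
        (s := Icc (-r) (-a)) (hasDerivWithinAt_neg x _) hm rfl
      have h2 : HasDerivWithinAt (fun s => y (-s)) (-y' (-x)) (Icc (-r) (-a)) x := by
        simpa [Function.comp_def] using h1
      exact h2.mono_of_mem_nhdsWithin (Icc_mem_nhdsGE_of_mem hx)

/-- Both implications are needed: they make vanishing a locally constant property of time, which a
connectedness argument can propagate across changes of frame. -/
lemma eventually_eq_zero_iff {F : Type*} [NormedAddCommGroup F] [NormedSpace ℝ F]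
    {y y' : ℝ → F} {a b C t : ℝ} (ht : t ∈ Icc a b)
    (h : ∀ᶠ τ in 𝓝[Icc a b] t, HasDerivWithinAt y (y' τ) (Icc a b) τ ∧ ‖y' τ‖ ≤ C * ‖y τ‖) :
    ∀ᶠ τ in 𝓝[Icc a b] t, (y t = 0 ↔ y τ = 0) := by
  rw [eventually_nhdsWithin_iff, Metric.eventually_nhds_iff_ball] at h
  obtain ⟨ε, hε, h⟩ := h
  filter_upwards [self_mem_nhdsWithin, nhdsWithin_le_nhds (ball_mem_nhds t hε)] with τ hτ hτε
  have hsub : uIcc t τ ⊆ ball t ε ∩ Icc a b := fun s hs =>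
    ⟨(Real.ball_eq_Ioo t ε ▸ ordConnected_Ioo : (ball t ε).OrdConnected).uIcc_subset
      (mem_ball_self hε) hτε hs, ordConnected_Icc.uIcc_subset ht hτ hs⟩
  have key := fun r hr h0 => eq_zero_of_norm_deriv_le (y := y) (y' := y') (C := C)
    (a := min t τ) (b := max t τ) (r := r)
    (fun s hs => (h s (hsub hs).1 (hsub hs).2).1.mono (fun z hz => (hsub hz).2))
    (fun s hs => (h s (hsub hs).1 (hsub hs).2).2) hr h0
  exact ⟨fun h0 => key t left_mem_uIcc h0 τ right_mem_uIcc,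
    fun h0 => key τ right_mem_uIcc h0 t left_mem_uIcc⟩

lemma norm_sum_smul_le {F : Type*} [NormedAddCommGroup F] [NormedSpace ℝ F] {m : ℕ} {a : Fin m → ℝ}
    {q : Fin m → F} {C R : ℝ} (hC : 0 ≤ C) (ha : ∀ i, |a i| ≤ C) (hq : ∀ i, ‖q i‖ ≤ R) :
    ‖∑ i, a i • q i‖ ≤ m * C * R := by
  refine (norm_sum_le_of_le (f := fun i => a i • q i) (n := fun _ => C * R) Finset.univ
    fun i _ => ?_).trans ?_
  · rw [norm_smul]
    exact mul_le_mul (ha i) (hq i) (norm_nonneg _) hC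
  · simp [mul_assoc]

variable {E : Type*} [NormedAddCommGroup E] [NormedSpace ℝ E]
  {M : Type*} [TopologicalSpace M] [ChartedSpace E M] [IsManifold 𝓘(ℝ, E) ∞ M]

/-- The maps `B t` pull tangent vectors back along the curve `c`, so that they turn the Lie bracket
with `X` into the derivative in time. -/
def IsPullback (X : ∀ x : M, TangentSpace 𝓘(ℝ, E) x) (c : ℝ → M) (J : Set ℝ)
    (B : ∀ t, TangentSpace 𝓘(ℝ, E) (c t) →ₗ[ℝ] E) : Prop :=
  ∀ t ∈ J, ∀ Y : ∀ x : M, TangentSpace 𝓘(ℝ, E) x, SmoothAt Y (c t) →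
    HasDerivWithinAt (fun τ => B τ (Y (c τ))) (B t (mlieBracket 𝓘(ℝ, E) X Y (c t))) J t

variable {X : ∀ x : M, TangentSpace 𝓘(ℝ, E) x} {𝒱 : ∀ x : M, Submodule ℝ (TangentSpace 𝓘(ℝ, E) x)}
  {m : ℕ} {W : Fin m → ∀ x, 𝒱 x} {H₀ H₁ : M → Matrix (Fin m) (Fin m) ℝ} {U N : Set M} {c : ℝ → M}
  {J : Set ℝ} {B : ∀ t, TangentSpace 𝓘(ℝ, E) (c t) →ₗ[ℝ] E} {t : ℝ}
  {F : Type*} [NormedAddCommGroup F] [NormedSpace ℝ F]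

lemma IsPullback.hasDerivWithinAt_frame (hB : IsPullback X c J B)
    (hF : IsAdaptedFrame X 𝒱 W H₀ H₁ N) (ht : t ∈ J) (hct : c t ∈ N) (L : E →L[ℝ] F) (j : Fin m) :
    HasDerivWithinAt (fun τ => L (B τ (W j (c τ)))) (L (B t (hor X W H₁ j (c t))) +
      ∑ k, ((1 / 2 : ℝ) • H₁ (c t)) k j • L (B t (W k (c t)))) J t := by
  have h := hB t ht (fun y => (W j y : TangentSpace 𝓘(ℝ, E) y)) (hF.smoothAt_frame hct j)
  refine (L.hasFDerivAt.comp_hasDerivWithinAt t h).congr_deriv ?_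
  have h2 : mlieBracket 𝓘(ℝ, E) X (fun y => (W j y : TangentSpace 𝓘(ℝ, E) y)) (c t) = _ :=
    adX_eq_sum_add_hor X W H₁ j (c t)
  rw [h2]
  simp only [map_add, map_sum, map_smul]
  rw [add_comm]

variable [FiniteDimensional ℝ E]

lemma IsPullback.hasDerivWithinAt_hor (hB : IsPullback X c J B)
    (hF : IsAdaptedFrame X 𝒱 W H₀ H₁ N) (ht : t ∈ J) (hct : c t ∈ N) (L : E →L[ℝ] F) (j : Fin m) :
    HasDerivWithinAt (fun τ => L (B τ (hor X W H₁ j (c τ))))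
      (∑ k, (-curvatureMatrix X H₀ H₁ (c t)) k j • L (B t (W k (c t))) +
      ∑ k, ((1 / 2 : ℝ) • H₁ (c t)) k j • L (B t (hor X W H₁ k (c t)))) J t := by
  have h := hB t ht (hor X W H₁ j) (hF.smoothAt_hor hct j)
  refine (L.hasFDerivAt.comp_hasDerivWithinAt t h).congr_deriv ?_
  rw [hF.mlieBracket_hor hct]
  simp only [map_add, map_sum, map_smul]

lemma IsAdaptedFrame.forall_mem_iff (hF : IsAdaptedFrame X 𝒱 W H₀ H₁ N) {x : M} (hx : x ∈ N)
    (L : TangentSpace 𝓘(ℝ, E) x →ₗ[ℝ] F) :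
    ((∀ v ∈ 𝒱 x, L v = 0) ∧ ∀ v ∈ horizontal X 𝒱 x, L v = 0) ↔
      ((fun j => L (W j x)), (fun j => L (hor X W H₁ j x))) = (0 : (Fin m → F) × (Fin m → F)) := by
  rw [Prod.ext_iff, funext_iff, funext_iff]
  refine and_congr ⟨fun h j => h _ (W j x).2, fun h v hv => ?_⟩
    ⟨fun h j => h _ (hF.hor_mem_horizontal hx j), fun h v hv => ?_⟩
  · have := congrArg (L ∘ₗ (𝒱 x).subtype) ((hF.frame.basis hx).sum_repr ⟨v, hv⟩)
    simp only [map_sum, map_smul, hF.frame.basis_apply] at this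
    refine Eq.trans this.symm (Finset.sum_eq_zero fun i _ => ?_)
    have hi : L (W i x) = 0 := h i
    simp [hi]
  · rw [hF.horizontal_eq hx] at hv
    obtain ⟨b, rfl⟩ := (Submodule.mem_span_range_iff_exists_fun ℝ).1 hv
    rw [map_sum]
    refine Finset.sum_eq_zero fun i _ => ?_
    have hi : L (hor X W H₁ i x) = 0 := h i
    rw [map_smul, hi, smul_zero]

/-- A linear map that vanishes on `𝒱 ⊕ ℋ` at the starting point vanishes on the vectors of `𝒱 ⊕ ℋ`
that are pulled back to it. -/
theorem IsPullback.forall_mem_eq_zero {b : ℝ} (hB : IsPullback X c (Icc 0 b) B)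
    (hreg : IsRegularOn X 𝒱 m U) (hU : IsOpen U) (hc : ContinuousOn c (Icc 0 b))
    (hcU : MapsTo c (Icc 0 b) U) (L : E →L[ℝ] F) (h0 : (∀ v ∈ 𝒱 (c 0), L (B 0 v) = 0) ∧
      ∀ v ∈ horizontal X 𝒱 (c 0), L (B 0 v) = 0) (ht : t ∈ Icc 0 b) :
    (∀ v ∈ 𝒱 (c t), L (B t v) = 0) ∧ ∀ v ∈ horizontal X 𝒱 (c t), L (B t v) = 0 := by
  -- `Z` does not mention a frame. Near each time it says, in a local frame, that the solution `y`
  -- of a linear system vanishes, so its truth is locally constant, hence constant on `[0, b]`.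
  let Z : ℝ → Prop := fun t =>
    (∀ v ∈ 𝒱 (c t), L (B t v) = 0) ∧ ∀ v ∈ horizontal X 𝒱 (c t), L (B t v) = 0
  suffices H : ∀ t ∈ Icc 0 b, ∀ᶠ τ in 𝓝[Icc 0 b] t, (Z t ↔ Z τ) from
    (isPreconnected_Icc.induction₂' (fun s t => Z s ↔ Z t)
      (fun s hs => (H s hs).mono fun τ h => ⟨h, h.symm⟩)
      (fun _ _ _ _ _ _ h1 h2 => h1.trans h2) (left_mem_Icc.2 (ht.1.trans ht.2)) ht).1 h0
  intro t ht
  obtain ⟨N, W, H₀, H₁, hxN, hF⟩ := hreg.exists_isAdaptedFrame hU (hcU ht)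
  let y : ℝ → (Fin m → F) × (Fin m → F) := fun τ =>
    ((fun j => L (B τ (W j (c τ)))), (fun j => L (B τ (hor X W H₁ j (c τ)))))
  let y' : ℝ → (Fin m → F) × (Fin m → F) := fun τ =>
    ((fun j => L (B τ (hor X W H₁ j (c τ))) +
      ∑ k, ((1 / 2 : ℝ) • H₁ (c τ)) k j • L (B τ (W k (c τ)))),
    (fun j => ∑ k, (-curvatureMatrix X H₀ H₁ (c τ)) k j • L (B τ (W k (c τ))) +
      ∑ k, ((1 / 2 : ℝ) • H₁ (c τ)) k j • L (B τ (hor X W H₁ k (c τ)))))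
  have hN : ∀ᶠ τ in 𝓝[Icc 0 b] t, c τ ∈ N := (hc t ht) (hF.isOpen.mem_nhds hxN)
  have hZ : ∀ τ, c τ ∈ N → (Z τ ↔ y τ = 0) := fun τ hτ =>
    hF.forall_mem_iff hτ (L.toLinearMap ∘ₗ B τ)
  have hbd : ∀ f : M → ℝ, SmoothFunAt E f (c t) →
      ∃ C, ∀ᶠ τ in 𝓝[Icc 0 b] t, |f (c τ)| ≤ C := by
    intro f hf
    have h1 : ContinuousWithinAt (fun τ => |f (c τ)|) (Icc 0 b) t :=
      (hf.continuousAt.comp_continuousWithinAt (hc t ht)).abs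
    exact ⟨|f (c t)| + 1, (h1.eventually (Iio_mem_nhds (lt_add_one _))).mono fun τ hτ => hτ.le⟩
  choose C₁ hC₁ using fun k j => hbd _ (hF.smoothFunAt_half hxN (1 / 2) k j)
  choose C₂ hC₂ using fun k j => hbd _ (hF.smoothFunAt_curvatureMatrix hxN k j)
  obtain ⟨C, hC₁', hC₂', hC0⟩ : ∃ C, (∀ k j, C₁ k j ≤ C) ∧ (∀ k j, C₂ k j ≤ C) ∧ 0 ≤ C := by
    have h1 : ∀ k j, |C₁ k j| ≤ ∑ k, ∑ j, |C₁ k j| := fun k j =>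
      (Finset.single_le_sum (f := fun j => |C₁ k j|) (fun _ _ => abs_nonneg _)
        (Finset.mem_univ j)).trans
      (Finset.single_le_sum (f := fun k => ∑ j, |C₁ k j|)
        (fun _ _ => Finset.sum_nonneg fun _ _ => abs_nonneg _) (Finset.mem_univ k))
    have h2 : ∀ k j, |C₂ k j| ≤ ∑ k, ∑ j, |C₂ k j| := fun k j =>
      (Finset.single_le_sum (f := fun j => |C₂ k j|) (fun _ _ => abs_nonneg _)
        (Finset.mem_univ j)).trans
      (Finset.single_le_sum (f := fun k => ∑ j, |C₂ k j|)
        (fun _ _ => Finset.sum_nonneg fun _ _ => abs_nonneg _) (Finset.mem_univ k))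
    have h3 : 0 ≤ ∑ k, ∑ j, |C₁ k j| :=
      Finset.sum_nonneg fun _ _ => Finset.sum_nonneg fun _ _ => abs_nonneg _
    have h4 : 0 ≤ ∑ k, ∑ j, |C₂ k j| :=
      Finset.sum_nonneg fun _ _ => Finset.sum_nonneg fun _ _ => abs_nonneg _
    exact ⟨_ + _, fun k j => (le_abs_self _).trans ((h1 k j).trans (le_add_of_nonneg_right h4)),
      fun k j => (le_abs_self _).trans ((h2 k j).trans (le_add_of_nonneg_left h3)),
      add_nonneg h3 h4⟩
  have hy := eventually_eq_zero_iff (y := y) (y' := y') (C := 1 + 2 * (m * C)) ht (by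
    filter_upwards [hN, self_mem_nhdsWithin,
      Filter.eventually_all.2 fun k => Filter.eventually_all.2 fun j => hC₁ k j,
      Filter.eventually_all.2 fun k => Filter.eventually_all.2 fun j => hC₂ k j]
      with τ hτN hτ h1 h2
    refine ⟨HasDerivWithinAt.prodMk
      (hasDerivWithinAt_pi.2 fun j => hB.hasDerivWithinAt_frame hF hτ hτN L j)
      (hasDerivWithinAt_pi.2 fun j => hB.hasDerivWithinAt_hor hF hτ hτN L j), ?_⟩
    have hq : ∀ j, ‖L (B τ (W j (c τ)))‖ ≤ ‖y τ‖ := fun j =>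
      (norm_le_pi_norm (y τ).1 j).trans (norm_fst_le _)
    have hn : ∀ j, ‖L (B τ (hor X W H₁ j (c τ)))‖ ≤ ‖y τ‖ := fun j =>
      (norm_le_pi_norm (y τ).2 j).trans (norm_snd_le _)
    have hP : ∀ k j, |((1 / 2 : ℝ) • H₁ (c τ)) k j| ≤ C := fun k j => (h1 k j).trans (hC₁' k j)
    have hK : ∀ k j, |(-curvatureMatrix X H₀ H₁ (c τ)) k j| ≤ C := fun k j => by
      rw [Matrix.neg_apply, abs_neg]
      exact (h2 k j).trans (hC₂' k j)
    have hmC : 0 ≤ m * C * ‖y τ‖ := by positivity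
    have hy0 : 0 ≤ ‖y τ‖ := norm_nonneg _
    refine norm_prod_le_iff.2 ⟨(pi_norm_le_iff_of_nonneg (by positivity)).2 fun j => ?_,
      (pi_norm_le_iff_of_nonneg (by positivity)).2 fun j => ?_⟩
    · refine (norm_add_le_of_le (hn j)
        (norm_sum_smul_le hC0 (fun k => hP k j) hq)).trans ?_
      linarith
    · refine (norm_add_le_of_le (norm_sum_smul_le hC0 (fun k => hK k j) hq)
        (norm_sum_smul_le hC0 (fun k => hP k j) hn)).trans ?_
      linarith)
  filter_upwards [hy, hN] with τ h hτ
  rw [hZ t hxN, hZ τ hτ, h]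

end Propagation

/-! ### The Jacobi equation in a local frame -/

section FrameMatrices

attribute [local instance] Matrix.linftyOpNormedRing Matrix.linftyOpNormedAlgebra

variable {E : Type*} [NormedAddCommGroup E] [NormedSpace ℝ E]
  {M : Type*} [TopologicalSpace M] [ChartedSpace E M]
  {X : ∀ x : M, TangentSpace 𝓘(ℝ, E) x} {𝒱 : ∀ x : M, Submodule ℝ (TangentSpace 𝓘(ℝ, E) x)}
  {m : ℕ} {c : ℝ → M}

/-- The components of the vector fields `Y₁, …, Yₘ` along `c`, pulled back by `B` and projected by
`p`. -/
def fieldMatrix (p : E →L[ℝ] (Fin m → ℝ)) (B : ∀ t, TangentSpace 𝓘(ℝ, E) (c t) →ₗ[ℝ] E)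
    (Y : Fin m → ∀ x : M, TangentSpace 𝓘(ℝ, E) x) (t : ℝ) : Matrix (Fin m) (Fin m) ℝ :=
  Matrix.of fun i j => p (B t (Y j (c t))) i

/-- The matrix `fieldMatrix` of the fields of a frame. -/
def frameMatrix (p : E →L[ℝ] (Fin m → ℝ)) (B : ∀ t, TangentSpace 𝓘(ℝ, E) (c t) →ₗ[ℝ] E)
    (W : Fin m → ∀ x, 𝒱 x) : ℝ → Matrix (Fin m) (Fin m) ℝ :=
  fieldMatrix p B fun j y => (W j y : TangentSpace 𝓘(ℝ, E) y)

/-- The Gram matrix of a frame along `c`. -/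
def gramMatrix (g : ∀ t : ℝ, LinearMap.BilinForm ℝ (𝒱 (c t))) (W : Fin m → ∀ x, 𝒱 x) (t : ℝ) :
    Matrix (Fin m) (Fin m) ℝ :=
  Matrix.of fun i j => g t (W i (c t)) (W j (c t))

variable {p : E →L[ℝ] (Fin m → ℝ)} {B : ∀ t, TangentSpace 𝓘(ℝ, E) (c t) →ₗ[ℝ] E}
  {g : ∀ t : ℝ, LinearMap.BilinForm ℝ (𝒱 (c t))} {W W' : Fin m → ∀ x, 𝒱 x} {t : ℝ}

lemma fieldMatrix_mulVec (Y : Fin m → ∀ x : M, TangentSpace 𝓘(ℝ, E) x) (a : Fin m → ℝ) :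
    (fieldMatrix p B Y t).mulVec a = p (B t (∑ j, a j • Y j (c t))) := by
  ext i
  simp [fieldMatrix, Matrix.mulVec, dotProduct, map_sum, mul_comm]

lemma fieldMatrix_eq_mul {Y Y' : Fin m → ∀ x : M, TangentSpace 𝓘(ℝ, E) x}
    {P : Matrix (Fin m) (Fin m) ℝ} (h : ∀ j, Y' j (c t) = ∑ i, P i j • Y i (c t)) :
    fieldMatrix p B Y' t = fieldMatrix p B Y t * P := by
  ext i j
  simp [fieldMatrix, h, Matrix.mul_apply, map_sum, mul_comm]

lemma gramMatrix_eq_mul {P : Matrix (Fin m) (Fin m) ℝ}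
    (h : ∀ j, W' j (c t) = ∑ i, P i j • W i (c t)) :
    gramMatrix g W' t = P.transpose * gramMatrix g W t * P := by
  ext i j
  simp [gramMatrix, h, Matrix.mul_apply, map_sum, LinearMap.sum_apply, mul_comm]

variable [IsManifold 𝓘(ℝ, E) ∞ M] {H₀ H₁ H₀' H₁' : M → Matrix (Fin m) (Fin m) ℝ} {N N' : Set M}

lemma IsFrameOn.exists_isUnit (hW : IsFrameOn 𝒱 W N) (hW' : IsFrameOn 𝒱 W' N') {x : M}
    (hx : x ∈ N) (hx' : x ∈ N') :
    ∃ P : Matrix (Fin m) (Fin m) ℝ, IsUnit P ∧ ∀ j, W' j x = ∑ i, P i j • W i x := by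
  let b := hW.basis hx
  let b' := hW'.basis hx'
  refine ⟨b.toMatrix b', ?_, fun j => ?_⟩
  · exact IsUnit.of_mul_eq_one (b'.toMatrix b) (b.toMatrix_mul_toMatrix_flip b')
  · have := b.sum_toMatrix_smul_self b' j
    simp only [b, b', hW.basis_apply, hW'.basis_apply] at this
    exact this.symm

lemma posDef_gramMatrix {J : Set ℝ} (hg : IsPosDefMetricAlong 𝒱 c J g) (ht : t ∈ J)
    (hW : IsFrameOn 𝒱 W N) (hct : c t ∈ N) : (gramMatrix g W t).PosDef := by
  refine Matrix.PosDef.of_dotProduct_mulVec_pos ?_ fun a ha => ?_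
  · exact Matrix.IsHermitian.ext fun i j => (hg t ht).1 _ _
  · have hv : ∑ i, a i • W i (c t) ≠ 0 := fun h0 => ha (funext fun i =>
      Fintype.linearIndependent_iff.1 (hW.linearIndependent _ hct) a h0 i)
    have e : star a ⬝ᵥ (gramMatrix g W t).mulVec a =
        g t (∑ i, a i • W i (c t)) (∑ i, a i • W i (c t)) := by
      simp [gramMatrix, Matrix.mulVec, dotProduct, map_sum, LinearMap.sum_apply, mul_comm]
      refine Finset.sum_congr rfl fun i _ => congrArg _ (Finset.sum_congr rfl fun j _ => ?_)
      rw [(hg t ht).1]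
    rw [e]
    exact (hg t ht).2 _ hv

lemma IsAdaptedFrame.toMatrix_curvature (hF : IsAdaptedFrame X 𝒱 W H₀ H₁ N) {x : M} (hx : x ∈ N)
    {K : 𝒱 x →ₗ[ℝ] 𝒱 x} (hK : IsCurvatureAt X 𝒱 m x K) :
    LinearMap.toMatrix (hF.frame.basis hx) (hF.frame.basis hx) K = curvatureMatrix X H₀ H₁ x := by
  ext i j
  rw [LinearMap.toMatrix_apply, hF.frame.basis_apply,
    hK N W H₀ H₁ hF.isOpen hx hF.frame hF.structureEq j]
  simp [← hF.frame.basis_apply hx, Finsupp.single_apply]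

variable [FiniteDimensional ℝ E]

/-- If `W' = W P`, then `Q` and `N` are multiplied by `P` on the right and the Gram matrix becomes
`Pᵀ g P`, so `P` cancels in both expressions. Only `P` needs to be invertible, so time `0`, where
`Q` is singular, is included. -/
lemma IsAdaptedFrame.invariants_eq (hF : IsAdaptedFrame X 𝒱 W H₀ H₁ N)
    (hF' : IsAdaptedFrame X 𝒱 W' H₀' H₁' N') (hx : c t ∈ N) (hx' : c t ∈ N') :
    fieldMatrix p B (hor X W' H₁') t * Ring.inverse (frameMatrix p B W' t) =
      fieldMatrix p B (hor X W H₁) t * Ring.inverse (frameMatrix p B W t) ∧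
    fieldMatrix p B (hor X W' H₁') t * (gramMatrix g W' t)⁻¹ * (frameMatrix p B W' t).transpose =
      fieldMatrix p B (hor X W H₁) t * (gramMatrix g W t)⁻¹ *
        (frameMatrix p B W t).transpose := by
  obtain ⟨P, hP, h⟩ := hF.frame.exists_isUnit hF'.frame hx hx'
  have h1 : frameMatrix p B W' t = frameMatrix p B W t * P := by
    refine fieldMatrix_eq_mul fun j => ?_
    rw [h j, AddSubmonoidClass.coe_finsetSum]
    rfl
  have h2 : fieldMatrix p B (hor X W' H₁') t = fieldMatrix p B (hor X W H₁) t * P :=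
    fieldMatrix_eq_mul fun j => hF.hor_eq_sum hF' hx hx' (h j)
  have h3 : gramMatrix g W' t = P.transpose * gramMatrix g W t * P := gramMatrix_eq_mul h
  have hd : IsUnit P.det := (Matrix.isUnit_iff_isUnit_det P).1 hP
  have hdt : IsUnit P.transpose.det := by rwa [Matrix.det_transpose]
  rw [h1, h2, h3]
  constructor
  · rw [← Matrix.nonsing_inv_eq_ringInverse, ← Matrix.nonsing_inv_eq_ringInverse,
      Matrix.mul_inv_rev, mul_assoc, ← mul_assoc P, Matrix.mul_nonsing_inv _ hd, one_mul]
  · rw [Matrix.mul_inv_rev, Matrix.mul_inv_rev, Matrix.transpose_mul]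
    have e1 : P * P⁻¹ = 1 := Matrix.mul_nonsing_inv _ hd
    have e2 : P.transpose⁻¹ * P.transpose = 1 := Matrix.nonsing_inv_mul _ hdt
    calc _ = fieldMatrix p B (hor X W H₁) t * (P * P⁻¹) * (gramMatrix g W t)⁻¹ *
          (P.transpose⁻¹ * P.transpose) * (frameMatrix p B W t).transpose := by
          simp only [mul_assoc]
      _ = _ := by rw [e1, e2, mul_one, mul_one]

theorem IsAdaptedFrame.jacobiData {J : Set ℝ} {κ : ℝ} {S R : ℝ → Matrix (Fin m) (Fin m) ℝ}
    (hF : IsAdaptedFrame X 𝒱 W H₀ H₁ N) (ht : t ∈ J) (hct : c t ∈ N) (hB : IsPullback X c J B)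
    (hg : IsPosDefMetricAlong 𝒱 c J g) (hpar : IsParallelAlong X 𝒱 c J g)
    {K : 𝒱 (c t) →ₗ[ℝ] 𝒱 (c t)} (hK : IsCurvatureAt X 𝒱 m (c t) K)
    (hsymm : ∀ v w, g t (K v) w = g t v (K w)) (htr : κ ≤ LinearMap.trace ℝ _ K)
    (hQ : 0 < t → IsUnit (frameMatrix p B W t))
    (hS : S t = fieldMatrix p B (hor X W H₁) t * Ring.inverse (frameMatrix p B W t))
    (hR : R t = fieldMatrix p B (hor X W H₁) t * (gramMatrix g W t)⁻¹ *
        (frameMatrix p B W t).transpose) :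
    JacobiData J κ S R (frameMatrix p B W) (fieldMatrix p B (hor X W H₁))
      (fun τ => (gramMatrix g W τ)⁻¹) (fun τ => H₁ (c τ))
      (fun τ => curvatureMatrix X H₀ H₁ (c τ)) t := by
  have hpd := posDef_gramMatrix hg ht hF.frame hct
  have hgu : IsUnit (gramMatrix g W t).det := (Matrix.isUnit_iff_isUnit_det _).1 hpd.isUnit
  have hginv : (gramMatrix g W t)⁻¹ * gramMatrix g W t = 1 := Matrix.nonsing_inv_mul _ hgu
  have hginv' : gramMatrix g W t * (gramMatrix g W t)⁻¹ = 1 := Matrix.mul_nonsing_inv _ hgu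
  refine ⟨?_, ?_, ?_, hpd.inv, ?_, ?_, hR, hQ, fun _ => hS⟩
  · refine hasDerivWithinAt_matrix.2 fun i j => ?_
    have h := hB.hasDerivWithinAt_frame hF ht hct ((ContinuousLinearMap.proj i).comp p) j
    refine h.congr_deriv ?_
    simp [frameMatrix, fieldMatrix, Matrix.mul_apply, Finset.mul_sum, mul_comm, mul_left_comm,
      mul_assoc]
  · refine hasDerivWithinAt_matrix.2 fun i j => ?_
    have h := hB.hasDerivWithinAt_hor hF ht hct ((ContinuousLinearMap.proj i).comp p) j
    refine h.congr_deriv ?_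
    simp [frameMatrix, fieldMatrix, Matrix.mul_apply, Finset.mul_sum, mul_comm, mul_left_comm,
      mul_assoc]
  · have h1 : HasDerivWithinAt (gramMatrix g W) ((1 / 2 : ℝ) • ((H₁ (c t)).transpose *
        gramMatrix g W t + gramMatrix g W t * H₁ (c t))) J t := by
      refine hasDerivWithinAt_matrix.2 fun i j => ?_
      refine (hpar t ht N (W i) (W j) hF.isOpen hct (hF.frame.smooth i)
        (hF.frame.smooth j)).congr_deriv ?_
      rw [hF.covDeriv_eq hct, hF.covDeriv_eq hct]
      simp [gramMatrix, Matrix.mul_apply, map_sum, LinearMap.sum_apply, Finset.mul_sum, mul_add,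
        mul_comm, mul_left_comm, mul_assoc]
    have h2 := hasDerivWithinAt_ringInverse h1 hpd.isUnit
    simp only [← Matrix.nonsing_inv_eq_ringInverse] at h2
    refine h2.congr_deriv ?_
    set G := (gramMatrix g W t)⁻¹
    have hG : ∀ Z, G * (gramMatrix g W t * Z) = Z := fun Z => by
      rw [← mul_assoc, hginv, one_mul]
    simp only [mul_add, add_mul, smul_mul_assoc, mul_smul_comm, mul_assoc, hginv', hG, mul_one]
    module
  -- Symmetry of `K` reads `Kᵀ g = g K` in the frame; multiplying by `g⁻¹` on both sides turns it
  -- into the condition for the inverse Gram matrix.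
  · have h1 : (curvatureMatrix X H₀ H₁ (c t)).transpose * gramMatrix g W t =
        gramMatrix g W t * curvatureMatrix X H₀ H₁ (c t) := by
      ext i j
      have := hsymm (W i (c t)) (W j (c t))
      rw [hK N W H₀ H₁ hF.isOpen hct hF.frame hF.structureEq,
        hK N W H₀ H₁ hF.isOpen hct hF.frame hF.structureEq] at this
      simpa [gramMatrix, Matrix.mul_apply, map_sum, LinearMap.sum_apply, mul_comm] using this
    calc _ = (gramMatrix g W t)⁻¹ * (gramMatrix g W t * curvatureMatrix X H₀ H₁ (c t)) *
          (gramMatrix g W t)⁻¹ := by rw [← mul_assoc, hginv, one_mul]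
      _ = _ := by rw [← h1, mul_assoc, mul_assoc, hginv', mul_one]
  · rwa [LinearMap.trace_eq_matrix_trace ℝ (hF.frame.basis hct), hF.toMatrix_curvature hct hK]
      at htr

end FrameMatrices

/-! ### Conjugate times and the comparison argument -/

section Comparison

variable {E : Type*} [NormedAddCommGroup E] [NormedSpace ℝ E]

variable {M : Type*} [TopologicalSpace M] [ChartedSpace E M]
  {X : ∀ x : M, TangentSpace 𝓘(ℝ, E) x} {𝒱 : ∀ x : M, Submodule ℝ (TangentSpace 𝓘(ℝ, E) x)}
  {m : ℕ} {U : Set M} {c : ℝ → M}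

/-- A vertical vector at `c t` that is pulled back to a vertical vector at `c 0` gives a conjugate
time. -/
lemma isConjugateTime_of_mem {A : E →L[ℝ] E} {t : ℝ} (ht : 0 < t) (hfl : flow X U t (c 0) = c t)
    (hA : HasMFDerivAt 𝓘(ℝ, E) 𝓘(ℝ, E) (flow X U t) (c 0) A) {v : TangentSpace 𝓘(ℝ, E) (c t)}
    (hv : v ∈ 𝒱 (c t)) (hv0 : v ≠ 0) {w : TangentSpace 𝓘(ℝ, E) (c 0)} (hw : w ∈ 𝒱 (c 0))
    (h : A w = v) : IsConjugateTime X 𝒱 U (c 0) t := by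
  refine ⟨ht, ?_⟩
  have hA' : mfderiv 𝓘(ℝ, E) 𝓘(ℝ, E) (flow X U t) (c 0) = A := hA.mfderiv
  intro hbot
  -- The points `flow X U t (c 0)` and `c t` are equal but not definitionally so; membership in `𝒱`
  -- is transported along this equality.
  have key : ∀ y : M, y = c t → ∀ z : E, (z : TangentSpace 𝓘(ℝ, E) (c t)) ∈ 𝒱 (c t) →
      (z : TangentSpace 𝓘(ℝ, E) y) ∈ 𝒱 y := by
    rintro _ rfl z hz
    exact hz
  have hmem : (mfderiv 𝓘(ℝ, E) 𝓘(ℝ, E) (flow X U t) (c 0) w) ∈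
      (𝒱 (c 0)).map (mfderiv 𝓘(ℝ, E) 𝓘(ℝ, E) (flow X U t) (c 0)).toLinearMap ⊓
        𝒱 (flow X U t (c 0)) := by
    refine ⟨⟨w, hw, rfl⟩, key _ hfl _ ?_⟩
    rw [hA']
    exact h ▸ hv
  rw [hbot, Submodule.mem_bot, hA'] at hmem
  exact hv0 (h.symm.trans hmem)

/-- Coordinates with respect to a linearly independent family, and the projection along its span. -/
lemma exists_coordinates [FiniteDimensional ℝ E] {ι : Type*} [Fintype ι] [DecidableEq ι] {v : ι → E}
    (hv : LinearIndependent ℝ v) : ∃ (l : E →L[ℝ] (ι → ℝ)) (L : E →L[ℝ] E),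
      (∀ i, l (v i) = Pi.single i 1) ∧ (∀ i, L (v i) = 0) ∧
      ∀ x, L x = 0 → x = ∑ i, l x i • v i := by
  obtain ⟨l, hl⟩ := LinearMap.exists_leftInverse_of_injective (Fintype.linearCombination ℝ v)
    (LinearMap.ker_eq_bot.2 hv.fintypeLinearCombination_injective)
  have h1 : ∀ i, l (v i) = Pi.single i 1 := fun i => by
    have := LinearMap.congr_fun hl (Pi.single i 1)
    simpa [Fintype.linearCombination_apply_single] using this
  refine ⟨LinearMap.toContinuousLinearMap l, LinearMap.toContinuousLinearMap
    (LinearMap.id - Fintype.linearCombination ℝ v ∘ₗ l), h1, fun i => ?_, fun x hx => ?_⟩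
  · simp [h1, Fintype.linearCombination_apply_single]
  · have : x - Fintype.linearCombination ℝ v (l x) = 0 := hx
    simpa [Fintype.linearCombination_apply] using sub_eq_zero.1 this

variable [IsManifold 𝓘(ℝ, E) ∞ M]

lemma IsRegularOn.pos_of_trace_pos (hreg : IsRegularOn X 𝒱 m U) {x : M} (hx : x ∈ U)
    {K : 𝒱 x →ₗ[ℝ] 𝒱 x} (hK : 0 < LinearMap.trace ℝ _ K) : 0 < m := by
  rcases Nat.eq_zero_or_pos m with rfl | h
  · obtain ⟨N, W, -, hxN, hW⟩ := hreg.smooth_distribution x hx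
    rw [LinearMap.trace_eq_matrix_trace ℝ (hW.basis hxN), Matrix.trace_fin_zero] at hK
    exact absurd hK (lt_irrefl _)
  · exact h

/-- If there is no conjugate time up to time `π / k`, then the trace of the curvature cannot stay
above `m k²`. -/
theorem exists_isConjugateTime [FiniteDimensional ℝ E] [T2Space M] {T : EReal} {k b : ℝ} (hU : IsOpen U)
    (hreg : IsRegularOn X 𝒱 m U) (hT : 0 < T) (hc : IsMIntegralCurveOn c X (timeInterval T))
    (hcU : MapsTo c (timeInterval T) U) (g : ∀ t : ℝ, LinearMap.BilinForm ℝ (𝒱 (c t)))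
    (hg : IsPosDefMetricAlong 𝒱 c (timeInterval T) g)
    (hpar : IsParallelAlong X 𝒱 c (timeInterval T) g)
    (hsymm : ∀ t ∈ timeInterval T, ∀ v w : 𝒱 (c t),
      g t (curvature X 𝒱 m (c t) v) w = g t v (curvature X 𝒱 m (c t) w))
    (hm : 0 < m) (hk : 0 < k) (hbk : b = Real.pi / k)
    (htr : ∀ t ∈ timeInterval T, m * k ^ 2 ≤ LinearMap.trace ℝ _ (curvature X 𝒱 m (c t)))
    (hb : (b : EReal) < T) : ∃ t, 0 < t ∧ t ≤ b ∧ IsConjugateTime X 𝒱 U (c 0) t := by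
  classical
  have : CompleteSpace E := FiniteDimensional.complete ℝ E
  by_contra! hno
  have hb0 : 0 < b := by rw [hbk]; positivity
  have hsub : Icc 0 b ⊆ timeInterval T := fun t ht =>
    mem_timeInterval_of_le (t := b) ⟨hb0.le, hb⟩ ht.1 ht.2
  have h0J : (0 : ℝ) ∈ Icc 0 b := left_mem_Icc.2 hb0.le
  obtain ⟨A, B, hB0, hAB⟩ := exists_pullback hU hreg.smooth_field hc hT hcU
  have hB : IsPullback X c (Icc 0 b) B := fun t ht Y hY =>
    ((hAB t (hsub ht)).2.2.2 Y hY).mono hsub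
  have hcc : ContinuousOn c (Icc 0 b) := hc.continuousOn.mono hsub
  have hcU' : MapsTo c (Icc 0 b) U := fun t ht => hcU (hsub ht)
  obtain ⟨N₀, W₀, P₀, P₁, hx₀, hF₀⟩ := hreg.exists_isAdaptedFrame hU (hcU' h0J)
  let v : Fin m ⊕ Fin m → E := Sum.elim (fun i => (W₀ i (c 0) : TangentSpace 𝓘(ℝ, E) (c 0)))
    fun i => hor X W₀ P₁ i (c 0)
  have hv : LinearIndependent ℝ v := hF₀.linearIndependent_hor hx₀
  obtain ⟨l, L, hl, hL, hlL⟩ := exists_coordinates hv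
  -- `p` takes the coordinates along `ℋ(c 0)`. On `𝒱 ⊕ ℋ` at `c 0` its kernel is `𝒱`; the map `L`
  -- vanishes exactly on this sum.
  let p : E →L[ℝ] (Fin m → ℝ) :=
    ContinuousLinearMap.pi fun i => (ContinuousLinearMap.proj (Sum.inr i)).comp l
  have hBW : ∀ i, B 0 (W₀ i (c 0)) = v (.inl i) := fun i => hB0 _
  have hBh : ∀ i, B 0 (hor X W₀ P₁ i (c 0)) = v (.inr i) := fun i => hB0 _
  have hLB : ∀ t ∈ Icc 0 b, ∀ w ∈ 𝒱 (c t), L (B t w) = 0 := fun t ht => by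
    refine (hB.forall_mem_eq_zero hreg hU hcc hcU' L
      ((hF₀.forall_mem_iff hx₀ (L.toLinearMap ∘ₗ B 0)).2 ?_) ht).1
    refine Prod.ext (funext fun j => ?_) (funext fun j => ?_)
    · exact (congrArg L (hBW j)).trans (hL _)
    · exact (congrArg L (hBh j)).trans (hL _)
  -- A kernel vector of `Q` gives a nonzero vertical vector at `c t` whose pull-back lies in `𝒱 ⊕ ℋ`
  -- at `c 0` and has no horizontal component. The pull-back is thus vertical, and `t` would be
  -- conjugate.
  have hQ : ∀ t ∈ Icc 0 b, ∀ (N : Set M) (W : Fin m → ∀ x, 𝒱 x), IsFrameOn 𝒱 W N → c t ∈ N →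
      0 < t → IsUnit (frameMatrix p B W t) := by
    intro t ht N W hW hct ht0
    by_contra hu
    rw [Matrix.isUnit_iff_isUnit_det, isUnit_iff_ne_zero, not_not,
      ← Matrix.exists_mulVec_eq_zero_iff] at hu
    obtain ⟨a, ha, hQa⟩ := hu
    rw [frameMatrix, fieldMatrix_mulVec] at hQa
    set w : TangentSpace 𝓘(ℝ, E) (c t) := ∑ j, a j • (W j (c t) : TangentSpace 𝓘(ℝ, E) (c t))
      with hw
    have hwV : w ∈ 𝒱 (c t) := Submodule.sum_mem _ fun j _ => Submodule.smul_mem _ _ (W j _).2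
    have hw0 : w ≠ 0 := fun h0 => ha (funext fun j =>
      Fintype.linearIndependent_iff.1 (hW.linearIndependent_coe hct) a h0 j)
    have hx := hlL _ (hLB t ht w hwV)
    rw [Fintype.sum_sum_type] at hx
    have hr : ∀ i, l (B t w) (.inr i) = 0 := fun i => congrFun hQa i
    simp only [hr, zero_smul, Finset.sum_const_zero, add_zero] at hx
    have hmem : ∀ z : E, z = ∑ i, l (B t w) (.inl i) • v (.inl i) →
        (z : TangentSpace 𝓘(ℝ, E) (c 0)) ∈ 𝒱 (c 0) := by
      rintro _ rfl
      exact Submodule.sum_mem (𝒱 (c 0)) fun i _ => Submodule.smul_mem _ _ (W₀ i (c 0)).2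
    obtain ⟨hfl, hA, hABt, -⟩ := hAB t (hsub ht)
    exact hno t ht0 ht.2 (isConjugateTime_of_mem ht0 hfl hA hwV hw0 (hmem _ hx) (hABt w))
  -- Frame independence allows one choice of `S` and `R` along the whole curve. Where no adapted
  -- frame exists, outside the range of interest, they are set to `0`.
  have hSR : ∀ t, ∃ S R : Matrix (Fin m) (Fin m) ℝ, ∀ (N : Set M) (W : Fin m → ∀ x, 𝒱 x)
      (H₀ H₁ : M → Matrix (Fin m) (Fin m) ℝ), IsAdaptedFrame X 𝒱 W H₀ H₁ N → c t ∈ N →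
      S = fieldMatrix p B (hor X W H₁) t * Ring.inverse (frameMatrix p B W t) ∧
      R = fieldMatrix p B (hor X W H₁) t * (gramMatrix g W t)⁻¹ *
        (frameMatrix p B W t).transpose := by
    intro t
    by_cases h : ∃ (N : Set M) (W : Fin m → ∀ x, 𝒱 x)
      (H₀ H₁ : M → Matrix (Fin m) (Fin m) ℝ), IsAdaptedFrame X 𝒱 W H₀ H₁ N ∧ c t ∈ N
    · obtain ⟨N, W, H₀, H₁, hF, hct⟩ := h
      exact ⟨_, _, fun N' W' H₀' H₁' hF' hct' => hF'.invariants_eq hF hct' hct⟩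
    · exact ⟨0, 0, fun N W H₀ H₁ hF hct => absurd ⟨N, W, H₀, H₁, hF, hct⟩ h⟩
  choose S R hSR using hSR
  have hdata : ∀ t ∈ Icc 0 b, ∀ (N : Set M) (W : Fin m → ∀ x, 𝒱 x)
      (H₀ H₁ : M → Matrix (Fin m) (Fin m) ℝ), IsAdaptedFrame X 𝒱 W H₀ H₁ N → c t ∈ N →
      ∀ᶠ τ in 𝓝[Icc 0 b] t, JacobiData (Icc 0 b) (m * k ^ 2) S R (frameMatrix p B W)
        (fieldMatrix p B (hor X W H₁)) (fun τ => (gramMatrix g W τ)⁻¹) (fun τ => H₁ (c τ))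
        (fun τ => curvatureMatrix X H₀ H₁ (c τ)) τ := by
    intro t ht N W H₀ H₁ hF hct
    filter_upwards [self_mem_nhdsWithin, (hcc t ht) (hF.isOpen.mem_nhds hct)] with τ hτ hcτ
    exact hF.jacobiData hτ hcτ hB (fun s hs => hg s (hsub hs))
      (fun s hs N Y Z hN hsN hY hZ => (hpar s (hsub hs) N Y Z hN hsN hY hZ).mono hsub)
      (hreg.isCurvatureAt_curvature hU (hcU' hτ)) (hsymm τ (hsub hτ)) (htr τ (hsub hτ))
      (hQ τ hτ N W hF.frame hcτ) (hSR τ N W H₀ H₁ hF hcτ).1 (hSR τ N W H₀ H₁ hF hcτ).2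
  refine JacobiData.false_of_forall_exists (S := S) (B := R) hm hk hbk fun t ht => ?_
  -- At time `0` the frame that defines `p` is used: in it `Q 0 = 0` and `N 0 = 1`. At later times
  -- any adapted frame will do.
  rcases eq_or_ne t 0 with rfl | ht0
  · refine ⟨_, _, _, _, _, hdata 0 ht N₀ W₀ P₀ P₁ hF₀ hx₀, fun _ => ⟨?_, ?_⟩⟩
    · ext i j
      have : l (B 0 (W₀ j (c 0))) (.inr i) = 0 := by
        rw [hBW, hl]
        simp
      exact this
    · have h1 : fieldMatrix p B (hor X W₀ P₁) 0 = 1 := by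
        ext i j
        have : l (B 0 (hor X W₀ P₁ j (c 0))) (.inr i) = (1 : Matrix (Fin m) (Fin m) ℝ) i j := by
          rw [hBh, hl, Matrix.one_apply]
          simp [Pi.single_apply]
        exact this
      rw [h1]
      exact isUnit_one
  · obtain ⟨N, W, H₀, H₁, hxN, hF⟩ := hreg.exists_isAdaptedFrame hU (hcU' ht)
    exact ⟨_, _, _, _, _, hdata t ht N W H₀ H₁ hF hxN, fun h => absurd h ht0⟩

end Comparison

end DynamicPair

end

theorem theorem2
    {E : Type*} [NormedAddCommGroup E] [NormedSpace ℝ E] [FiniteDimensional ℝ E]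
    {M : Type*} [TopologicalSpace M] [T2Space M] [ChartedSpace E M] [IsManifold 𝓘(ℝ, E) ∞ M]
    (X : ∀ x : M, TangentSpace 𝓘(ℝ, E) x)
    (𝒱 : ∀ x : M, Submodule ℝ (TangentSpace 𝓘(ℝ, E) x)) (m : ℕ)
    (U : Set M) (hU : IsOpen U) (hreg : DynamicPair.IsRegularOn X 𝒱 m U)
    (T : EReal) (hT : 0 < T) (c : ℝ → M)
    (hc : IsMIntegralCurveOn c X (DynamicPair.timeInterval T))
    (hcU : Set.MapsTo c (DynamicPair.timeInterval T) U)
    (hclosed : ∀ t ∈ DynamicPair.timeInterval T, 0 < t → c t ≠ c 0)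
    (g : ∀ t : ℝ, LinearMap.BilinForm ℝ (𝒱 (c t)))
    (hg : DynamicPair.IsPosDefMetricAlong 𝒱 c (DynamicPair.timeInterval T) g)
    (hpar : DynamicPair.IsParallelAlong X 𝒱 c (DynamicPair.timeInterval T) g)
    (hsymm : ∀ t ∈ DynamicPair.timeInterval T, ∀ v w : 𝒱 (c t),
      g t (DynamicPair.curvature X 𝒱 m (c t) v) w = g t v (DynamicPair.curvature X 𝒱 m (c t) w))
    (κ : ℝ) (hκ : 0 < κ)
    (htr : ∀ t ∈ DynamicPair.timeInterval T,
      κ ≤ LinearMap.trace ℝ (𝒱 (c t)) (DynamicPair.curvature X 𝒱 m (c t)))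
    (hTstar : ((Real.pi * Real.sqrt (m / κ) : ℝ) : EReal) < T) :
    ∃ t : ℝ, 0 < t ∧ t ≤ Real.pi * Real.sqrt (m / κ) ∧
      DynamicPair.IsConjugateTime X 𝒱 U (c 0) t := by
  have h0 : (0 : ℝ) ∈ DynamicPair.timeInterval T := DynamicPair.zero_mem_timeInterval hT
  have hm : 0 < m := hreg.pos_of_trace_pos (hcU h0) (hκ.trans_le (htr 0 h0))
  have hmR : (0 : ℝ) < m := Nat.cast_pos.2 hm
  -- The comparison frequency is `k = √(κ / m)`, so that `m k² = κ` and `π / k = π √(m / κ)`.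
  have hk : (m : ℝ) * Real.sqrt (κ / m) ^ 2 = κ := by
    rw [Real.sq_sqrt (by positivity)]
    field_simp
  have hb : Real.pi * Real.sqrt (m / κ) = Real.pi / Real.sqrt (κ / m) := by
    rw [div_eq_mul_inv Real.pi, ← Real.sqrt_inv, inv_div]
  exact DynamicPair.exists_isConjugateTime hU hreg hT hc hcU g hg hpar hsymm hm
    (Real.sqrt_pos.2 (div_pos hκ hmR)) hb (fun t ht => hk.le.trans (htr t ht)) hTstar
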